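/- A finite set of points in the plane is in general orthogonal position if no two of its points share an $x$-coordinate or a $y$-coordinate. A planar L-shaped drawing of a graph $G$ on a point set $P$ places the vertices of $G$ at distinct points of $P$ (points of $P$ may stay unused) and draws every edge $uv$ as an orthogonal path with exactly one bend, that is, one horizontal and one vertical segment joining the points of $u$ and $v$, such that no edge passes through a vertex other than its end points and any two distinct edges meet only at common end points. Theorem. Let $T$ be a tree with $n \ge 1$ nodes and maximum degree at most $4$ (a ternary tree), and let $P$ be a finite set of points in the plane, in general orthogonal position, with $|P| \ge 2n^{1.55}$. Then $T$ has a planar L-shaped drawing on $P$. -/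

import Mathlib

/-- A set of points in the plane is in *general orthogonal position* if no two of its points
share an `x`-coordinate or a `y`-coordinate. -/
def GeneralOrthogonalPosition (P : Set (ℝ × ℝ)) : Prop :=
  ∀ p ∈ P, ∀ q ∈ P, p ≠ q → p.1 ≠ q.1 ∧ p.2 ≠ q.2

/-- The curve that represents an edge `e` with bend `b`, when the vertices are placed by `pos`:
for `e = s(u, v)` it is the union of the segment from `pos u` to `b` and the segment from `b`
to `pos v`. -/
def edgeCurve {V : Type*} (pos : V → ℝ × ℝ) (b : ℝ × ℝ) (e : Sym2 V) : Set (ℝ × ℝ) :=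
  {x | ∃ v ∈ e, x ∈ segment ℝ (pos v) b}

/-- A planar L-shaped drawing of the graph `G` on the point set `P` (not all points of `P` need
to be used). Every edge is drawn as an orthogonal path with one bend. -/
structure PlanarLDrawing {V : Type*} (G : SimpleGraph V) (P : Set (ℝ × ℝ)) where
  /-- the placement of the vertices -/
  pos : V → ℝ × ℝ
  pos_mem : ∀ v, pos v ∈ P
  pos_injective : Function.Injective pos
  /-- the bend of each edge (irrelevant on pairs that are not edges) -/
  bend : Sym2 V → ℝ × ℝ
  /-- the bend lies at one of the two other corners of the axis-parallel rectangle spanned by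
  the end points of the edge -/
  bend_eq : ∀ u v, G.Adj u v →
    bend s(u, v) = ((pos u).1, (pos v).2) ∨ bend s(u, v) = ((pos v).1, (pos u).2)
  /-- an edge passes through no vertex other than its end points -/
  vertex_mem : ∀ e ∈ G.edgeSet, ∀ w, pos w ∈ edgeCurve pos (bend e) e → w ∈ e
  /-- two distinct edges meet only at common end points -/
  edges_meet : ∀ e ∈ G.edgeSet, ∀ e' ∈ G.edgeSet, e ≠ e' →
    ∀ x ∈ edgeCurve pos (bend e) e, x ∈ edgeCurve pos (bend e') e' →
      ∃ v, v ∈ e ∧ v ∈ e' ∧ x = pos v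

/-!
The tree is rooted at a vertex of degree at most `3`, so that every node has at most three
children, and the children of every node are ordered by size. It is drawn from the leaves to the
root, and two numbers measure how many points a subtree needs. `Hcap T m` says that `T` can be
hung on a point `z` by an edge that leaves `z` in a prescribed direction, using any `m` points on
that side of `z`; `Fcap T m` says that `T` can be drawn on any `m` points with the ray above its
root left free. Reflections of the plane give the other directions. A drawing hung on `z` stays in
the bounding box of `z` and the points used, and before it reaches the first of these points it
uses only the ray from `z` (`RightReg` and its analogues). So crossings are excluded by cutting
the point set along lines.

Let the subtrees `A`, `B`, `C` of a node, in increasing order of size, need `a`, `b`, `c` points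
in the sense of `Hcap`, and let `C` need `f` points in the sense of `Fcap`. Simple constructions
show that `a + b + c + 1` and also `f + 2 (a + b) + 1` points suffice for `Fcap`
(`Fcap.node_of_strips`, `Fcap.node_of_lower`), and that `c + 2 (a + b) + 1` points suffice for
`Hcap` (`Hcap.node_of_strips`); the factors `2` are due to a choice between the two sides of a
line. With bounds of about `2 n ^ 1.55` for `Hcap` and `1.6 n ^ 1.55` for `Fcap`, the recursion
for `Fcap` closes, while the recursion for `Hcap` can fail only if `A` is small and `B` and `C`
have about half of the nodes each. Then the root `t` and the root `β` of `B` are placed together: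
`CornerCap A B e` says that `e` points suffice to draw `t` with `A` and `B` so that two rays from
`t` are free for `C` and for the edge to the parent, which gives `c + 2 e - 1` for `Hcap`
(`Hcap.node_of_corner`). Placing `t` and `β` together, the subtrees `B'` and `C'` of `B` hang on
`β` in regions of their own, and only the points spent for the small subtrees are multiplied by
larger constants. This is `CornerCap.node_of_strips`, and `CornerCap.node_of_left` in the case
that `C'` makes up almost all of `B`; the latter uses that `Fcap` is cheaper than `Hcap`.

The numerical part (`FBound.node`, `HBound.node`) compares the sums with `n ^ 1.55` by means of
chords of this convex function. Finally, the recursively defined drawings `Body` are translated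
into `PlanarLDrawing` by gluing partial drawings along one edge at a time (`IsDrawing.glue`).
-/

section

variable {V : Type*}

/-! ### Rooted trees and their drawings -/

/-- Rooted trees with labelled nodes in which every node has at most three children; an absent
child is the empty tree `nil`. -/
inductive TTree (V : Type*) where
  | nil : TTree V
  | node (v : V) (a b c : TTree V) : TTree V

/-- The number of nodes of a tree. -/
def TTree.size {V : Type*} : TTree V → ℕ
  | nil => 0
  | node _ a b c => 1 + a.size + b.size + c.size

/-- The L-shaped path from `z` to `t` that leaves `z` horizontally and reaches `t` vertically.
The path that leaves `z` vertically is `hPath t z`. -/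
def hPath (z t : ℝ × ℝ) : Set (ℝ × ℝ) :=
  {p | (p.2 = z.2 ∧ (z.1 ≤ p.1 ∧ p.1 ≤ t.1 ∨ t.1 ≤ p.1 ∧ p.1 ≤ z.1)) ∨
    (p.1 = t.1 ∧ (z.2 ≤ p.2 ∧ p.2 ≤ t.2 ∨ t.2 ≤ p.2 ∧ p.2 ≤ z.2))}

/-- `Link D z U`: the set `U` consists of an L-shaped edge `e` from `z` to the root `t` of a drawing
`K` (as specified by `D t K`) and of that drawing; the edge meets the drawing only in `t`, and the
point `z` itself is left out of `U`, so that several such sets at the same `z` can be disjoint. -/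
def Link (D : ℝ × ℝ → Set (ℝ × ℝ) → Prop) (z : ℝ × ℝ) (U : Set (ℝ × ℝ)) : Prop :=
  ∃ t K e, D t K ∧ z ≠ t ∧ (e = hPath z t ∨ e = hPath t z) ∧ (∀ p ∈ e, p ∈ K → p = t) ∧
    U = {p | (p ∈ e ∨ p ∈ K) ∧ p ≠ z}

/-- `Body S T t K`: the tree `T` has a planar L-shaped drawing with vertices in `S`, with its root
at `t`, in which `K` is the union of all vertices and edges. The labels of the nodes play no role.
The empty tree has no such drawing; an absent child contributes the empty set. -/
def Body {V : Type*} (S : Set (ℝ × ℝ)) : TTree V → ℝ × ℝ → Set (ℝ × ℝ) → Prop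
  | .nil => fun _ _ => False
  | .node _ a b c => fun t K => t ∈ S ∧ ∃ Ua Ub Uc,
      (a = .nil ∧ Ua = ∅ ∨ Link (Body S a) t Ua) ∧
      (b = .nil ∧ Ub = ∅ ∨ Link (Body S b) t Ub) ∧
      (c = .nil ∧ Uc = ∅ ∨ Link (Body S c) t Uc) ∧
      (∀ p ∈ Ua, p ∉ Ub) ∧ (∀ p ∈ Ua, p ∉ Uc) ∧ (∀ p ∈ Ub, p ∉ Uc) ∧
      K = {p | p = t ∨ p ∈ Ua ∨ p ∈ Ub ∨ p ∈ Uc}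

/-- `Arm S T z U`: the set `U` is a drawing of `T` with vertices in `S`, together with an edge that
hangs it on the point `z`; the empty tree has the empty arm. -/
def Arm {V : Type*} (S : Set (ℝ × ℝ)) (T : TTree V) (z : ℝ × ℝ) (U : Set (ℝ × ℝ)) : Prop :=
  T = .nil ∧ U = ∅ ∨ Link (Body S T) z U

theorem Link.mono {D D' : ℝ × ℝ → Set (ℝ × ℝ) → Prop} (h : ∀ t K, D t K → D' t K)
    {z : ℝ × ℝ} {U : Set (ℝ × ℝ)} (hU : Link D z U) : Link D' z U := by
  obtain ⟨t, K, e, h1, h2⟩ := hU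
  exact ⟨t, K, e, h _ _ h1, h2⟩

theorem Body.mono {S S' : Set (ℝ × ℝ)} (h : S ⊆ S') {T : TTree V} :
    ∀ {t : ℝ × ℝ} {K : Set (ℝ × ℝ)}, Body S T t K → Body S' T t K := by
  induction T with
  | nil => intro t K hB; exact hB.elim
  | node v a b c iha ihb ihc =>
    rintro t K ⟨ht, Ua, Ub, Uc, ha, hb, hc, hd⟩
    exact ⟨h ht, Ua, Ub, Uc, ha.imp id (Link.mono fun _ _ => iha),
      hb.imp id (Link.mono fun _ _ => ihb), hc.imp id (Link.mono fun _ _ => ihc), hd⟩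

theorem Arm.mono {S S' : Set (ℝ × ℝ)} (h : S ⊆ S') {T : TTree V} {z : ℝ × ℝ} {U : Set (ℝ × ℝ)}
    (hU : Arm S T z U) : Arm S' T z U :=
  hU.imp id (Link.mono fun _ _ => Body.mono h)

theorem Body.node {S : Set (ℝ × ℝ)} {a b c : TTree V} {t : ℝ × ℝ} {Ua Ub Uc : Set (ℝ × ℝ)} (v : V)
    (ht : t ∈ S) (ha : Arm S a t Ua) (hb : Arm S b t Ub) (hc : Arm S c t Uc)
    (hab : ∀ p ∈ Ua, p ∉ Ub) (hac : ∀ p ∈ Ua, p ∉ Uc) (hbc : ∀ p ∈ Ub, p ∉ Uc) :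
    Body S (.node v a b c) t {p | p = t ∨ p ∈ Ua ∨ p ∈ Ub ∨ p ∈ Uc} :=
  ⟨ht, Ua, Ub, Uc, ha, hb, hc, hab, hac, hbc, rfl⟩

theorem Arm.hpath {S : Set (ℝ × ℝ)} {T : TTree V} {z t : ℝ × ℝ} {K : Set (ℝ × ℝ)}
    (hB : Body S T t K) (hz : z ≠ t) (h : ∀ p ∈ hPath z t, p ∈ K → p = t) :
    Arm S T z {p | (p ∈ hPath z t ∨ p ∈ K) ∧ p ≠ z} :=
  Or.inr ⟨t, K, _, hB, hz, Or.inl rfl, h, rfl⟩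

theorem Arm.vpath {S : Set (ℝ × ℝ)} {T : TTree V} {z t : ℝ × ℝ} {K : Set (ℝ × ℝ)}
    (hB : Body S T t K) (hz : z ≠ t) (h : ∀ p ∈ hPath t z, p ∈ K → p = t) :
    Arm S T z {p | (p ∈ hPath t z ∨ p ∈ K) ∧ p ≠ z} :=
  Or.inr ⟨t, K, _, hB, hz, Or.inr rfl, h, rfl⟩

/-- The bounding box of a set of points. -/
def Hull (S : Set (ℝ × ℝ)) : Set (ℝ × ℝ) :=
  {p | (∃ q ∈ S, q.1 ≤ p.1) ∧ (∃ q ∈ S, p.1 ≤ q.1) ∧ (∃ q ∈ S, q.2 ≤ p.2) ∧ ∃ q ∈ S, p.2 ≤ q.2}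

theorem mem_hull_of_mem {S : Set (ℝ × ℝ)} {p : ℝ × ℝ} (h : p ∈ S) : p ∈ Hull S :=
  ⟨⟨p, h, le_rfl⟩, ⟨p, h, le_rfl⟩, ⟨p, h, le_rfl⟩, ⟨p, h, le_rfl⟩⟩

theorem hPath_subset_hull {S : Set (ℝ × ℝ)} {z t : ℝ × ℝ} (hz : z ∈ S) (ht : t ∈ S) :
    hPath z t ⊆ Hull S := by
  rintro p (⟨h1, h2 | h2⟩ | ⟨h1, h2 | h2⟩)
  · exact ⟨⟨z, hz, h2.1⟩, ⟨t, ht, h2.2⟩, ⟨z, hz, h1.ge⟩, ⟨z, hz, h1.le⟩⟩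
  · exact ⟨⟨t, ht, h2.1⟩, ⟨z, hz, h2.2⟩, ⟨z, hz, h1.ge⟩, ⟨z, hz, h1.le⟩⟩
  · exact ⟨⟨t, ht, h1.ge⟩, ⟨t, ht, h1.le⟩, ⟨z, hz, h2.1⟩, ⟨t, ht, h2.2⟩⟩
  · exact ⟨⟨t, ht, h1.ge⟩, ⟨t, ht, h1.le⟩, ⟨t, ht, h2.1⟩, ⟨z, hz, h2.2⟩⟩

theorem Body.root_mem {S : Set (ℝ × ℝ)} {T : TTree V} {t : ℝ × ℝ} {K : Set (ℝ × ℝ)}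
    (hB : Body S T t K) : t ∈ S := by
  cases T with
  | nil => exact hB.elim
  | node v a b c => exact hB.1

theorem Body.subset_hull {S : Set (ℝ × ℝ)} {T : TTree V} :
    ∀ {t : ℝ × ℝ} {K : Set (ℝ × ℝ)}, Body S T t K → K ⊆ Hull S := by
  induction T with
  | nil => intro t K hB; exact hB.elim
  | node v a b c iha ihb ihc =>
    have key : ∀ {x : TTree V} {t : ℝ × ℝ} {U : Set (ℝ × ℝ)}, t ∈ S →
        (∀ {t : ℝ × ℝ} {K : Set (ℝ × ℝ)}, Body S x t K → K ⊆ Hull S) →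
        (x = .nil ∧ U = ∅ ∨ Link (Body S x) t U) → U ⊆ Hull S := by
      rintro x t U ht ih (⟨-, rfl⟩ | ⟨t', K, e, hB, -, he, -, rfl⟩) p hp
      · exact hp.elim
      · rcases hp.1 with hp | hp
        · rcases he with rfl | rfl
          · exact hPath_subset_hull ht hB.root_mem hp
          · exact hPath_subset_hull hB.root_mem ht hp
        · exact ih hB hp
    rintro t K ⟨ht, Ua, Ub, Uc, ha, hb, hc, -, -, -, rfl⟩ p (rfl | hp | hp | hp)
    · exact mem_hull_of_mem ht
    · exact key ht iha ha hp
    · exact key ht ihb hb hp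
    · exact key ht ihc hc hp

theorem Arm.subset_hull {S : Set (ℝ × ℝ)} {T : TTree V} {z : ℝ × ℝ} {U : Set (ℝ × ℝ)}
    (hz : z ∈ S) (h : Arm S T z U) : U ⊆ Hull S := by
  rcases h with ⟨-, rfl⟩ | ⟨t', K, e, hB, -, he, -, rfl⟩
  · exact Set.empty_subset _
  · rintro p ⟨hp | hp, -⟩
    · rcases he with rfl | rfl
      · exact hPath_subset_hull hz hB.root_mem hp
      · exact hPath_subset_hull hB.root_mem hz hp
    · exact hB.subset_hull hp

theorem Arm.ne {S : Set (ℝ × ℝ)} {T : TTree V} {z : ℝ × ℝ} {U : Set (ℝ × ℝ)}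
    (h : Arm S T z U) {p : ℝ × ℝ} (hp : p ∈ U) : p ≠ z := by
  rcases h with ⟨-, rfl⟩ | ⟨t', K, e, hB, -, he, -, rfl⟩
  · exact hp.elim
  · exact hp.2

/-! ### Reflections -/

/-- The reflection in the vertical axis. -/
def flipX (p : ℝ × ℝ) : ℝ × ℝ := (-p.1, p.2)

@[simp] theorem flipX_fst (p : ℝ × ℝ) : (flipX p).1 = -p.1 := rfl
@[simp] theorem flipX_snd (p : ℝ × ℝ) : (flipX p).2 = p.2 := rfl
@[simp] theorem flipX_flipX (p : ℝ × ℝ) : flipX (flipX p) = p := by simp [flipX]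

/-- The reflection in the antidiagonal. -/
def antiswap (p : ℝ × ℝ) : ℝ × ℝ := (-p.2, -p.1)

@[simp] theorem antiswap_fst (p : ℝ × ℝ) : (antiswap p).1 = -p.2 := rfl
@[simp] theorem antiswap_snd (p : ℝ × ℝ) : (antiswap p).2 = -p.1 := rfl
@[simp] theorem antiswap_antiswap (p : ℝ × ℝ) : antiswap (antiswap p) = p := by simp [antiswap]

theorem flipX_mem_hPath (p z t : ℝ × ℝ) : flipX p ∈ hPath (flipX z) (flipX t) ↔ p ∈ hPath z t := by
  simp only [hPath, Set.mem_ofPred_eq, flipX_fst, flipX_snd, neg_le_neg_iff, neg_inj]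
  tauto

theorem swap_mem_hPath (p z t : ℝ × ℝ) : p.swap ∈ hPath z.swap t.swap ↔ p ∈ hPath t z := by
  simp only [hPath, Set.mem_ofPred_eq, Prod.fst_swap, Prod.snd_swap]
  tauto

theorem antiswap_mem_hPath (p z t : ℝ × ℝ) :
    antiswap p ∈ hPath (antiswap z) (antiswap t) ↔ p ∈ hPath t z := by
  simp only [hPath, Set.mem_ofPred_eq, antiswap_fst, antiswap_snd, neg_le_neg_iff, neg_inj]
  tauto

/-- A reflection of the plane that maps L-shaped paths to L-shaped paths; it may interchange the
horizontal and the vertical direction. -/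
structure IsSym (σ : ℝ × ℝ → ℝ × ℝ) : Prop where
  invol : ∀ p, σ (σ p) = p
  path : (∀ p z t, σ p ∈ hPath (σ z) (σ t) ↔ p ∈ hPath z t) ∨
    (∀ p z t, σ p ∈ hPath (σ z) (σ t) ↔ p ∈ hPath t z)
  gop : ∀ p q : ℝ × ℝ, (p.1 ≠ q.1 ∧ p.2 ≠ q.2) → (σ p).1 ≠ (σ q).1 ∧ (σ p).2 ≠ (σ q).2

theorem isSym_id : IsSym id where
  invol _ := rfl
  path := Or.inl fun _ _ _ => Iff.rfl
  gop _ _ h := h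

theorem isSym_flipX : IsSym flipX where
  invol := flipX_flipX
  path := Or.inl flipX_mem_hPath
  gop := by simp

theorem isSym_swap : IsSym Prod.swap where
  invol := Prod.swap_swap
  path := Or.inr swap_mem_hPath
  gop := fun _ _ h => ⟨h.2, h.1⟩

theorem isSym_antiswap : IsSym antiswap where
  invol := antiswap_antiswap
  path := Or.inr antiswap_mem_hPath
  gop := by
    intro p q h
    simpa using ⟨h.2, h.1⟩

theorem IsSym.path' {σ : ℝ × ℝ → ℝ × ℝ} (hσ : IsSym σ) :
    (∀ p z t, σ p ∈ hPath z t ↔ p ∈ hPath (σ z) (σ t)) ∨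
      (∀ p z t, σ p ∈ hPath z t ↔ p ∈ hPath (σ t) (σ z)) :=
  hσ.path.imp (fun h p z t => by rw [← h p, hσ.invol, hσ.invol])
    (fun h p z t => by rw [← h p, hσ.invol, hσ.invol])

theorem Body.sym {σ : ℝ × ℝ → ℝ × ℝ} (hσ : IsSym σ) {S : Set (ℝ × ℝ)} {T : TTree V} :
    ∀ {t : ℝ × ℝ} {K : Set (ℝ × ℝ)}, Body S T t K → Body (σ ⁻¹' S) T (σ t) (σ ⁻¹' K) := by
  induction T with
  | nil => intro t K hB; exact hB.elim
  | node v a b c iha ihb ihc =>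
    have key : ∀ {x : TTree V} {t : ℝ × ℝ} {U : Set (ℝ × ℝ)},
        (∀ {t : ℝ × ℝ} {K : Set (ℝ × ℝ)}, Body S x t K → Body (σ ⁻¹' S) x (σ t) (σ ⁻¹' K)) →
        (x = .nil ∧ U = ∅ ∨ Link (Body S x) t U) →
        (x = .nil ∧ σ ⁻¹' U = ∅ ∨ Link (Body (σ ⁻¹' S) x) (σ t) (σ ⁻¹' U)) := by
      rintro x t U ih (⟨h, rfl⟩ | ⟨t', K, e, hB, hne, he, hK, rfl⟩)
      · exact Or.inl ⟨h, rfl⟩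
      · right
        refine ⟨σ t', σ ⁻¹' K, σ ⁻¹' e, ih hB, fun h => hne ?_, ?_, ?_, ?_⟩
        · rw [← hσ.invol t, h, hσ.invol]
        · rcases hσ.path' with hp | hp <;> rcases he with rfl | rfl
          · exact Or.inl (Set.ext fun p => hp p _ _)
          · exact Or.inr (Set.ext fun p => hp p _ _)
          · exact Or.inr (Set.ext fun p => hp p _ _)
          · exact Or.inl (Set.ext fun p => hp p _ _)
        · intro p hp hpK
          rw [← hσ.invol p, hK _ hp hpK]
        · ext p
          simp only [Set.mem_preimage, Set.mem_ofPred_eq]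
          have : σ p = t ↔ p = σ t :=
            ⟨fun h => by rw [← h, hσ.invol], fun h => by rw [h, hσ.invol]⟩
          rw [Ne, Ne, this]
    rintro t K ⟨ht, Ua, Ub, Uc, ha, hb, hc, hab, hac, hbc, rfl⟩
    refine ⟨?_, σ ⁻¹' Ua, σ ⁻¹' Ub, σ ⁻¹' Uc, key iha ha, key ihb hb, key ihc hc,
      fun p h1 h2 => hab _ h1 h2, fun p h1 h2 => hac _ h1 h2, fun p h1 h2 => hbc _ h1 h2, ?_⟩
    · simpa [hσ.invol] using ht
    · ext p
      simp only [Set.mem_preimage, Set.mem_ofPred_eq]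
      have : σ p = t ↔ p = σ t :=
        ⟨fun h => by rw [← h, hσ.invol], fun h => by rw [h, hσ.invol]⟩
      rw [this]

theorem Arm.sym {σ : ℝ × ℝ → ℝ × ℝ} (hσ : IsSym σ) {S : Set (ℝ × ℝ)} {T : TTree V}
    {z : ℝ × ℝ} {U : Set (ℝ × ℝ)} (h : Arm S T z U) : Arm (σ ⁻¹' S) T (σ z) (σ ⁻¹' U) := by
  rcases h with ⟨h, rfl⟩ | ⟨t', K, e, hB, hne, he, hK, rfl⟩
  · exact Or.inl ⟨h, rfl⟩
  · right
    refine ⟨σ t', σ ⁻¹' K, σ ⁻¹' e, hB.sym hσ, fun h => hne ?_, ?_, ?_, ?_⟩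
    · rw [← hσ.invol z, h, hσ.invol]
    · rcases hσ.path' with hp | hp <;> rcases he with rfl | rfl
      · exact Or.inl (Set.ext fun p => hp p _ _)
      · exact Or.inr (Set.ext fun p => hp p _ _)
      · exact Or.inr (Set.ext fun p => hp p _ _)
      · exact Or.inl (Set.ext fun p => hp p _ _)
    · intro p hp hpK
      rw [← hσ.invol p, hK _ hp hpK]
    · ext p
      simp only [Set.mem_preimage, Set.mem_ofPred_eq]
      have : σ p = z ↔ p = σ z :=
        ⟨fun h => by rw [← h, hσ.invol], fun h => by rw [h, hσ.invol]⟩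
      rw [Ne, Ne, this]

/-! ### Cutting point sets -/

theorem GeneralOrthogonalPosition.mono {P Q : Set (ℝ × ℝ)} (h : GeneralOrthogonalPosition P)
    (hQ : Q ⊆ P) : GeneralOrthogonalPosition Q :=
  fun p hp q hq hne => h p (hQ hp) q (hQ hq) hne

theorem GeneralOrthogonalPosition.image {P : Finset (ℝ × ℝ)}
    (h : GeneralOrthogonalPosition (P : Set (ℝ × ℝ))) {σ : ℝ × ℝ → ℝ × ℝ} (hσ : IsSym σ) :
    GeneralOrthogonalPosition (P.image σ : Set (ℝ × ℝ)) := by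
  intro p hp q hq hne
  obtain ⟨p', hp', rfl⟩ := Finset.mem_image.1 (Finset.mem_coe.1 hp)
  obtain ⟨q', hq', rfl⟩ := Finset.mem_image.1 (Finset.mem_coe.1 hq)
  exact hσ.gop _ _ (h _ hp' _ hq' fun e => hne (by rw [e]))

theorem IsSym.injective {σ : ℝ × ℝ → ℝ × ℝ} (hσ : IsSym σ) : Function.Injective σ :=
  fun p q h => by rw [← hσ.invol p, h, hσ.invol]

theorem IsSym.preimage_image {σ : ℝ × ℝ → ℝ × ℝ} (hσ : IsSym σ) (S : Finset (ℝ × ℝ)) :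
    σ ⁻¹' (S.image σ : Set (ℝ × ℝ)) = S := by
  rw [Finset.coe_image, Set.preimage_image_eq _ hσ.injective]

/-- A finite set of points on which `f` is injective can be cut by a level of `f` into two parts of
prescribed sizes. -/
theorem exists_cut (f : ℝ × ℝ → ℝ) (S : Finset (ℝ × ℝ))
    (hf : ∀ p ∈ S, ∀ q ∈ S, p ≠ q → f p ≠ f q) {a b : ℕ} (hab : a + b = S.card) :
    ∃ c, ∃ L R : Finset (ℝ × ℝ), L ⊆ S ∧ R ⊆ S ∧ L.card = a ∧ R.card = b ∧
      (∀ q ∈ L, f q < c) ∧ ∀ q ∈ R, c < f q := by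
  induction a generalizing b with
  | zero =>
    obtain ⟨m, hm⟩ := (S.image f).finite_toSet.bddBelow
    refine ⟨m - 1, ∅, S, by simp, subset_rfl, rfl, by omega, by simp, fun q hq => ?_⟩
    have := hm (Finset.mem_coe.2 (Finset.mem_image_of_mem f hq))
    linarith
  | succ a ih =>
    obtain ⟨c, L, R, hL, hR, hLa, hRb, hLc, hRc⟩ := ih (b := b + 1) (by omega)
    obtain ⟨t, ht, htm⟩ := R.exists_min_image f (Finset.card_pos.1 (by omega))
    have hlt : ∀ q ∈ R.erase t, f t < f q := fun q hq =>
      lt_of_le_of_ne (htm q (Finset.mem_of_mem_erase hq))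
        (hf _ (hR ht) _ (hR (Finset.mem_of_mem_erase hq)) (Finset.ne_of_mem_erase hq).symm)
    have htL : t ∉ L := fun h => lt_asymm (hLc t h) (hRc t ht)
    have key : ∃ c', f t < c' ∧ ∀ q ∈ R.erase t, c' < f q := by
      rcases (R.erase t).eq_empty_or_nonempty with h | h
      · exact ⟨f t + 1, by linarith, by simp [h]⟩
      · obtain ⟨u, hu, hum⟩ := (R.erase t).exists_min_image f h
        have := hlt u hu
        exact ⟨(f t + f u) / 2, by linarith, fun q hq => by linarith [hum q hq]⟩
    obtain ⟨c', h1, h2⟩ := key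
    refine ⟨c', insert t L, R.erase t, Finset.insert_subset (hR ht) hL,
      (Finset.erase_subset _ _).trans hR, by rw [Finset.card_insert_of_notMem htL, hLa],
      by rw [Finset.card_erase_of_mem ht, hRb]; rfl, fun q hq => ?_, h2⟩
    rcases Finset.mem_insert.1 hq with rfl | hq
    · exact h1
    · linarith [hLc q hq, hRc t ht]

theorem exists_cut_x {S : Finset (ℝ × ℝ)} (hS : GeneralOrthogonalPosition (S : Set (ℝ × ℝ)))
    {a b : ℕ} (hab : a + b = S.card) :
    ∃ c, ∃ L R : Finset (ℝ × ℝ), L ⊆ S ∧ R ⊆ S ∧ L.card = a ∧ R.card = b ∧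
      (∀ q ∈ L, q.1 < c) ∧ ∀ q ∈ R, c < q.1 :=
  exists_cut Prod.fst S (fun p hp q hq h => (hS p hp q hq h).1) hab

theorem exists_cut_y {S : Finset (ℝ × ℝ)} (hS : GeneralOrthogonalPosition (S : Set (ℝ × ℝ)))
    {a b : ℕ} (hab : a + b = S.card) :
    ∃ c, ∃ L R : Finset (ℝ × ℝ), L ⊆ S ∧ R ⊆ S ∧ L.card = a ∧ R.card = b ∧
      (∀ q ∈ L, q.2 < c) ∧ ∀ q ∈ R, c < q.2 :=
  exists_cut Prod.snd S (fun p hp q hq h => (hS p hp q hq h).2) hab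

theorem exists_extreme (f : ℝ × ℝ → ℝ) (S : Finset (ℝ × ℝ))
    (hf : ∀ p ∈ S, ∀ q ∈ S, p ≠ q → f p ≠ f q) (hS : 0 < S.card) :
    ∃ t ∈ S, (S.erase t).card + 1 = S.card ∧ ∀ q ∈ S.erase t, f t < f q := by
  obtain ⟨t, ht, htm⟩ := S.exists_min_image f (Finset.card_pos.1 hS)
  refine ⟨t, ht, Finset.card_erase_add_one ht, fun q hq => ?_⟩
  exact lt_of_le_of_ne (htm q (Finset.mem_of_mem_erase hq))
    (hf _ ht _ (Finset.mem_of_mem_erase hq) (Finset.ne_of_mem_erase hq).symm)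

theorem exists_leftmost {S : Finset (ℝ × ℝ)} (hS : GeneralOrthogonalPosition (S : Set (ℝ × ℝ)))
    (h : 0 < S.card) :
    ∃ t ∈ S, (S.erase t).card + 1 = S.card ∧ ∀ q ∈ S.erase t, t.1 < q.1 :=
  exists_extreme Prod.fst S (fun p hp q hq h => (hS p hp q hq h).1) h

theorem exists_lowest {S : Finset (ℝ × ℝ)} (hS : GeneralOrthogonalPosition (S : Set (ℝ × ℝ)))
    (h : 0 < S.card) :
    ∃ t ∈ S, (S.erase t).card + 1 = S.card ∧ ∀ q ∈ S.erase t, t.2 < q.2 :=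
  exists_extreme Prod.snd S (fun p hp q hq h => (hS p hp q hq h).2) h

theorem exists_rightmost {S : Finset (ℝ × ℝ)} (hS : GeneralOrthogonalPosition (S : Set (ℝ × ℝ)))
    (h : 0 < S.card) :
    ∃ t ∈ S, (S.erase t).card + 1 = S.card ∧ ∀ q ∈ S.erase t, q.1 < t.1 := by
  simpa only [neg_lt_neg_iff] using
    exists_extreme (fun p => -p.1) S (fun p hp q hq h e => (hS p hp q hq h).1 (neg_inj.1 e)) h

theorem exists_highest {S : Finset (ℝ × ℝ)} (hS : GeneralOrthogonalPosition (S : Set (ℝ × ℝ)))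
    (h : 0 < S.card) :
    ∃ t ∈ S, (S.erase t).card + 1 = S.card ∧ ∀ q ∈ S.erase t, q.2 < t.2 := by
  simpa only [neg_lt_neg_iff] using
    exists_extreme (fun p => -p.2) S (fun p hp q hq h e => (hS p hp q hq h).2 (neg_inj.1 e)) h

/-! ### Capacities -/

/-- `Fcap T m`: every set of at least `m` points in general orthogonal position carries a drawing of
`T` that does not meet the ray from the root upwards. -/
def Fcap (T : TTree V) (m : ℕ) : Prop :=
  ∀ S : Finset (ℝ × ℝ), GeneralOrthogonalPosition (S : Set (ℝ × ℝ)) → m ≤ S.card →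
    ∃ t K, Body (S : Set (ℝ × ℝ)) T t K ∧ ∀ p ∈ K, p.1 = t.1 → p.2 ≤ t.2

/-- `Hcap T m`: on every set of at least `m` points to the right of a point `z`, the tree `T` can be
drawn so that it can be hung on `z` by a path that leaves `z` horizontally. The points may lie above
and below `z`. For the empty tree there is nothing to draw. -/
def Hcap (T : TTree V) (m : ℕ) : Prop :=
  T = .nil ∨ ∀ (z : ℝ × ℝ) (S : Finset (ℝ × ℝ)),
    GeneralOrthogonalPosition (insert z (S : Set (ℝ × ℝ))) → (∀ q ∈ S, z.1 < q.1) → m ≤ S.card →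
    ∃ t K, Body (S : Set (ℝ × ℝ)) T t K ∧ ∀ p ∈ hPath z t, p ∈ K → p = t

theorem Hcap.nil : Hcap (.nil : TTree V) 0 := Or.inl rfl

theorem Hcap.mono {T : TTree V} {m m' : ℕ} (h : Hcap T m) (hm : m ≤ m') : Hcap T m' :=
  h.imp id fun h z S hS hz hc => h z S hS hz (hm.trans hc)

/-- The defining property of `Hcap` transported by a reflection. -/
theorem Hcap.sym {T : TTree V} {m : ℕ} (h : Hcap T m) (hT : T ≠ .nil) {σ : ℝ × ℝ → ℝ × ℝ}
    (hσ : IsSym σ) {P S : Finset (ℝ × ℝ)} (hP : GeneralOrthogonalPosition (P : Set (ℝ × ℝ)))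
    {z : ℝ × ℝ} (hz : z ∈ P) (hSP : S ⊆ P) (hzS : ∀ q ∈ S, (σ z).1 < (σ q).1) (hm : m ≤ S.card) :
    ∃ t K, Body (S : Set (ℝ × ℝ)) T t K ∧
      ∀ p, σ p ∈ hPath (σ z) (σ t) → p ∈ K → p = t := by
  rcases h with h | h
  · exact absurd h hT
  obtain ⟨t, K, hB, hp⟩ := h (σ z) (S.image σ)
    ((hP.image hσ).mono (by
      intro q hq
      rcases hq with rfl | hq
      · exact Finset.mem_coe.2 (Finset.mem_image_of_mem _ hz)
      · exact Finset.mem_coe.2 (Finset.image_subset_image hSP hq)))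
    (by
      intro q hq
      obtain ⟨q', hq', rfl⟩ := Finset.mem_image.1 hq
      exact hzS q' hq')
    (by rwa [Finset.card_image_of_injective _ hσ.injective])
  refine ⟨σ t, σ ⁻¹' K, ?_, fun p h1 h2 => ?_⟩
  · have := hB.sym hσ
    rwa [hσ.preimage_image] at this
  · rw [hσ.invol] at h1
    rw [← hp _ h1 h2, hσ.invol]

/-- The defining property of `Fcap` transported by a reflection. -/
theorem Fcap.sym {T : TTree V} {m : ℕ} (h : Fcap T m) {σ : ℝ × ℝ → ℝ × ℝ}
    (hσ : IsSym σ) {S : Finset (ℝ × ℝ)} (hS : GeneralOrthogonalPosition (S : Set (ℝ × ℝ)))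
    (hm : m ≤ S.card) :
    ∃ t K, Body (S : Set (ℝ × ℝ)) T t K ∧ ∀ p ∈ K, (σ p).1 = (σ t).1 → (σ p).2 ≤ (σ t).2 := by
  obtain ⟨t, K, hB, hp⟩ := h (S.image σ) (hS.image hσ)
    (by rwa [Finset.card_image_of_injective _ hσ.injective])
  refine ⟨σ t, σ ⁻¹' K, ?_, fun p h1 h2 => ?_⟩
  · have := hB.sym hσ
    rwa [hσ.preimage_image] at this
  · rw [hσ.invol] at h2 ⊢
    exact hp _ h1 h2

theorem Fcap.left {T : TTree V} {m : ℕ} (h : Fcap T m) {S : Finset (ℝ × ℝ)}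
    (hS : GeneralOrthogonalPosition (S : Set (ℝ × ℝ))) (hm : m ≤ S.card) :
    ∃ t K, Body (S : Set (ℝ × ℝ)) T t K ∧ ∀ p ∈ K, p.2 = t.2 → t.1 ≤ p.1 := by
  obtain ⟨t, K, hB, hp⟩ := h.sym isSym_antiswap hS hm
  exact ⟨t, K, hB, fun p h1 h2 => by simpa [h2] using hp p h1⟩

theorem ne_of_coords {p z : ℝ × ℝ} (h : p ≠ z) : p.1 ≠ z.1 ∨ p.2 ≠ z.2 := by
  by_contra! h'
  exact h (Prod.ext h'.1 h'.2)

/-- The part of the plane that is used by an arm leaving `z` to the right into the set `S`: it lies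
to the right of `z`, within the bounding box of `S` and `z`, and only the ray from `z` to the right
is used before the leftmost point of `S`. Bounds are tested against arbitrary lines. -/
def RightReg (z : ℝ × ℝ) (S : Finset (ℝ × ℝ)) (p : ℝ × ℝ) : Prop :=
  z.1 < p.1 ∧ (∀ c, (∀ q ∈ S, q.1 < c) → p.1 < c) ∧
    (∀ c, (∀ q ∈ S, c < q.1) → p.2 = z.2 ∨ c < p.1) ∧
    (∀ c, z.2 < c → (∀ q ∈ S, q.2 < c) → p.2 < c) ∧
    ∀ c, c < z.2 → (∀ q ∈ S, c < q.2) → c < p.2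

/-- The analogue of `RightReg` for an arm that leaves `z` to the left. -/
def LeftReg (z : ℝ × ℝ) (S : Finset (ℝ × ℝ)) (p : ℝ × ℝ) : Prop :=
  p.1 < z.1 ∧ (∀ c, (∀ q ∈ S, c < q.1) → c < p.1) ∧
    (∀ c, (∀ q ∈ S, q.1 < c) → p.2 = z.2 ∨ p.1 < c) ∧
    (∀ c, z.2 < c → (∀ q ∈ S, q.2 < c) → p.2 < c) ∧
    ∀ c, c < z.2 → (∀ q ∈ S, c < q.2) → c < p.2

/-- The analogue of `RightReg` for an arm that leaves `z` upwards. -/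
def UpReg (z : ℝ × ℝ) (S : Finset (ℝ × ℝ)) (p : ℝ × ℝ) : Prop :=
  z.2 < p.2 ∧ (∀ c, (∀ q ∈ S, q.2 < c) → p.2 < c) ∧
    (∀ c, (∀ q ∈ S, c < q.2) → p.1 = z.1 ∨ c < p.2) ∧
    (∀ c, z.1 < c → (∀ q ∈ S, q.1 < c) → p.1 < c) ∧
    ∀ c, c < z.1 → (∀ q ∈ S, c < q.1) → c < p.1

/-- The analogue of `RightReg` for an arm that leaves `z` downwards. -/
def DownReg (z : ℝ × ℝ) (S : Finset (ℝ × ℝ)) (p : ℝ × ℝ) : Prop :=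
  p.2 < z.2 ∧ (∀ c, (∀ q ∈ S, c < q.2) → c < p.2) ∧
    (∀ c, (∀ q ∈ S, q.2 < c) → p.1 = z.1 ∨ p.2 < c) ∧
    (∀ c, z.1 < c → (∀ q ∈ S, q.1 < c) → p.1 < c) ∧
    ∀ c, c < z.1 → (∀ q ∈ S, c < q.1) → c < p.1

theorem rightReg_of_mem {S : Finset (ℝ × ℝ)} {z t p : ℝ × ℝ} (hS : ∀ q ∈ S, z.1 < q.1)
    (ht : t ∈ S) (hp : p ∈ hPath z t ∨ p ∈ Hull (S : Set (ℝ × ℝ))) (hne : p ≠ z) :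
    RightReg z S p := by
  have hzt := hS t ht
  rcases hp with (⟨h1, h2⟩ | ⟨h1, h2⟩) |
    ⟨⟨q1, hq1, h1⟩, ⟨q2, hq2, h2⟩, ⟨q3, hq3, h3⟩, ⟨q4, hq4, h4⟩⟩
  · have h3 : z.1 < p.1 := by
      rcases ne_of_coords hne with h | h
      · rcases h2 with h2 | h2
        · exact lt_of_le_of_ne h2.1 h.symm
        · linarith
      · exact absurd h1 h
    refine ⟨h3, fun c hc => ?_, fun c hc => Or.inl h1, fun c hc _ => ?_, fun c hc _ => ?_⟩
    · have := hc t ht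
      rcases h2 with h2 | h2 <;> linarith
    · linarith
    · linarith
  · refine ⟨?_, fun c hc => ?_, fun c hc => Or.inr ?_, fun c hc hc' => ?_, fun c hc hc' => ?_⟩
    · linarith
    · linarith [hc t ht]
    · linarith [hc t ht]
    · have := hc' t ht
      rcases h2 with h2 | h2 <;> linarith
    · have := hc' t ht
      rcases h2 with h2 | h2 <;> linarith
  · refine ⟨?_, fun c hc => ?_, fun c hc => Or.inr ?_, fun c hc hc' => ?_, fun c hc hc' => ?_⟩
    · linarith [hS q1 hq1]
    · linarith [hc q2 hq2]
    · linarith [hc q1 hq1]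
    · linarith [hc' q4 hq4]
    · linarith [hc' q3 hq3]

theorem hull_image_flipX {S : Finset (ℝ × ℝ)} {p : ℝ × ℝ} (h : p ∈ Hull (S : Set (ℝ × ℝ))) :
    flipX p ∈ Hull (S.image flipX : Set (ℝ × ℝ)) := by
  obtain ⟨h1, h2, h3, h4⟩ := h
  simp only [Hull, Set.mem_ofPred_eq, Finset.mem_coe, Finset.exists_mem_image, flipX_fst,
    flipX_snd, neg_le_neg_iff]
  exact ⟨h2, h1, h3, h4⟩

theorem hull_image_swap {S : Finset (ℝ × ℝ)} {p : ℝ × ℝ} (h : p ∈ Hull (S : Set (ℝ × ℝ))) :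
    p.swap ∈ Hull (S.image Prod.swap : Set (ℝ × ℝ)) := by
  obtain ⟨h1, h2, h3, h4⟩ := h
  simp only [Hull, Set.mem_ofPred_eq, Finset.mem_coe, Finset.exists_mem_image]
  exact ⟨h3, h4, h1, h2⟩

theorem leftReg_of_mem {S : Finset (ℝ × ℝ)} {z t p : ℝ × ℝ} (hS : ∀ q ∈ S, q.1 < z.1)
    (ht : t ∈ S) (hp : p ∈ hPath z t ∨ p ∈ Hull (S : Set (ℝ × ℝ))) (hne : p ≠ z) :
    LeftReg z S p := by
  have h := rightReg_of_mem (z := flipX z) (S := S.image flipX) (p := flipX p)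
    (by
      simp only [Finset.forall_mem_image, flipX_fst, neg_lt_neg_iff]
      exact hS) (Finset.mem_image_of_mem _ ht)
    (hp.imp (flipX_mem_hPath _ _ _).2 hull_image_flipX) (isSym_flipX.injective.ne hne)
  simp only [RightReg, Finset.forall_mem_image, flipX_fst, flipX_snd, neg_lt_neg_iff] at h
  refine ⟨h.1, fun c hc => ?_, fun c hc => ?_, h.2.2.2⟩
  · simpa using h.2.1 (-c) (by simpa using hc)
  · simpa using h.2.2.1 (-c) (by simpa using hc)

theorem upReg_of_mem {S : Finset (ℝ × ℝ)} {z t p : ℝ × ℝ} (hS : ∀ q ∈ S, z.2 < q.2)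
    (ht : t ∈ S) (hp : p ∈ hPath t z ∨ p ∈ Hull (S : Set (ℝ × ℝ))) (hne : p ≠ z) :
    UpReg z S p := by
  have h := rightReg_of_mem (z := z.swap) (S := S.image Prod.swap) (p := p.swap)
    (Finset.forall_mem_image.2 hS) (Finset.mem_image_of_mem _ ht)
    (hp.imp (swap_mem_hPath _ _ _).2 hull_image_swap) (isSym_swap.injective.ne hne)
  simp only [RightReg, Finset.forall_mem_image, Prod.fst_swap, Prod.snd_swap] at h
  exact h

theorem downReg_of_mem {S : Finset (ℝ × ℝ)} {z t p : ℝ × ℝ} (hS : ∀ q ∈ S, q.2 < z.2)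
    (ht : t ∈ S) (hp : p ∈ hPath t z ∨ p ∈ Hull (S : Set (ℝ × ℝ))) (hne : p ≠ z) :
    DownReg z S p := by
  have h := leftReg_of_mem (z := z.swap) (S := S.image Prod.swap) (p := p.swap)
    (Finset.forall_mem_image.2 hS) (Finset.mem_image_of_mem _ ht)
    (hp.imp (swap_mem_hPath _ _ _).2 hull_image_swap) (isSym_swap.injective.ne hne)
  simp only [LeftReg, Finset.forall_mem_image, Prod.fst_swap, Prod.snd_swap] at h
  exact h

/-! ### Hanging a subtree on a point in one of the four directions -/

section Arms

variable {T : TTree V} {m : ℕ} {P S : Finset (ℝ × ℝ)} {z : ℝ × ℝ}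

theorem Hcap.right (h : Hcap T m) (hP : GeneralOrthogonalPosition (P : Set (ℝ × ℝ)))
    (hz : z ∈ P) (hSP : S ⊆ P) (hm : m ≤ S.card) (hzS : ∀ q ∈ S, z.1 < q.1) :
    ∃ U, Arm (S : Set (ℝ × ℝ)) T z U ∧ ∀ p ∈ U, RightReg z S p := by
  by_cases hT : T = .nil
  · exact ⟨∅, Or.inl ⟨hT, rfl⟩, by simp⟩
  obtain ⟨t, K, hB, hp⟩ := h.sym hT isSym_id hP hz hSP hzS hm
  have ht : t ∈ S := hB.root_mem
  refine ⟨_, Arm.hpath hB (fun e => (hzS t ht).ne (by rw [e]))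
    hp, fun p h1 => ?_⟩
  exact rightReg_of_mem hzS ht (h1.1.imp id fun h => hB.subset_hull h) h1.2

theorem Hcap.left (h : Hcap T m) (hP : GeneralOrthogonalPosition (P : Set (ℝ × ℝ)))
    (hz : z ∈ P) (hSP : S ⊆ P) (hm : m ≤ S.card) (hzS : ∀ q ∈ S, q.1 < z.1) :
    ∃ U, Arm (S : Set (ℝ × ℝ)) T z U ∧ ∀ p ∈ U, LeftReg z S p := by
  by_cases hT : T = .nil
  · exact ⟨∅, Or.inl ⟨hT, rfl⟩, by simp⟩
  obtain ⟨t, K, hB, hp⟩ := h.sym hT isSym_flipX hP hz hSP (by simpa using hzS) hm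
  have ht : t ∈ S := hB.root_mem
  refine ⟨_, Arm.hpath hB (fun e => (hzS t ht).ne (by rw [e]))
    fun p h1 h2 => hp p ((flipX_mem_hPath _ _ _).2 h1) h2, fun p h1 => ?_⟩
  exact leftReg_of_mem hzS ht (h1.1.imp id fun h => hB.subset_hull h) h1.2

theorem Hcap.up (h : Hcap T m) (hP : GeneralOrthogonalPosition (P : Set (ℝ × ℝ)))
    (hz : z ∈ P) (hSP : S ⊆ P) (hm : m ≤ S.card) (hzS : ∀ q ∈ S, z.2 < q.2) :
    ∃ U, Arm (S : Set (ℝ × ℝ)) T z U ∧ ∀ p ∈ U, UpReg z S p := by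
  by_cases hT : T = .nil
  · exact ⟨∅, Or.inl ⟨hT, rfl⟩, by simp⟩
  obtain ⟨t, K, hB, hp⟩ := h.sym hT isSym_swap hP hz hSP hzS hm
  have ht : t ∈ S := hB.root_mem
  refine ⟨_, Arm.vpath hB (fun e => (hzS t ht).ne (by rw [e]))
    fun p h1 h2 => hp p ((swap_mem_hPath _ _ _).2 h1) h2, fun p h1 => ?_⟩
  exact upReg_of_mem hzS ht (h1.1.imp id fun h => hB.subset_hull h) h1.2

theorem Hcap.down (h : Hcap T m) (hP : GeneralOrthogonalPosition (P : Set (ℝ × ℝ)))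
    (hz : z ∈ P) (hSP : S ⊆ P) (hm : m ≤ S.card) (hzS : ∀ q ∈ S, q.2 < z.2) :
    ∃ U, Arm (S : Set (ℝ × ℝ)) T z U ∧ ∀ p ∈ U, DownReg z S p := by
  by_cases hT : T = .nil
  · exact ⟨∅, Or.inl ⟨hT, rfl⟩, by simp⟩
  obtain ⟨t, K, hB, hp⟩ := h.sym hT isSym_antiswap hP hz hSP (by simpa using hzS) hm
  have ht : t ∈ S := hB.root_mem
  refine ⟨_, Arm.vpath hB (fun e => (hzS t ht).ne (by rw [e]))
    fun p h1 h2 => hp p ((antiswap_mem_hPath _ _ _).2 h1) h2, fun p h1 => ?_⟩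
  exact downReg_of_mem hzS ht (h1.1.imp id fun h => hB.subset_hull h) h1.2

end Arms

/-! ### Drawing a node above or beside its subtrees -/

theorem GeneralOrthogonalPosition.subset {P Q : Finset (ℝ × ℝ)}
    (h : GeneralOrthogonalPosition (P : Set (ℝ × ℝ))) (hQ : Q ⊆ P) :
    GeneralOrthogonalPosition (Q : Set (ℝ × ℝ)) :=
  h.mono (Finset.coe_subset.2 hQ)

theorem Arm.subset {S S' : Finset (ℝ × ℝ)} {T : TTree V} {z : ℝ × ℝ} {U : Set (ℝ × ℝ)}
    (hU : Arm (S : Set (ℝ × ℝ)) T z U) (h : S ⊆ S') : Arm (S' : Set (ℝ × ℝ)) T z U :=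
  hU.mono (Finset.coe_subset.2 h)

theorem Body.subset {S S' : Finset (ℝ × ℝ)} {T : TTree V} {t : ℝ × ℝ} {K : Set (ℝ × ℝ)}
    (hB : Body (S : Set (ℝ × ℝ)) T t K) (h : S ⊆ S') : Body (S' : Set (ℝ × ℝ)) T t K :=
  hB.mono (Finset.coe_subset.2 h)

theorem Body.gt_x {S : Finset (ℝ × ℝ)} {T : TTree V} {t : ℝ × ℝ} {K : Set (ℝ × ℝ)}
    (hB : Body (S : Set (ℝ × ℝ)) T t K) {c : ℝ} (hc : ∀ q ∈ S, c < q.1) {p : ℝ × ℝ} (hp : p ∈ K) :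
    c < p.1 := by
  obtain ⟨q, hq, h⟩ := (hB.subset_hull hp).1
  exact (hc q hq).trans_le h

theorem Body.lt_y {S : Finset (ℝ × ℝ)} {T : TTree V} {t : ℝ × ℝ} {K : Set (ℝ × ℝ)}
    (hB : Body (S : Set (ℝ × ℝ)) T t K) {c : ℝ} (hc : ∀ q ∈ S, q.2 < c) {p : ℝ × ℝ} (hp : p ∈ K) :
    p.2 < c := by
  obtain ⟨q, hq, h⟩ := (hB.subset_hull hp).2.2.2
  exact h.trans_lt (hc q hq)

/-- The root is the highest point of a middle strip; its subtrees hang to the left, to the right and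
downwards. -/
theorem Fcap.node_of_strips (v : V) {A B C : TTree V} {a b c : ℕ} (hA : Hcap A a) (hB : Hcap B b)
    (hC : Hcap C c) : Fcap (.node v A B C) (a + b + c + 1) := by
  intro S hS hm
  obtain ⟨x, L, S₁, hL, hS₁, hLa, hS₁c, hLx, hS₁x⟩ := exists_cut_x hS
    (show a + (S.card - a) = S.card by omega)
  obtain ⟨y, M, R, hM, hR, hMc, hRb, hMy, hRy⟩ := exists_cut_x (hS.subset hS₁)
    (show (S₁.card - b) + b = S₁.card by omega)
  have hMS : M ⊆ S := hM.trans hS₁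
  obtain ⟨r, hr, hrc, hrt⟩ := exists_highest (hS.subset hMS) (by omega)
  obtain ⟨Ua, hUa, ra⟩ := hA.left hS (hMS hr) hL (by omega)
    (fun q hq => (hLx q hq).trans (hS₁x r (hM hr)))
  obtain ⟨Ub, hUb, rb⟩ := hB.right hS (hMS hr) (hR.trans hS₁) (by omega)
    (fun q hq => (hMy r hr).trans (hRy q hq))
  obtain ⟨Uc, hUc, rc⟩ := hC.down hS (hMS hr) ((Finset.erase_subset _ _).trans hMS) (by omega) hrt
  have fa : ∀ p ∈ Ua, p.1 < r.1 ∧ (p.2 = r.2 ∨ p.1 < x) := fun p hp =>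
    ⟨(ra p hp).1, (ra p hp).2.2.1 x hLx⟩
  have fb : ∀ p ∈ Ub, r.1 < p.1 ∧ (p.2 = r.2 ∨ y < p.1) := fun p hp =>
    ⟨(rb p hp).1, (rb p hp).2.2.1 y hRy⟩
  have fc : ∀ p ∈ Uc, p.2 < r.2 ∧ p.1 < y ∧ x < p.1 := fun p hp =>
    ⟨(rc p hp).1, (rc p hp).2.2.2.1 y (hMy r hr) fun q hq => hMy q (Finset.mem_of_mem_erase hq),
      (rc p hp).2.2.2.2 x (hS₁x r (hM hr)) fun q hq => hS₁x q (hM (Finset.mem_of_mem_erase hq))⟩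
  refine ⟨r, _, Body.node v (hMS hr) (hUa.subset hL)
    (hUb.subset (hR.trans hS₁)) (hUc.subset ((Finset.erase_subset _ _).trans hMS)) ?_ ?_ ?_, ?_⟩
  · intro p h1 h2
    linarith [fa p h1, fb p h2]
  · intro p h1 h2
    obtain ⟨h3, h4 | h4⟩ := fa p h1 <;> linarith [fc p h2]
  · intro p h1 h2
    obtain ⟨h3, h4 | h4⟩ := fb p h1 <;> linarith [fc p h2]
  · rintro p (rfl | h | h | h) hpr
    · exact le_rfl
    · linarith [fa p h]
    · linarith [fb p h]
    · linarith [fc p h]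

/-- The subtree `C` is drawn in the lowest rows with the ray above its root `t` left free. Of the
points above, at least half lie on one side of the column of `t`; they carry the root and the
subtrees `A` and `B`, and the edge to `t` comes down in the column of `t`. -/
theorem Fcap.node_of_lower (v : V) {A B C : TTree V} {a b c : ℕ} (hA : Hcap A a) (hB : Hcap B b)
    (hC : Fcap C c) : Fcap (.node v A B C) (c + 2 * (a + b) + 1) := by
  intro S hS hm
  obtain ⟨y, Y, W, hY, hW, hYc, hWc, hYy, hWy⟩ := exists_cut_y hS
    (show c + (S.card - c) = S.card by omega)
  obtain ⟨t, K, hK, hKt⟩ := hC (S := Y) (hS.subset hY) hYc.ge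
  have ht : t ∈ Y := hK.root_mem
  have hty := hYy t ht
  have hKy : ∀ p ∈ K, p.2 < y := fun p hp => hK.lt_y hYy hp
  have hx : ∀ q ∈ W, q.1 ≠ t.1 := fun q hq => (hS q (hW hq) t (hY ht) (by
    rintro rfl
    linarith [hWy q hq])).1
  have hcard : (W.filter fun q => t.1 < q.1).card + (W.filter fun q => ¬ t.1 < q.1).card = W.card :=
    Finset.card_filter_add_card_filter_not _
  rcases (show a + b + 1 ≤ (W.filter fun q => t.1 < q.1).card ∨
    a + b + 1 ≤ (W.filter fun q => ¬ t.1 < q.1).card by omega) with h | h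
  · set Q := W.filter fun q => t.1 < q.1 with hQdef
    have hQW : Q ⊆ W := Finset.filter_subset _ _
    have hQS : Q ⊆ S := hQW.trans hW
    have hQt : ∀ q ∈ Q, t.1 < q.1 := fun q hq => (Finset.mem_filter.1 hq).2
    obtain ⟨x, L, R, hL, hR, hLc, hRc, hLx, hRx⟩ := exists_cut_x (hS.subset hQS)
      (show (Q.card - a) + a = Q.card by omega)
    obtain ⟨r, hr, hrc, hrt⟩ := exists_highest (hS.subset (hL.trans hQS)) (by omega)
    have hrS := hQS (hL hr)
    have hry := hWy r (hQW (hL hr))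
    have hrt1 := hQt r (hL hr)
    obtain ⟨Ua, hUa, ra⟩ := hA.right hS hrS (hR.trans hQS) (by omega)
      (fun q hq => (hLx r hr).trans (hRx q hq))
    obtain ⟨Ub, hUb, rb⟩ := hB.down hS hrS ((Finset.erase_subset _ _).trans (hL.trans hQS))
      (by omega) hrt
    have fa : ∀ p ∈ Ua, r.1 < p.1 ∧ (p.2 = r.2 ∨ x < p.1) := fun p hp =>
      ⟨(ra p hp).1, (ra p hp).2.2.1 x hRx⟩
    have fb : ∀ p ∈ Ub, p.2 < r.2 ∧ p.1 < x ∧ t.1 < p.1 ∧ y < p.2 := fun p hp =>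
      ⟨(rb p hp).1, (rb p hp).2.2.2.1 x (hLx r hr) fun q hq => hLx q (Finset.mem_of_mem_erase hq),
        (rb p hp).2.2.2.2 _ hrt1 fun q hq => hQt q (hL (Finset.mem_of_mem_erase hq)),
        (rb p hp).2.1 y fun q hq => hWy q (hQW (hL (Finset.mem_of_mem_erase hq)))⟩
    have fe : ∀ p, p ∈ hPath r t → p.2 = r.2 ∧ t.1 ≤ p.1 ∧ p.1 ≤ r.1 ∨
        p.1 = t.1 ∧ t.2 ≤ p.2 ∧ p.2 ≤ r.2 := by
      rintro p (⟨h1, h2 | h2⟩ | ⟨h1, h2 | h2⟩)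
      · linarith
      · exact Or.inl ⟨h1, h2⟩
      · linarith
      · exact Or.inr ⟨h1, h2⟩
    have hUc := Arm.hpath (z := r) (hK.subset hY) (by rintro rfl; linarith) (by
      intro p hp hpK
      have h2 := hKy p hpK
      rcases fe p hp with h3 | h3
      · linarith
      · exact Prod.ext h3.1 (le_antisymm (hKt p hpK h3.1) h3.2.1))
    have fc : ∀ p, ((p ∈ hPath r t ∨ p ∈ K) ∧ p ≠ r) →
        p.2 = r.2 ∧ p.1 < r.1 ∨ p.1 = t.1 ∧ p.2 ≤ r.2 ∨ p.2 < y := by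
      rintro p ⟨hp | hp, hne⟩
      · rcases fe p hp with h3 | h3
        · left
          rcases ne_of_coords hne with h4 | h4
          · exact ⟨h3.1, lt_of_le_of_ne h3.2.2 h4⟩
          · exact absurd h3.1 h4
        · exact Or.inr (Or.inl ⟨h3.1, h3.2.2⟩)
      · exact Or.inr (Or.inr (hKy p hp))
    refine ⟨r, _, Body.node v hrS (hUa.subset (hR.trans hQS))
      (hUb.subset ((Finset.erase_subset _ _).trans (hL.trans hQS))) hUc ?_ ?_ ?_, ?_⟩
    · intro p h1 h2
      obtain ⟨h3, h4 | h4⟩ := fa p h1 <;> linarith [fb p h2]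
    · intro p h1 h2
      have h5 := (ra p h1).2.2.2.2 y hry fun q hq => hWy q (hQW (hR hq))
      rcases fc p h2 with h3 | h3 | h3 <;> linarith [fa p h1]
    · intro p h1 h2
      rcases fc p h2 with h3 | h3 | h3 <;> linarith [fb p h1]
    · rintro p (rfl | h | h | h) hpr
      · exact le_rfl
      · linarith [fa p h]
      · linarith [fb p h]
      · rcases fc p h with h3 | h3 | h3 <;> linarith
  · set Q := W.filter fun q => ¬ t.1 < q.1 with hQdef
    have hQW : Q ⊆ W := Finset.filter_subset _ _
    have hQS : Q ⊆ S := hQW.trans hW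
    have hQt : ∀ q ∈ Q, q.1 < t.1 := fun q hq =>
      lt_of_le_of_ne (not_lt.1 (Finset.mem_filter.1 hq).2) (hx q (hQW hq))
    obtain ⟨x, R, L, hR, hL, hRc, hLc, hRx, hLx⟩ := exists_cut_x (hS.subset hQS)
      (show a + (Q.card - a) = Q.card by omega)
    obtain ⟨r, hr, hrc, hrt⟩ := exists_highest (hS.subset (hL.trans hQS)) (by omega)
    have hrS := hQS (hL hr)
    have hry := hWy r (hQW (hL hr))
    have hrt1 := hQt r (hL hr)
    obtain ⟨Ua, hUa, ra⟩ := hA.left hS hrS (hR.trans hQS) (by omega)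
      (fun q hq => (hRx q hq).trans (hLx r hr))
    obtain ⟨Ub, hUb, rb⟩ := hB.down hS hrS ((Finset.erase_subset _ _).trans (hL.trans hQS))
      (by omega) hrt
    have fa : ∀ p ∈ Ua, p.1 < r.1 ∧ (p.2 = r.2 ∨ p.1 < x) := fun p hp =>
      ⟨(ra p hp).1, (ra p hp).2.2.1 x hRx⟩
    have fb : ∀ p ∈ Ub, p.2 < r.2 ∧ x < p.1 ∧ p.1 < t.1 ∧ y < p.2 := fun p hp =>
      ⟨(rb p hp).1, (rb p hp).2.2.2.2 x (hLx r hr) fun q hq => hLx q (Finset.mem_of_mem_erase hq),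
        (rb p hp).2.2.2.1 _ hrt1 fun q hq => hQt q (hL (Finset.mem_of_mem_erase hq)),
        (rb p hp).2.1 y fun q hq => hWy q (hQW (hL (Finset.mem_of_mem_erase hq)))⟩
    have fe : ∀ p, p ∈ hPath r t → p.2 = r.2 ∧ r.1 ≤ p.1 ∧ p.1 ≤ t.1 ∨
        p.1 = t.1 ∧ t.2 ≤ p.2 ∧ p.2 ≤ r.2 := by
      rintro p (⟨h1, h2 | h2⟩ | ⟨h1, h2 | h2⟩)
      · exact Or.inl ⟨h1, h2⟩
      · linarith
      · linarith
      · exact Or.inr ⟨h1, h2⟩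
    have hUc := Arm.hpath (z := r) (hK.subset hY) (by rintro rfl; linarith) (by
      intro p hp hpK
      have h2 := hKy p hpK
      rcases fe p hp with h3 | h3
      · linarith
      · exact Prod.ext h3.1 (le_antisymm (hKt p hpK h3.1) h3.2.1))
    have fc : ∀ p, ((p ∈ hPath r t ∨ p ∈ K) ∧ p ≠ r) →
        p.2 = r.2 ∧ r.1 < p.1 ∨ p.1 = t.1 ∧ p.2 ≤ r.2 ∨ p.2 < y := by
      rintro p ⟨hp | hp, hne⟩
      · rcases fe p hp with h3 | h3
        · left
          rcases ne_of_coords hne with h4 | h4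
          · exact ⟨h3.1, lt_of_le_of_ne h3.2.1 h4.symm⟩
          · exact absurd h3.1 h4
        · exact Or.inr (Or.inl ⟨h3.1, h3.2.2⟩)
      · exact Or.inr (Or.inr (hKy p hp))
    refine ⟨r, _, Body.node v hrS (hUa.subset (hR.trans hQS))
      (hUb.subset ((Finset.erase_subset _ _).trans (hL.trans hQS))) hUc ?_ ?_ ?_, ?_⟩
    · intro p h1 h2
      obtain ⟨h3, h4 | h4⟩ := fa p h1 <;> linarith [fb p h2]
    · intro p h1 h2
      have h5 := (ra p h1).2.2.2.2 y hry fun q hq => hWy q (hQW (hR hq))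
      rcases fc p h2 with h3 | h3 | h3 <;> linarith [fa p h1]
    · intro p h1 h2
      rcases fc p h2 with h3 | h3 | h3 <;> linarith [fb p h1]
    · rintro p (rfl | h | h | h) hpr
      · exact le_rfl
      · linarith [fa p h]
      · linarith [fb p h]
      · rcases fc p h with h3 | h3 | h3 <;> linarith

/-- `CornerCap A B e`: on every set of at least `e` points in general orthogonal position the trees
`A` and `B` can be hung on a common point in such a way that the rays from this point to the left
and downwards stay free. -/
def CornerCap (A B : TTree V) (e : ℕ) : Prop :=
  ∀ S : Finset (ℝ × ℝ), GeneralOrthogonalPosition (S : Set (ℝ × ℝ)) → e ≤ S.card →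
    ∃ t ∈ S, ∃ Ua Ub, Arm (S : Set (ℝ × ℝ)) A t Ua ∧ Arm (S : Set (ℝ × ℝ)) B t Ub ∧
      (∀ p ∈ Ua, p ∉ Ub) ∧
      ∀ p, p ∈ Ua ∨ p ∈ Ub → (p.2 = t.2 → t.1 < p.1) ∧ (p.1 = t.1 → t.2 < p.2)

/-- The defining property of `CornerCap` transported by a reflection. -/
theorem CornerCap.sym {A B : TTree V} {e : ℕ} (h : CornerCap A B e) {σ : ℝ × ℝ → ℝ × ℝ}
    (hσ : IsSym σ) {S : Finset (ℝ × ℝ)} (hS : GeneralOrthogonalPosition (S : Set (ℝ × ℝ)))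
    (he : e ≤ S.card) :
    ∃ t ∈ S, ∃ Ua Ub, Arm (S : Set (ℝ × ℝ)) A t Ua ∧ Arm (S : Set (ℝ × ℝ)) B t Ub ∧
      (∀ p ∈ Ua, p ∉ Ub) ∧ ∀ p, p ∈ Ua ∨ p ∈ Ub →
        ((σ p).2 = (σ t).2 → (σ t).1 < (σ p).1) ∧ ((σ p).1 = (σ t).1 → (σ t).2 < (σ p).2) := by
  obtain ⟨t, ht, Ua, Ub, ha, hb, hab, hp⟩ := h (S.image σ) (hS.image hσ)
    (by rwa [Finset.card_image_of_injective _ hσ.injective])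
  have ha' := ha.sym hσ
  have hb' := hb.sym hσ
  rw [hσ.preimage_image] at ha' hb'
  obtain ⟨t', ht', rfl⟩ := Finset.mem_image.1 ht
  rw [hσ.invol] at ha' hb'
  exact ⟨t', ht', _, _, ha', hb', fun p h1 h2 => hab _ h1 h2, fun p h => hp _ h⟩

theorem Arm.lt_x {S : Finset (ℝ × ℝ)} {T : TTree V} {z : ℝ × ℝ} {U : Set (ℝ × ℝ)}
    (h : Arm (S : Set (ℝ × ℝ)) T z U) (hz : z ∈ S) {c : ℝ} (hc : ∀ q ∈ S, q.1 < c) {p : ℝ × ℝ}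
    (hp : p ∈ U) : p.1 < c := by
  obtain ⟨q, hq, h⟩ := (h.subset_hull hz hp).2.1
  exact h.trans_lt (hc q hq)

theorem Arm.lt_y {S : Finset (ℝ × ℝ)} {T : TTree V} {z : ℝ × ℝ} {U : Set (ℝ × ℝ)}
    (h : Arm (S : Set (ℝ × ℝ)) T z U) (hz : z ∈ S) {c : ℝ} (hc : ∀ q ∈ S, q.2 < c) {p : ℝ × ℝ}
    (hp : p ∈ U) : p.2 < c := by
  obtain ⟨q, hq, h⟩ := (h.subset_hull hz hp).2.2.2
  exact h.trans_lt (hc q hq)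

theorem Arm.gt_y {S : Finset (ℝ × ℝ)} {T : TTree V} {z : ℝ × ℝ} {U : Set (ℝ × ℝ)}
    (h : Arm (S : Set (ℝ × ℝ)) T z U) (hz : z ∈ S) {c : ℝ} (hc : ∀ q ∈ S, c < q.2) {p : ℝ × ℝ}
    (hp : p ∈ U) : c < p.2 := by
  obtain ⟨q, hq, h⟩ := (h.subset_hull hz hp).2.2.1
  exact (hc q hq).trans_le h

/-- The subtree `C` takes the rightmost columns. Of the other points, at least half lie on one
side of the row of `z`. There the root `t`, with `A` and `B`, is drawn so that its ray to the
right, used for `C`, and its ray towards the row of `z`, used for the edge from `z`, are free. -/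
theorem Hcap.node_of_corner (v : V) {A B C : TTree V} {e c : ℕ} (hAB : CornerCap A B e)
    (hC : Hcap C c) : Hcap (.node v A B C) (c + (2 * e - 1)) := by
  right
  intro z S hzS hz hm
  have hP : GeneralOrthogonalPosition ((insert z S : Finset (ℝ × ℝ)) : Set (ℝ × ℝ)) := by
    rwa [Finset.coe_insert]
  have hS : GeneralOrthogonalPosition (S : Set (ℝ × ℝ)) := hP.subset (Finset.subset_insert _ _)
  obtain ⟨x, L, R, hL, hR, hLc, hRc, hLx, hRx⟩ := exists_cut_x hS
    (show (S.card - c) + c = S.card by omega)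
  have hrow : ∀ q ∈ S, z.2 ≠ q.2 := fun q hq =>
    (hP z (Finset.mem_coe.2 (Finset.mem_insert_self _ _)) q
      (Finset.mem_coe.2 (Finset.mem_insert_of_mem hq))
      (by rintro rfl; exact lt_irrefl _ (hz z hq))).2
  have hcard : (L.filter fun q => z.2 < q.2).card + (L.filter fun q => ¬ z.2 < q.2).card = L.card :=
    Finset.card_filter_add_card_filter_not _
  rcases (show e ≤ (L.filter fun q => z.2 < q.2).card ∨
    e ≤ (L.filter fun q => ¬ z.2 < q.2).card by omega) with h | h
  · set Q := L.filter fun q => z.2 < q.2 with hQdef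
    have hQL : Q ⊆ L := Finset.filter_subset _ _
    have hQS : Q ⊆ S := hQL.trans hL
    have hQz : ∀ q ∈ Q, z.2 < q.2 := fun q hq => (Finset.mem_filter.1 hq).2
    obtain ⟨t, ht, Ua, Ub, hUa, hUb, hab, hfree⟩ := hAB.sym isSym_flipX (hS.subset hQS) h
    have htS := hQS ht
    have htz := hQz t ht
    have htz' := hz t htS
    have htx := hLx t (hQL ht)
    obtain ⟨Uc, hUc, rc⟩ := hC.right hS htS hR (by omega) fun q hq => htx.trans (hRx q hq)
    have fab : ∀ p, p ∈ Ua ∨ p ∈ Ub → p.1 < x ∧ z.2 < p.2 ∧ (p.2 = t.2 → p.1 < t.1) ∧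
        (p.1 = t.1 → t.2 < p.2) := by
      intro p hp
      refine ⟨?_, ?_, ?_⟩
      · exact hp.elim (hUa.lt_x ht fun q hq => hLx q (hQL hq))
          (hUb.lt_x ht fun q hq => hLx q (hQL hq))
      · exact hp.elim (hUa.gt_y ht hQz) (hUb.gt_y ht hQz)
      · simpa using hfree p hp
    have fc : ∀ p ∈ Uc, t.1 < p.1 ∧ (p.2 = t.2 ∨ x < p.1) := fun p hp =>
      ⟨(rc p hp).1, (rc p hp).2.2.1 x hRx⟩
    have habc : ∀ p, p ∈ Ua ∨ p ∈ Ub → p ∉ Uc := by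
      intro p h1 h2
      obtain ⟨h3, h4, h5, h6⟩ := fab p h1
      obtain ⟨h7, h8 | h8⟩ := fc p h2
      · linarith [h5 h8]
      · linarith
    refine ⟨t, _, Body.node v htS (hUa.subset hQS) (hUb.subset hQS) (hUc.subset hR) hab
      (fun p hp => habc p (Or.inl hp)) (fun p hp => habc p (Or.inr hp)), ?_⟩
    have key : ∀ p, p ∈ Ua ∨ p ∈ Ub → p ∉ hPath z t := by
      rintro p hp hpe
      obtain ⟨h3, h4, h5, h6⟩ := fab p hp
      rcases hpe with ⟨h1, h2⟩ | ⟨h1, h2⟩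
      · linarith
      · have := h6 h1
        rcases h2 with h2 | h2 <;> linarith
    rintro p hpe (rfl | hp | hp | hp)
    · rfl
    · exact absurd hpe (key p (Or.inl hp))
    · exact absurd hpe (key p (Or.inr hp))
    · have := fc p hp
      rcases hpe with ⟨h1, h2 | h2⟩ | ⟨h1, h2⟩ <;> linarith
  · set Q := L.filter fun q => ¬ z.2 < q.2 with hQdef
    have hQL : Q ⊆ L := Finset.filter_subset _ _
    have hQS : Q ⊆ S := hQL.trans hL
    have hQz : ∀ q ∈ Q, q.2 < z.2 := fun q hq =>
      lt_of_le_of_ne (not_lt.1 (Finset.mem_filter.1 hq).2) (hrow q (hQS hq)).symm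
    obtain ⟨t, ht, Ua, Ub, hUa, hUb, hab, hfree⟩ := hAB.sym isSym_antiswap (hS.subset hQS) h
    have htS := hQS ht
    have htz := hQz t ht
    have htz' := hz t htS
    have htx := hLx t (hQL ht)
    obtain ⟨Uc, hUc, rc⟩ := hC.right hS htS hR (by omega) fun q hq => htx.trans (hRx q hq)
    have fab : ∀ p, p ∈ Ua ∨ p ∈ Ub → p.1 < x ∧ p.2 < z.2 ∧ (p.1 = t.1 → p.2 < t.2) ∧
        (p.2 = t.2 → p.1 < t.1) := by
      intro p hp
      refine ⟨?_, ?_, ?_⟩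
      · exact hp.elim (hUa.lt_x ht fun q hq => hLx q (hQL hq))
          (hUb.lt_x ht fun q hq => hLx q (hQL hq))
      · exact hp.elim (hUa.lt_y ht hQz) (hUb.lt_y ht hQz)
      · simpa using hfree p hp
    have fc : ∀ p ∈ Uc, t.1 < p.1 ∧ (p.2 = t.2 ∨ x < p.1) := fun p hp =>
      ⟨(rc p hp).1, (rc p hp).2.2.1 x hRx⟩
    have habc : ∀ p, p ∈ Ua ∨ p ∈ Ub → p ∉ Uc := by
      intro p h1 h2
      obtain ⟨h3, h4, h5, h6⟩ := fab p h1
      obtain ⟨h7, h8 | h8⟩ := fc p h2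
      · linarith [h6 h8]
      · linarith
    refine ⟨t, _, Body.node v htS (hUa.subset hQS) (hUb.subset hQS) (hUc.subset hR) hab
      (fun p hp => habc p (Or.inl hp)) (fun p hp => habc p (Or.inr hp)), ?_⟩
    have key : ∀ p, p ∈ Ua ∨ p ∈ Ub → p ∉ hPath z t := by
      rintro p hp hpe
      obtain ⟨h3, h4, h5, h6⟩ := fab p hp
      rcases hpe with ⟨h1, h2⟩ | ⟨h1, h2⟩
      · linarith
      · have := h5 h1
        rcases h2 with h2 | h2 <;> linarith
    rintro p hpe (rfl | hp | hp | hp)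
    · rfl
    · exact absurd hpe (key p (Or.inl hp))
    · exact absurd hpe (key p (Or.inr hp))
    · have := fc p hp
      rcases hpe with ⟨h1, h2 | h2⟩ | ⟨h1, h2⟩ <;> linarith

/-- Take the rightmost columns for `B`, and hang `A` upwards on the lowest of the other points. -/
theorem CornerCap.of_strip {A B : TTree V} {a b : ℕ} (hA : Hcap A a) (hB : Hcap B b) :
    CornerCap A B (a + b + 1) := by
  intro S hS hm
  obtain ⟨x, L, R, hL, hR, hLc, hRc, hLx, hRx⟩ := exists_cut_x hS
    (show (S.card - b) + b = S.card by omega)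
  obtain ⟨t, ht, htc, htm⟩ := exists_lowest (hS.subset hL) (by omega)
  have hE : L.erase t ⊆ L := Finset.erase_subset _ _
  obtain ⟨Ua, hUa, ra⟩ := hA.up hS (hL ht) (hE.trans hL) (by omega) htm
  obtain ⟨Ub, hUb, rb⟩ := hB.right hS (hL ht) hR (by omega)
    (fun q hq => (hLx t ht).trans (hRx q hq))
  have fa : ∀ p ∈ Ua, t.2 < p.2 ∧ p.1 < x := fun p hp =>
    ⟨(ra p hp).1, (ra p hp).2.2.2.1 x (hLx t ht) fun q hq => hLx q (hE hq)⟩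
  have fb : ∀ p ∈ Ub, t.1 < p.1 ∧ (p.2 = t.2 ∨ x < p.1) := fun p hp =>
    ⟨(rb p hp).1, (rb p hp).2.2.1 x hRx⟩
  refine ⟨t, hL ht, Ua, Ub, hUa.subset (hE.trans hL), hUb.subset hR, ?_, ?_⟩
  · intro p h1 h2
    obtain ⟨h3, h4 | h4⟩ := fb p h2 <;> linarith [fa p h1]
  · rintro p (hp | hp)
    · exact ⟨fun h => by linarith [fa p hp], fun h => (fa p hp).1⟩
    · exact ⟨fun h => (fb p hp).1, fun h => by linarith [fb p hp]⟩

/-! ### Drawing a node together with one of its children -/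

/-- `Pair S A B t β M`: the points `t` and `β` of `S` are joined by an L-shaped edge, the tree `A`
hangs on `t` and the tree `B` hangs on `β`, without crossings; `M` is the union of all this, and it
leaves the rays from `t` to the left and downwards free. -/
def Pair (S : Set (ℝ × ℝ)) (A B : TTree V) (t β : ℝ × ℝ) (M : Set (ℝ × ℝ)) : Prop :=
  t ∈ S ∧ β ∈ S ∧ t ≠ β ∧ ∃ Ua e Ub, Arm S A t Ua ∧ Arm S B β Ub ∧ (e = hPath t β ∨ e = hPath β t) ∧
    (∀ p ∈ Ua, p ∉ e ∧ p ∉ Ub) ∧ (∀ p ∈ Ub, p ∉ e) ∧ M = {p | p ∈ Ua ∨ p ∈ e ∨ p ∈ Ub} ∧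
    ∀ p ∈ M, p ≠ t → (p.2 = t.2 → t.1 < p.1) ∧ (p.1 = t.1 → t.2 < p.2)

theorem Pair.subset {S S' : Finset (ℝ × ℝ)} {A B : TTree V} {t β : ℝ × ℝ} {M : Set (ℝ × ℝ)}
    (h : Pair (S : Set (ℝ × ℝ)) A B t β M) (hS : S ⊆ S') : Pair (S' : Set (ℝ × ℝ)) A B t β M := by
  obtain ⟨ht, hβ, hne, Ua, e, Ub, ha, hb, h⟩ := h
  exact ⟨hS ht, hS hβ, hne, Ua, e, Ub, ha.subset hS, hb.subset hS, h⟩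

theorem Pair.subset_hull {S : Set (ℝ × ℝ)} {A B : TTree V} {t β : ℝ × ℝ} {M : Set (ℝ × ℝ)}
    (h : Pair S A B t β M) : M ⊆ Hull S := by
  obtain ⟨ht, hβ, hne, Ua, e, Ub, ha, hb, he, -, -, rfl, -⟩ := h
  rintro p (hp | hp | hp)
  · exact ha.subset_hull ht hp
  · rcases he with rfl | rfl
    · exact hPath_subset_hull ht hβ hp
    · exact hPath_subset_hull hβ ht hp
  · exact hb.subset_hull hβ hp

/-- Completing a pair: the remaining subtrees `B'` and `C'` of `β` are hung on `β`. -/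
theorem Pair.corner {S : Set (ℝ × ℝ)} {A A' B' C' : TTree V} {t β : ℝ × ℝ} {M Ub Uc : Set (ℝ × ℝ)}
    (h : Pair S A A' t β M) (v : V) (hB : Arm S B' β Ub) (hC : Arm S C' β Uc)
    (hbM : ∀ p ∈ Ub, p ∉ M) (hcM : ∀ p ∈ Uc, p ∉ M) (hbc : ∀ p ∈ Ub, p ∉ Uc)
    (hclear : ∀ p, p ∈ Ub ∨ p ∈ Uc → (p.2 = t.2 → t.1 < p.1) ∧ (p.1 = t.1 → t.2 < p.2)) :
    ∃ t ∈ S, ∃ Ua Ub, Arm S A t Ua ∧ Arm S (.node v A' B' C') t Ub ∧ (∀ p ∈ Ua, p ∉ Ub) ∧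
      ∀ p, p ∈ Ua ∨ p ∈ Ub → (p.2 = t.2 → t.1 < p.1) ∧ (p.1 = t.1 → t.2 < p.2) := by
  obtain ⟨ht, hβ, hne, Ua, e, Ua', ha, ha', he, h1, h2, rfl, h3⟩ := h
  have hβe : β ∈ e := by
    rcases he with rfl | rfl
    · right
      exact ⟨rfl, le_total _ _ |>.imp (fun h => ⟨h, le_rfl⟩) fun h => ⟨le_rfl, h⟩⟩
    · left
      exact ⟨rfl, le_total _ _ |>.imp (fun h => ⟨le_rfl, h⟩) fun h => ⟨h, le_rfl⟩⟩
  refine ⟨t, ht, Ua, {p | (p ∈ e ∨ p = β ∨ p ∈ Ua' ∨ p ∈ Ub ∨ p ∈ Uc) ∧ p ≠ t}, ha, ?_, ?_, ?_⟩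
  · refine Or.inr ⟨β, _, e, Body.node v hβ ha' hB hC ?_ ?_ hbc, hne, he, ?_, rfl⟩
    · exact fun p hp hp' => hbM p hp' (Or.inr (Or.inr hp))
    · exact fun p hp hp' => hcM p hp' (Or.inr (Or.inr hp))
    · rintro p hp (hp' | hp' | hp' | hp')
      · exact hp'
      · exact absurd hp (h2 p hp')
      · exact absurd (Or.inr (Or.inl hp)) (hbM p hp')
      · exact absurd (Or.inr (Or.inl hp)) (hcM p hp')
  · rintro p hp ⟨hp' | rfl | hp' | hp' | hp', -⟩
    · exact (h1 p hp).1 hp'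
    · exact (h1 p hp).1 hβe
    · exact (h1 p hp).2 hp'
    · exact hbM p hp' (Or.inl hp)
    · exact hcM p hp' (Or.inl hp)
  · rintro p (hp | ⟨hp | rfl | hp | hp | hp, hpt⟩)
    · exact h3 p (Or.inl hp) (ha.ne hp)
    · exact h3 p (Or.inr (Or.inl hp)) hpt
    · exact h3 p (Or.inr (Or.inl hβe)) hpt
    · exact h3 p (Or.inr (Or.inr hp)) hpt
    · exact hclear p (Or.inl hp)
    · exact hclear p (Or.inr hp)

/-- A pair in two layers of points. Depending on which side of the highest point `r` of the lower
layer has enough points, `r` serves as `β` or as `t`, with its own subtree hung upwards into the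
upper layer; the other end of the edge is the extreme point of the lower layer on that side, with
its subtree between the two columns. -/
theorem exists_pair {A B : TTree V} {a b : ℕ} (hA : Hcap A a) (hB : Hcap B b)
    {U₁ U₂ : Finset (ℝ × ℝ)}
    (hS : GeneralOrthogonalPosition ((U₁ ∪ U₂ : Finset (ℝ × ℝ)) : Set (ℝ × ℝ))) {y : ℝ}
    (hy₁ : ∀ q ∈ U₁, y < q.2) (hy₂ : ∀ q ∈ U₂, q.2 < y) (hc₁ : a + b ≤ U₁.card)
    (hc₂ : a + b + 2 ≤ U₂.card) :
    ∃ t ∈ U₂, ∃ β ∈ U₂, t.1 < β.1 ∧ ∃ M,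
      Pair ((U₁ ∪ U₂ : Finset (ℝ × ℝ)) : Set (ℝ × ℝ)) A B t β M ∧
      ∀ p ∈ M, p ≠ β → (p.2 = β.2 → p.1 < β.1) ∧ (p.1 = β.1 → β.2 < p.2) := by
  have h₁ : U₁ ⊆ U₁ ∪ U₂ := Finset.subset_union_left
  have h₂ : U₂ ⊆ U₁ ∪ U₂ := Finset.subset_union_right
  obtain ⟨r, hr, hrc, hrt⟩ := exists_highest (hS.subset h₂) (by omega)
  have hry := hy₂ r hr
  have hcard : ((U₂.erase r).filter fun q => q.1 < r.1).card +
      ((U₂.erase r).filter fun q => ¬ q.1 < r.1).card = (U₂.erase r).card :=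
    Finset.card_filter_add_card_filter_not _
  rcases (show a + 1 ≤ ((U₂.erase r).filter fun q => q.1 < r.1).card ∨
    b + 1 ≤ ((U₂.erase r).filter fun q => ¬ q.1 < r.1).card by omega) with h | h
  · set L := (U₂.erase r).filter fun q => q.1 < r.1 with hLdef
    have hL : L ⊆ U₂ := (Finset.filter_subset _ _).trans (Finset.erase_subset _ _)
    have hLr : ∀ q ∈ L, q.1 < r.1 := fun q hq => (Finset.mem_filter.1 hq).2
    have hLr' : ∀ q ∈ L, q.2 < r.2 := fun q hq => hrt q (Finset.mem_filter.1 hq).1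
    obtain ⟨t, ht, htc, htl⟩ := exists_leftmost (hS.subset (hL.trans h₂)) (by omega)
    have hE : L.erase t ⊆ L := Finset.erase_subset _ _
    have htr := hLr t ht
    have htr' := hLr' t ht
    obtain ⟨Ua, hUa, ra⟩ := hA.right hS (h₂ (hL ht)) (hE.trans (hL.trans h₂)) (by omega) htl
    obtain ⟨Ub, hUb, rb⟩ := hB.up hS (h₂ hr) h₁ (by omega) fun q hq => hry.trans (hy₁ q hq)
    have fa : ∀ p ∈ Ua, t.1 < p.1 ∧ p.1 < r.1 ∧ p.2 < r.2 := fun p hp =>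
      ⟨(ra p hp).1, (ra p hp).2.1 _ fun q hq => hLr q (hE hq),
        (ra p hp).2.2.2.1 _ htr' fun q hq => hLr' q (hE hq)⟩
    have fb : ∀ p ∈ Ub, r.2 < p.2 := fun p hp => (rb p hp).1
    have fe : ∀ p ∈ hPath r t, p.2 = r.2 ∧ t.1 ≤ p.1 ∧ p.1 ≤ r.1 ∨
        p.1 = t.1 ∧ t.2 ≤ p.2 ∧ p.2 ≤ r.2 := by
      rintro p (⟨h1, h2 | h2⟩ | ⟨h1, h2 | h2⟩)
      · linarith
      · exact Or.inl ⟨h1, h2⟩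
      · linarith
      · exact Or.inr ⟨h1, h2⟩
    refine ⟨t, hL ht, r, hr, htr, _, ⟨h₂ (hL ht), h₂ hr, by rintro rfl; exact lt_irrefl _ htr,
      Ua, _, Ub, hUa.subset (hE.trans (hL.trans h₂)), hUb.subset h₁, Or.inr rfl, ?_, ?_, rfl, ?_⟩,
      ?_⟩
    · intro p hp
      have := fa p hp
      refine ⟨fun h => ?_, fun h => ?_⟩
      · rcases fe p h with h1 | h1 <;> linarith
      · linarith [fb p h]
    · intro p hp h
      have := fb p hp
      rcases fe p h with h1 | h1 <;> linarith
    · rintro p (hp | hp | hp) hne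
      · exact ⟨fun _ => (fa p hp).1, fun h => by linarith [fa p hp]⟩
      · have := ne_of_coords hne
        rcases fe p hp with h1 | h1
        · exact ⟨fun h => by linarith, fun h => by linarith⟩
        · refine ⟨fun h => absurd (Prod.ext h1.1 h) hne, fun h => ?_⟩
          exact lt_of_le_of_ne h1.2.1 fun h' => hne (Prod.ext h1.1 h'.symm)
      · exact ⟨fun h => by linarith [fb p hp], fun h => by linarith [fb p hp]⟩
    · rintro p (hp | hp | hp) hne
      · exact ⟨fun h => by linarith [fa p hp], fun h => by linarith [fa p hp]⟩
      · rcases fe p hp with h1 | h1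
        · refine ⟨fun h => ?_, fun h => absurd (Prod.ext h h1.1) hne⟩
          exact lt_of_le_of_ne h1.2.2 fun h' => hne (Prod.ext h' h1.1)
        · exact ⟨fun h => by linarith, fun h => by linarith⟩
      · exact ⟨fun h => by linarith [fb p hp], fun h => by linarith [fb p hp]⟩
  · set R := (U₂.erase r).filter fun q => ¬ q.1 < r.1 with hRdef
    have hR : R ⊆ U₂ := (Finset.filter_subset _ _).trans (Finset.erase_subset _ _)
    have hRr : ∀ q ∈ R, r.1 < q.1 := fun q hq => by
      have hq' := Finset.mem_filter.1 hq
      exact lt_of_le_of_ne (not_lt.1 hq'.2)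
        (hS r (h₂ hr) q (h₂ (hR hq)) (Finset.ne_of_mem_erase hq'.1).symm).1
    have hRr' : ∀ q ∈ R, q.2 < r.2 := fun q hq => hrt q (Finset.mem_filter.1 hq).1
    obtain ⟨β, hβ, hβc, hβr⟩ := exists_rightmost (hS.subset (hR.trans h₂)) (by omega)
    have hE : R.erase β ⊆ R := Finset.erase_subset _ _
    have htr := hRr β hβ
    have htr' := hRr' β hβ
    obtain ⟨Ua, hUa, ra⟩ := hA.up hS (h₂ hr) h₁ (by omega) fun q hq => hry.trans (hy₁ q hq)
    obtain ⟨Ub, hUb, rb⟩ := hB.left hS (h₂ (hR hβ)) (hE.trans (hR.trans h₂)) (by omega) hβr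
    have fa : ∀ p ∈ Ua, r.2 < p.2 := fun p hp => (ra p hp).1
    have fb : ∀ p ∈ Ub, p.1 < β.1 ∧ r.1 < p.1 ∧ p.2 < r.2 := fun p hp =>
      ⟨(rb p hp).1, (rb p hp).2.1 _ fun q hq => hRr q (hE hq),
        (rb p hp).2.2.2.1 _ htr' fun q hq => hRr' q (hE hq)⟩
    have fe : ∀ p ∈ hPath r β, p.2 = r.2 ∧ r.1 ≤ p.1 ∧ p.1 ≤ β.1 ∨
        p.1 = β.1 ∧ β.2 ≤ p.2 ∧ p.2 ≤ r.2 := by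
      rintro p (⟨h1, h2 | h2⟩ | ⟨h1, h2 | h2⟩)
      · exact Or.inl ⟨h1, h2⟩
      · linarith
      · linarith
      · exact Or.inr ⟨h1, h2⟩
    refine ⟨r, hr, β, hR hβ, htr, _, ⟨h₂ hr, h₂ (hR hβ), by rintro rfl; exact lt_irrefl _ htr,
      Ua, _, Ub, hUa.subset h₁, hUb.subset (hE.trans (hR.trans h₂)), Or.inl rfl, ?_, ?_, rfl, ?_⟩,
      ?_⟩
    · intro p hp
      have := fa p hp
      refine ⟨fun h => ?_, fun h => ?_⟩
      · rcases fe p h with h1 | h1 <;> linarith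
      · linarith [fb p h]
    · intro p hp h
      have := fb p hp
      rcases fe p h with h1 | h1 <;> linarith
    · rintro p (hp | hp | hp) hne
      · exact ⟨fun h => by linarith [fa p hp], fun h => fa p hp⟩
      · rcases fe p hp with h1 | h1
        · refine ⟨fun h => ?_, fun h => absurd (Prod.ext h h1.1) hne⟩
          exact lt_of_le_of_ne h1.2.1 fun h' => hne (Prod.ext h'.symm h1.1)
        · exact ⟨fun h => by linarith, fun h => by linarith⟩
      · exact ⟨fun h => by linarith [fb p hp], fun h => by linarith [fb p hp]⟩
    · rintro p (hp | hp | hp) hne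
      · exact ⟨fun h => by linarith [fa p hp], fun h => by linarith [fa p hp]⟩
      · rcases fe p hp with h1 | h1
        · exact ⟨fun h => by linarith, fun h => by linarith⟩
        · refine ⟨fun h => absurd (Prod.ext h1.1 h) hne, fun h => ?_⟩
          exact lt_of_le_of_ne h1.2.1 fun h' => hne (Prod.ext h1.1 h'.symm)
      · exact ⟨fun h => by linarith [fb p hp], fun h => by linarith [fb p hp]⟩

/-- The subtree `C'` hangs on `β` to the right, in the rightmost columns, and `B'` hangs on `β`
downwards. The points used for `t`, `β`, `A` and `A'` number only `3 a + 2 a' + 3`: two layers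
`U₁`, `U₂` of high rows, and the leftmost columns `W` of the points below. If some point of `U₂`
lies to the right of `W`, it serves as `β`, with `t` in `W`; otherwise `U₁` and `U₂` contain a
pair that stays to the left of the points reserved for `B'`. -/
theorem CornerCap.node_of_strips (v : V) {A A' B' C' : TTree V} {a a' b' c' : ℕ} (hA : Hcap A a)
    (hA' : Hcap A' a') (hB' : Hcap B' b') (hC' : Hcap C' c') :
    CornerCap A (.node v A' B' C') (c' + b' + 3 * a + 2 * a' + 3) := by
  intro S hS hm
  obtain ⟨xC, M₀, C₀, hM₀, hC₀, hM₀c, hC₀c, hM₀x, hC₀x⟩ := exists_cut_x hS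
    (show (S.card - c') + c' = S.card by omega)
  obtain ⟨y₁, N₁, U₁, hN₁, hU₁, hN₁c, hU₁c, hN₁y, hU₁y⟩ := exists_cut_y (hS.subset hM₀)
    (show (M₀.card - (a + a')) + (a + a') = M₀.card by omega)
  obtain ⟨y₂, N₂, U₂, hN₂, hU₂, hN₂c, hU₂c, hN₂y, hU₂y⟩ :=
    exists_cut_y (hS.subset (hN₁.trans hM₀))
      (show (N₁.card - (a + a' + 2)) + (a + a' + 2) = N₁.card by omega)
  obtain ⟨xV, W, B₀, hW, hB₀, hWc, hB₀c, hWx, hB₀x⟩ :=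
    exists_cut_x (hS.subset (hN₂.trans (hN₁.trans hM₀)))
      (show (a + 1) + (N₂.card - (a + 1)) = N₂.card by omega)
  have hU₁S := hU₁.trans hM₀
  have hU₂M := hU₂.trans hN₁
  have hU₂S := hU₂M.trans hM₀
  have hN₂M := hN₂.trans hN₁
  have hWS := (hW.trans hN₂M).trans hM₀
  have hB₀S := (hB₀.trans hN₂M).trans hM₀
  -- once a pair is found, `B'` and `C'` are hung on `β` in the same way in all cases
  have key : ∀ t β M, Pair (S : Set (ℝ × ℝ)) A A' t β M → β ∈ U₂ → t.1 < β.1 →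
      (∀ q ∈ B₀, t.1 < q.1) →
      (∀ p ∈ M, p ≠ β → (p.2 = β.2 → p.1 < β.1) ∧ (p.1 = β.1 → β.2 < p.2)) →
      (∀ p ∈ M, p.1 < xC) → (∀ p ∈ M, y₂ < p.2 ∨ p.1 < xV ∧ xV < β.1) →
      ∃ t ∈ S, ∃ Ua Ub, Arm (S : Set (ℝ × ℝ)) A t Ua ∧
        Arm (S : Set (ℝ × ℝ)) (.node v A' B' C') t Ub ∧ (∀ p ∈ Ua, p ∉ Ub) ∧
        ∀ p, p ∈ Ua ∨ p ∈ Ub → (p.2 = t.2 → t.1 < p.1) ∧ (p.1 = t.1 → t.2 < p.2) := by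
    intro t β M hM hβ htβ htB hMβ hMC hMV
    have hβx := hM₀x β (hU₂M hβ)
    have hβy := hU₂y β hβ
    obtain ⟨Ub, hUb, rb⟩ := hB'.down hS (hU₂S hβ) hB₀S (by omega)
      fun q hq => (hN₂y q (hB₀ hq)).trans hβy
    obtain ⟨Uc, hUc, rc⟩ := hC'.right hS (hU₂S hβ) hC₀ (by omega)
      fun q hq => hβx.trans (hC₀x q hq)
    have fb : ∀ p ∈ Ub, p.2 < β.2 ∧ (p.1 = β.1 ∨ p.2 < y₂) ∧ t.1 < p.1 ∧ p.1 < xC := fun p hp =>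
      ⟨(rb p hp).1, (rb p hp).2.2.1 _ fun q hq => hN₂y q (hB₀ hq), (rb p hp).2.2.2.2 _ htβ htB,
        (rb p hp).2.2.2.1 _ hβx fun q hq => hM₀x q (hN₂M (hB₀ hq))⟩
    have fc : ∀ p ∈ Uc, β.1 < p.1 ∧ (p.2 = β.2 ∨ xC < p.1) := fun p hp =>
      ⟨(rc p hp).1, (rc p hp).2.2.1 _ hC₀x⟩
    refine hM.corner v (hUb.subset hB₀S) (hUc.subset hC₀) ?_ ?_ ?_ ?_
    · intro p h1 h2
      obtain ⟨h3, h4, h5, h6⟩ := fb p h1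
      have h7 := hMβ p h2 (hUb.ne h1)
      rcases h4 with h4 | h4
      · linarith [h7.2 h4]
      · rcases hMV p h2 with h8 | ⟨h8, h9⟩
        · linarith
        · linarith [(rb p h1).2.2.2.2 _ h9 hB₀x]
    · intro p h1 h2
      obtain ⟨h3, h4 | h4⟩ := fc p h1
      · linarith [(hMβ p h2 (hUc.ne h1)).1 h4]
      · linarith [hMC p h2]
    · intro p h1 h2
      obtain ⟨h3, h4 | h4⟩ := fc p h2 <;> linarith [fb p h1]
    · rintro p (h | h)
      · exact ⟨fun _ => (fb p h).2.2.1, fun h' => by linarith [fb p h]⟩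
      · exact ⟨fun _ => by linarith [fc p h], fun h' => by linarith [fc p h]⟩
  by_cases hex : ∃ β ∈ U₂, xV < β.1
  · obtain ⟨β, hβ, hβV⟩ := hex
    have hβx := hM₀x β (hU₂M hβ)
    have hβy := hU₂y β hβ
    obtain ⟨t, ht, htc, htl⟩ := exists_leftmost (hS.subset hWS) (by omega)
    have htx := hWx t ht
    have hty := hN₂y t (hW ht)
    have hE : W.erase t ⊆ W := Finset.erase_subset _ _
    obtain ⟨Ua, hUa, ra⟩ := hA.right hS (hWS ht) (hE.trans hWS) (by omega) htl
    obtain ⟨Ub, hUb, rb⟩ := hA'.up hS (hU₂S hβ) hU₁S (by omega)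
      fun q hq => (hN₁y β (hU₂ hβ)).trans (hU₁y q hq)
    have fa : ∀ p ∈ Ua, t.1 < p.1 ∧ p.1 < xV ∧ p.2 < y₂ := fun p hp =>
      ⟨(ra p hp).1, (ra p hp).2.1 _ fun q hq => hWx q (hE hq),
        (ra p hp).2.2.2.1 _ hty fun q hq => hN₂y q (hW (hE hq))⟩
    have fb : ∀ p ∈ Ub, β.2 < p.2 ∧ p.1 < xC := fun p hp =>
      ⟨(rb p hp).1, (rb p hp).2.2.2.1 _ hβx fun q hq => hM₀x q (hU₁ hq)⟩
    have fe : ∀ p ∈ hPath β t, p.2 = β.2 ∧ t.1 ≤ p.1 ∧ p.1 ≤ β.1 ∨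
        p.1 = t.1 ∧ t.2 ≤ p.2 ∧ p.2 ≤ β.2 := by
      rintro p (⟨h1, h2 | h2⟩ | ⟨h1, h2 | h2⟩)
      · linarith
      · exact Or.inl ⟨h1, h2⟩
      · linarith
      · exact Or.inr ⟨h1, h2⟩
    refine key t β _ ⟨hWS ht, hU₂S hβ, by rintro rfl; linarith, Ua, _, Ub,
      hUa.subset (hE.trans hWS), hUb.subset hU₁S, Or.inr rfl, ?_, ?_, rfl, ?_⟩ hβ
      (htx.trans hβV) (fun q hq => htx.trans (hB₀x q hq)) ?_ ?_ ?_
    · intro p hp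
      have := fa p hp
      refine ⟨fun h => ?_, fun h => ?_⟩
      · rcases fe p h with h1 | h1 <;> linarith
      · linarith [fb p h]
    · intro p hp h
      have := fb p hp
      rcases fe p h with h1 | h1 <;> linarith
    · rintro p (hp | hp | hp) hne
      · exact ⟨fun _ => (fa p hp).1, fun h => by linarith [fa p hp]⟩
      · rcases fe p hp with h1 | h1
        · exact ⟨fun h => by linarith, fun h => by linarith⟩
        · refine ⟨fun h => absurd (Prod.ext h1.1 h) hne, fun h => ?_⟩
          exact lt_of_le_of_ne h1.2.1 fun h' => hne (Prod.ext h1.1 h'.symm)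
      · exact ⟨fun h => by linarith [fb p hp], fun h => by linarith [fb p hp]⟩
    · rintro p (hp | hp | hp) hne
      · exact ⟨fun h => by linarith [fa p hp], fun h => by linarith [fa p hp]⟩
      · rcases fe p hp with h1 | h1
        · refine ⟨fun h => ?_, fun h => absurd (Prod.ext h h1.1) hne⟩
          exact lt_of_le_of_ne h1.2.2 fun h' => hne (Prod.ext h' h1.1)
        · exact ⟨fun h => by linarith, fun h => by linarith⟩
      · exact ⟨fun h => by linarith [fb p hp], fun h => by linarith [fb p hp]⟩
    · rintro p (hp | hp | hp)
      · linarith [fa p hp]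
      · rcases fe p hp with h1 | h1 <;> linarith
      · exact (fb p hp).2
    · rintro p (hp | hp | hp)
      · exact Or.inr ⟨(fa p hp).2.1, hβV⟩
      · rcases fe p hp with h1 | h1
        · left; linarith
        · right; exact ⟨by linarith, hβV⟩
      · left; linarith [fb p hp]
  · push Not at hex
    have hU : U₁ ∪ U₂ ⊆ S := Finset.union_subset hU₁S hU₂S
    obtain ⟨t, ht, β, hβ, htβ, M, hM, hMβ⟩ := exists_pair hA hA' (hS.subset hU) hU₁y
      (fun q hq => hN₁y q (hU₂ hq)) hU₁c.ge hU₂c.ge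
    have hUM : ∀ q ∈ U₁ ∪ U₂, q.1 < xC ∧ y₂ < q.2 := fun q hq =>
      (Finset.mem_union.1 hq).elim
        (fun h => ⟨hM₀x q (hU₁ h), by linarith [hU₁y q h, hN₁y t (hU₂ ht), hU₂y t ht]⟩)
        (fun h => ⟨hM₀x q (hU₂M h), hU₂y q h⟩)
    refine key t β M (hM.subset hU) hβ htβ (fun q hq => (hex t ht).trans_lt (hB₀x q hq)) hMβ ?_ ?_
    · intro p hp
      obtain ⟨q, hq, h⟩ := (hM.subset_hull hp).2.1
      exact h.trans_lt (hUM q hq).1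
    · intro p hp
      obtain ⟨q, hq, h⟩ := (hM.subset_hull hp).2.2.1
      exact Or.inl ((hUM q hq).2.trans_le h)

set_option maxHeartbeats 800000 in
/-- The subtree `C'` is drawn in the rightmost columns with the ray to the left of its root `r`
left free, and the edge from `β` runs into this ray. If enough of the other points lie above the
row of `r`, they contain a pair, with `B'` to the right of `β`, and the edge to `r` leaves `β`
downwards. Otherwise the points below this row are used: `t` is the lowest of them apart from
those reserved for `A`, the node `β` lies on a side of `t` with enough points, and the edge to `r`
leaves `β` upwards. -/
theorem CornerCap.node_of_left (v : V) {A A' B' C' : TTree V} {a a' b' c' : ℕ} (hA : Hcap A a)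
    (hA' : Hcap A' a') (hB' : Hcap B' b') (hC' : Fcap C' c') :
    CornerCap A (.node v A' B' C') (c' + 4 * a + 4 * a' + 3 * b' + 3) := by
  intro S hS hm
  obtain ⟨xC, W, Y, hW, hY, hWc, hYc, hWx, hYx⟩ := exists_cut_x hS
    (show (S.card - c') + c' = S.card by omega)
  obtain ⟨r, K, hK, hKr⟩ := hC'.left (hS.subset hY) hYc.ge
  have hr : r ∈ Y := hK.root_mem
  have hrx := hYx r hr
  have hKx : ∀ p ∈ K, xC < p.1 := fun p hp => hK.gt_x hYx hp
  have hrow : ∀ q ∈ W, r.2 ≠ q.2 := fun q hq => (hS r (hY hr) q (hW hq) (by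
    rintro rfl
    linarith [hWx r hq])).2
  have hcard : (W.filter fun q => r.2 < q.2).card + (W.filter fun q => ¬ r.2 < q.2).card = W.card :=
    Finset.card_filter_add_card_filter_not _
  rcases (show b' + 2 * (a + a') + 2 ≤ (W.filter fun q => r.2 < q.2).card ∨
    2 * a + 2 * a' + 2 * b' + 2 ≤ (W.filter fun q => ¬ r.2 < q.2).card by omega) with h | h
  · set Q := W.filter fun q => r.2 < q.2 with hQdef
    have hQW : Q ⊆ W := Finset.filter_subset _ _
    have hQr : ∀ q ∈ Q, r.2 < q.2 := fun q hq => (Finset.mem_filter.1 hq).2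
    obtain ⟨xB, N, SB, hN, hSB, hNc, hSBc, hNx, hSBx⟩ := exists_cut_x (hS.subset (hQW.trans hW))
      (show (Q.card - b') + b' = Q.card by omega)
    obtain ⟨y, U₂, U₁, hU₂, hU₁, hU₂c, hU₁c, hU₂y, hU₁y⟩ :=
      exists_cut_y (hS.subset (hN.trans (hQW.trans hW)))
        (show (N.card - (a + a')) + (a + a') = N.card by omega)
    have hSBS := (hSB.trans hQW).trans hW
    have hNS := (hN.trans hQW).trans hW
    have hU : U₁ ∪ U₂ ⊆ N := Finset.union_subset hU₁ hU₂
    obtain ⟨t, ht, β, hβ, htβ, M, hM, hMβ⟩ := exists_pair hA hA' (hS.subset (hU.trans hNS)) hU₁y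
      hU₂y hU₁c.ge (by omega)
    have hMr : ∀ p ∈ M, r.2 < p.2 := fun p hp => by
      obtain ⟨q, hq, h⟩ := (hM.subset_hull hp).2.2.1
      exact (hQr q (hN (hU hq))).trans_le h
    have hMB : ∀ p ∈ M, p.1 < xB := fun p hp => by
      obtain ⟨q, hq, h⟩ := (hM.subset_hull hp).2.1
      exact h.trans_lt (hNx q (hU hq))
    have hMC : ∀ p ∈ M, p.1 < xC := fun p hp => by
      obtain ⟨q, hq, h⟩ := (hM.subset_hull hp).2.1
      exact h.trans_lt (hWx q (hQW (hN (hU hq))))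
    have hβS := hNS (hU₂ hβ)
    have hβr := hQr β (hN (hU₂ hβ))
    have hβC := hWx β (hQW (hN (hU₂ hβ)))
    obtain ⟨Ub, hUb, rb⟩ := hB'.right hS hβS hSBS (by omega)
      fun q hq => (hNx β (hU₂ hβ)).trans (hSBx q hq)
    have fb : ∀ p ∈ Ub, β.1 < p.1 ∧ p.1 < xC ∧ r.2 < p.2 ∧ (p.2 = β.2 ∨ xB < p.1) := fun p hp =>
      ⟨(rb p hp).1, (rb p hp).2.1 _ fun q hq => hWx q (hQW (hSB hq)),
        (rb p hp).2.2.2.2 _ hβr fun q hq => hQr q (hSB hq), (rb p hp).2.2.1 _ hSBx⟩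
    have fe : ∀ p ∈ hPath r β, p.2 = r.2 ∧ β.1 ≤ p.1 ∧ p.1 ≤ r.1 ∨
        p.1 = β.1 ∧ r.2 ≤ p.2 ∧ p.2 ≤ β.2 := by
      rintro p (⟨h1, h2 | h2⟩ | ⟨h1, h2 | h2⟩)
      · linarith
      · exact Or.inl ⟨h1, h2⟩
      · exact Or.inr ⟨h1, h2⟩
      · linarith
    have hUc := Arm.vpath (z := β) (hK.subset hY) (by rintro rfl; linarith) (by
      intro p hp hpK
      have := hKx p hpK
      rcases fe p hp with h1 | h1
      · exact Prod.ext (le_antisymm h1.2.2 (hKr p hpK h1.1)) h1.1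
      · linarith)
    have fc : ∀ p, ((p ∈ hPath r β ∨ p ∈ K) ∧ p ≠ β) →
        p.2 = r.2 ∧ β.1 ≤ p.1 ∨ p.1 = β.1 ∧ p.2 < β.2 ∨ xC < p.1 := by
      rintro p ⟨hp | hp, hne⟩
      · rcases fe p hp with h1 | h1
        · exact Or.inl ⟨h1.1, h1.2.1⟩
        · exact Or.inr (Or.inl ⟨h1.1, lt_of_le_of_ne h1.2.2 fun h => hne (Prod.ext h1.1 h)⟩)
      · exact Or.inr (Or.inr (hKx p hp))
    refine (hM.subset (hU.trans hNS)).corner v (hUb.subset hSBS) hUc ?_ ?_ ?_ ?_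
    · intro p h1 h2
      obtain ⟨h3, h4, h5, h6 | h6⟩ := fb p h1
      · linarith [(hMβ p h2 (hUb.ne h1)).1 h6]
      · linarith [hMB p h2]
    · intro p h1 h2
      rcases fc p h1 with h3 | h3 | h3
      · linarith [hMr p h2]
      · linarith [(hMβ p h2 h1.2).2 h3.1]
      · linarith [hMC p h2]
    · intro p h1 h2
      have := fb p h1
      rcases fc p h2 with h3 | h3 | h3 <;> linarith
    · have hgt : ∀ p, p ∈ Ub ∨ p ∈ {p | (p ∈ hPath r β ∨ p ∈ K) ∧ p ≠ β} → t.1 < p.1 := by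
        rintro p (h | h)
        · linarith [fb p h]
        · rcases fc p h with h3 | h3 | h3 <;> linarith
      exact fun p hp => ⟨fun _ => hgt p hp, fun h => by linarith [hgt p hp]⟩
  · set Q := W.filter fun q => ¬ r.2 < q.2 with hQdef
    have hQW : Q ⊆ W := Finset.filter_subset _ _
    have hQr : ∀ q ∈ Q, q.2 < r.2 := fun q hq =>
      lt_of_le_of_ne (not_lt.1 (Finset.mem_filter.1 hq).2) (hrow q (hQW hq)).symm
    obtain ⟨xA, N, SA, hN, hSA, hNc, hSAc, hNx, hSAx⟩ := exists_cut_x (hS.subset (hQW.trans hW))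
      (show (Q.card - a) + a = Q.card by omega)
    have hQS := hQW.trans hW
    have hNS := hN.trans hQS
    obtain ⟨t, ht, htc, htl⟩ := exists_lowest (hS.subset hNS) (by omega)
    have htS := hNS ht
    have htr := hQr t (hN ht)
    have htA := hNx t ht
    have htC := hWx t (hQW (hN ht))
    have hcard' : ((N.erase t).filter fun q => t.1 < q.1).card +
        ((N.erase t).filter fun q => ¬ t.1 < q.1).card = (N.erase t).card :=
      Finset.card_filter_add_card_filter_not _
    -- the edge from `β` to the root `r` of `C'` leaves `β` upwards in both cases
    have fe : ∀ β : ℝ × ℝ, β.1 < xC → β.2 < r.2 → ∀ p ∈ hPath r β,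
        p.2 = r.2 ∧ β.1 ≤ p.1 ∧ p.1 ≤ r.1 ∨ p.1 = β.1 ∧ β.2 ≤ p.2 ∧ p.2 ≤ r.2 := by
      rintro β hβC hβr p (⟨h1, h2 | h2⟩ | ⟨h1, h2 | h2⟩)
      · linarith
      · exact Or.inl ⟨h1, h2⟩
      · linarith
      · exact Or.inr ⟨h1, h2⟩
    have hUc : ∀ β : ℝ × ℝ, β.1 < xC → β.2 < r.2 →
        Arm (S : Set (ℝ × ℝ)) C' β {p | (p ∈ hPath r β ∨ p ∈ K) ∧ p ≠ β} := by
      refine fun β hβC hβr => Arm.vpath (hK.subset hY) (by rintro rfl; linarith) ?_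
      intro p hp hpK
      have := hKx p hpK
      rcases fe β hβC hβr p hp with h1 | h1
      · exact Prod.ext (le_antisymm h1.2.2 (hKr p hpK h1.1)) h1.1
      · linarith
    have fc : ∀ β : ℝ × ℝ, β.1 < xC → β.2 < r.2 → ∀ p, ((p ∈ hPath r β ∨ p ∈ K) ∧ p ≠ β) →
        p.2 = r.2 ∧ β.1 ≤ p.1 ∨ p.1 = β.1 ∧ β.2 < p.2 ∨ xC < p.1 := by
      rintro β hβC hβr p ⟨hp | hp, hne⟩
      · rcases fe β hβC hβr p hp with h1 | h1
        · exact Or.inl ⟨h1.1, h1.2.1⟩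
        · exact Or.inr (Or.inl ⟨h1.1, lt_of_le_of_ne h1.2.1 fun h => hne (Prod.ext h1.1 h.symm)⟩)
      · exact Or.inr (Or.inr (hKx p hp))
    rcases (show a + a' + b' + 1 ≤ ((N.erase t).filter fun q => t.1 < q.1).card ∨
      a' + b' + 1 ≤ ((N.erase t).filter fun q => ¬ t.1 < q.1).card by omega) with h' | h'
    · set R := (N.erase t).filter fun q => t.1 < q.1 with hRdef
      have hRE : R ⊆ N.erase t := Finset.filter_subset _ _
      have hRN : R ⊆ N := hRE.trans (Finset.erase_subset _ _)
      have hRt : ∀ q ∈ R, t.1 < q.1 := fun q hq => (Finset.mem_filter.1 hq).2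
      have hRS := hRN.trans hNS
      obtain ⟨x₁, RA, R₁, hRA, hR₁, hRAc, hR₁c, hRAx, hR₁x⟩ := exists_cut_x (hS.subset hRS)
        (show a + (R.card - a) = R.card by omega)
      obtain ⟨x₂, RA', R₂, hRA', hR₂, hRA'c, hR₂c, hRA'x, hR₂x⟩ :=
        exists_cut_x (hS.subset (hR₁.trans hRS)) (show a' + (R₁.card - a') = R₁.card by omega)
      obtain ⟨β, hβ, hβc, hβl⟩ := exists_leftmost (hS.subset (hR₂.trans (hR₁.trans hRS)))
        (by omega)
      have hR₂R := hR₂.trans hR₁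
      have hE : R₂.erase β ⊆ R₂ := Finset.erase_subset _ _
      have hβR := hR₂R hβ
      have hβS := hRS hβR
      have htβ := hRt β hβR
      have htβ' := htl β (hRE hβR)
      have hβr := hQr β (hN (hRN hβR))
      have hβC := hWx β (hQW (hN (hRN hβR)))
      have hβ₁ := hR₁x β (hR₂ hβ)
      obtain ⟨Ua, hUa, ra⟩ := hA.up hS htS (hRA.trans hRS) (by omega)
        fun q hq => htl q (hRE (hRA hq))
      obtain ⟨Ua', hUa', ra'⟩ := hA'.left hS hβS (hRA'.trans (hR₁.trans hRS)) (by omega)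
        fun q hq => (hRA'x q hq).trans (hR₂x β hβ)
      obtain ⟨Ub, hUb, rb⟩ := hB'.right hS hβS (hE.trans (hR₂R.trans hRS)) (by omega) hβl
      -- when `RA` is empty the cut `x₁` may lie to the left of `t`
      have fa : ∀ p ∈ Ua, t.2 < p.2 ∧ p.1 ≤ max x₁ t.1 ∧ p.2 < r.2 := by
        refine fun p hp => ⟨(ra p hp).1, ?_, (ra p hp).2.1 _ fun q hq => hQr q (hN (hRN (hRA hq)))⟩
        by_contra hlt
        obtain ⟨h1, h2⟩ := max_lt_iff.1 (not_le.1 hlt)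
        exact lt_irrefl _ ((ra p hp).2.2.2.1 _ h2 fun q hq => (hRAx q hq).trans h1)
      have hβm : max x₁ t.1 < β.1 := max_lt hβ₁ htβ
      have fa' : ∀ p ∈ Ua', p.1 < β.1 ∧ max x₁ t.1 < p.1 ∧ t.2 < p.2 ∧ p.2 < r.2 := fun p hp =>
        ⟨(ra' p hp).1, (ra' p hp).2.1 _
            fun q hq => max_lt (hR₁x q (hRA' hq)) (hRt q (hR₁ (hRA' hq))),
          (ra' p hp).2.2.2.2 _ htβ' fun q hq => htl q (hRE (hR₁ (hRA' hq))),
          (ra' p hp).2.2.2.1 _ hβr fun q hq => hQr q (hN (hRN (hR₁ (hRA' hq))))⟩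
      have fb : ∀ p ∈ Ub, β.1 < p.1 ∧ p.1 < xC ∧ p.2 < r.2 := fun p hp =>
        ⟨(rb p hp).1, (rb p hp).2.1 _ fun q hq => hWx q (hQW (hN (hRN (hR₂R (hE hq))))),
          (rb p hp).2.2.2.1 _ hβr fun q hq => hQr q (hN (hRN (hR₂R (hE hq))))⟩
      have fe' : ∀ p ∈ hPath t β, p.2 = t.2 ∧ t.1 ≤ p.1 ∧ p.1 ≤ β.1 ∨
          p.1 = β.1 ∧ t.2 ≤ p.2 ∧ p.2 ≤ β.2 := by
        rintro p (⟨h1, h2 | h2⟩ | ⟨h1, h2 | h2⟩)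
        · exact Or.inl ⟨h1, h2⟩
        · linarith
        · exact Or.inr ⟨h1, h2⟩
        · linarith
      have fc' := fc β hβC hβr
      have hM : Pair (S : Set (ℝ × ℝ)) A A' t β {p | p ∈ Ua ∨ p ∈ hPath t β ∨ p ∈ Ua'} := by
        refine ⟨htS, hβS, by rintro rfl; exact lt_irrefl _ htβ, Ua, _, Ua',
          hUa.subset (hRA.trans hRS), hUa'.subset (hRA'.trans (hR₁.trans hRS)), Or.inl rfl,
          ?_, ?_, rfl, ?_⟩
        · intro p hp
          have := fa p hp
          refine ⟨fun h => ?_, fun h => ?_⟩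
          · rcases fe' p h with h1 | h1 <;> linarith
          · linarith [fa' p h]
        · intro p hp h
          have := fa' p hp
          rcases fe' p h with h1 | h1 <;> linarith
        · rintro p (hp | hp | hp) hne
          · exact ⟨fun h => by linarith [fa p hp], fun _ => (fa p hp).1⟩
          · rcases fe' p hp with h1 | h1
            · refine ⟨fun h => ?_, fun h => absurd (Prod.ext h h1.1) hne⟩
              exact lt_of_le_of_ne h1.2.1 fun h' => hne (Prod.ext h'.symm h1.1)
            · exact ⟨fun h => by linarith, fun h => by linarith⟩
          · exact ⟨fun h => by linarith [fa' p hp], fun h => by linarith [fa' p hp]⟩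
      have fM : ∀ p ∈ {p | p ∈ Ua ∨ p ∈ hPath t β ∨ p ∈ Ua'},
          p.1 ≤ β.1 ∧ p.2 < r.2 ∧ (p.1 = β.1 → p.2 ≤ β.2) := by
        rintro p (hp | hp | hp)
        · have := fa p hp
          exact ⟨by linarith, this.2.2, fun h => by linarith⟩
        · rcases fe' p hp with h1 | h1
          · exact ⟨h1.2.2, by linarith, fun h => by linarith⟩
          · exact ⟨h1.1.le, by linarith, fun h => h1.2.2⟩
        · have := fa' p hp
          exact ⟨this.1.le, this.2.2.2, fun h => by linarith⟩
      refine hM.corner v (hUb.subset (hE.trans (hR₂R.trans hRS))) (hUc β hβC hβr) ?_ ?_ ?_ ?_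
      · intro p h1 h2
        linarith [fb p h1, (fM p h2).1]
      · intro p h1 h2
        obtain ⟨h3, h4, h5⟩ := fM p h2
        rcases fc' p h1 with h6 | h6 | h6
        · linarith
        · linarith [h5 h6.1]
        · linarith
      · intro p h1 h2
        have := fb p h1
        rcases fc' p h2 with h3 | h3 | h3 <;> linarith
      · have hgt : ∀ p, p ∈ Ub ∨ p ∈ {p | (p ∈ hPath r β ∨ p ∈ K) ∧ p ≠ β} → t.1 < p.1 := by
          rintro p (h | h)
          · linarith [fb p h]
          · rcases fc' p h with h3 | h3 | h3 <;> linarith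
        exact fun p hp => ⟨fun _ => hgt p hp, fun h => by linarith [hgt p hp]⟩
    · set L := (N.erase t).filter fun q => ¬ t.1 < q.1 with hLdef
      have hLE : L ⊆ N.erase t := Finset.filter_subset _ _
      have hLN : L ⊆ N := hLE.trans (Finset.erase_subset _ _)
      have hLS := hLN.trans hNS
      have hLt : ∀ q ∈ L, q.1 < t.1 := fun q hq =>
        lt_of_le_of_ne (not_lt.1 (Finset.mem_filter.1 hq).2)
          (hS q (hLS hq) t htS (Finset.ne_of_mem_erase (hLE hq))).1
      obtain ⟨x, LB, L₁, hLB, hL₁, hLBc, hL₁c, hLBx, hL₁x⟩ := exists_cut_x (hS.subset hLS)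
        (show b' + (L.card - b') = L.card by omega)
      obtain ⟨β, hβ, hβc, hβl⟩ := exists_highest (hS.subset (hL₁.trans hLS)) (by omega)
      have hE : L₁.erase β ⊆ L₁ := Finset.erase_subset _ _
      have hβL := hL₁ hβ
      have hβS := hLS hβL
      have htβ := hLt β hβL
      have htβ' := htl β (hLE hβL)
      have hβr := hQr β (hN (hLN hβL))
      have hβC := hWx β (hQW (hN (hLN hβL)))
      have hβx := hL₁x β hβ
      obtain ⟨Ua, hUa, ra⟩ := hA.right hS htS (hSA.trans hQS) (by omega)
        fun q hq => htA.trans (hSAx q hq)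
      obtain ⟨Ua', hUa', ra'⟩ := hA'.down hS hβS (hE.trans (hL₁.trans hLS)) (by omega) hβl
      obtain ⟨Ub, hUb, rb⟩ := hB'.left hS hβS (hLB.trans hLS) (by omega)
        fun q hq => (hLBx q hq).trans hβx
      have fa : ∀ p ∈ Ua, t.1 < p.1 ∧ p.1 < xC ∧ p.2 < r.2 := fun p hp =>
        ⟨(ra p hp).1, (ra p hp).2.1 _ fun q hq => hWx q (hQW (hSA hq)),
          (ra p hp).2.2.2.1 _ htr fun q hq => hQr q (hSA hq)⟩
      have fa' : ∀ p ∈ Ua', p.2 < β.2 ∧ p.1 < t.1 ∧ x < p.1 ∧ t.2 < p.2 := fun p hp =>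
        ⟨(ra' p hp).1, (ra' p hp).2.2.2.1 _ htβ fun q hq => hLt q (hL₁ (hE hq)),
          (ra' p hp).2.2.2.2 _ hβx fun q hq => hL₁x q (hE hq),
          (ra' p hp).2.1 _ fun q hq => htl q (hLE (hL₁ (hE hq)))⟩
      have fb : ∀ p ∈ Ub, p.1 < β.1 ∧ t.2 < p.2 ∧ p.2 < r.2 ∧ (p.2 = β.2 ∨ p.1 < x) := fun p hp =>
        ⟨(rb p hp).1, (rb p hp).2.2.2.2 _ htβ' fun q hq => htl q (hLE (hLB hq)),
          (rb p hp).2.2.2.1 _ hβr fun q hq => hQr q (hN (hLN (hLB hq))), (rb p hp).2.2.1 _ hLBx⟩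
      have fe' : ∀ p ∈ hPath β t, p.2 = β.2 ∧ β.1 ≤ p.1 ∧ p.1 ≤ t.1 ∨
          p.1 = t.1 ∧ t.2 ≤ p.2 ∧ p.2 ≤ β.2 := by
        rintro p (⟨h1, h2 | h2⟩ | ⟨h1, h2 | h2⟩)
        · exact Or.inl ⟨h1, h2⟩
        · linarith
        · linarith
        · exact Or.inr ⟨h1, h2⟩
      have fc' := fc β hβC hβr
      have hM : Pair (S : Set (ℝ × ℝ)) A A' t β {p | p ∈ Ua ∨ p ∈ hPath β t ∨ p ∈ Ua'} := by
        refine ⟨htS, hβS, by rintro rfl; exact lt_irrefl _ htβ, Ua, _, Ua',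
          hUa.subset (hSA.trans hQS), hUa'.subset (hE.trans (hL₁.trans hLS)), Or.inr rfl,
          ?_, ?_, rfl, ?_⟩
        · intro p hp
          have := fa p hp
          refine ⟨fun h => ?_, fun h => ?_⟩
          · rcases fe' p h with h1 | h1 <;> linarith
          · linarith [fa' p h]
        · intro p hp h
          have := fa' p hp
          rcases fe' p h with h1 | h1 <;> linarith
        · rintro p (hp | hp | hp) hne
          · exact ⟨fun _ => (fa p hp).1, fun h => by linarith [fa p hp]⟩
          · rcases fe' p hp with h1 | h1
            · exact ⟨fun h => by linarith, fun h => by linarith⟩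
            · refine ⟨fun h => absurd (Prod.ext h1.1 h) hne, fun h => ?_⟩
              exact lt_of_le_of_ne h1.2.1 fun h' => hne (Prod.ext h1.1 h'.symm)
          · exact ⟨fun h => by linarith [fa' p hp], fun h => by linarith [fa' p hp]⟩
      have fM : ∀ p ∈ {p | p ∈ Ua ∨ p ∈ hPath β t ∨ p ∈ Ua'},
          p.1 < xC ∧ p.2 < r.2 ∧ (p.1 ≤ β.1 → p.2 ≤ β.2) ∧
            (p.1 < β.1 → p.2 < β.2 ∧ x < p.1) := by
        rintro p (hp | hp | hp)
        · have := fa p hp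
          exact ⟨this.2.1, this.2.2, fun h => by linarith, fun h => by linarith⟩
        · rcases fe' p hp with h1 | h1
          · exact ⟨by linarith, by linarith, fun h => h1.1.le, fun h => by linarith⟩
          · exact ⟨by linarith, by linarith, fun h => h1.2.2, fun h => by linarith⟩
        · have := fa' p hp
          exact ⟨by linarith, by linarith, fun h => this.1.le, fun h => ⟨this.1, this.2.2.1⟩⟩
      refine hM.corner v (hUb.subset (hLB.trans hLS)) (hUc β hβC hβr) ?_ ?_ ?_ ?_
      · intro p h1 h2
        obtain ⟨h3, h4, h5, h6⟩ := fb p h1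
        have h7 := (fM p h2).2.2.2 h3
        rcases h6 with h6 | h6 <;> linarith
      · intro p h1 h2
        obtain ⟨h3, h4, h5, -⟩ := fM p h2
        rcases fc' p h1 with h6 | h6 | h6
        · linarith
        · linarith [h5 h6.1.le]
        · linarith
      · intro p h1 h2
        have := fb p h1
        rcases fc' p h2 with h3 | h3 | h3 <;> linarith
      · rintro p (h | h)
        · have := fb p h
          exact ⟨fun h => by linarith, fun h => by linarith⟩
        · rcases fc' p h with h3 | h3 | h3
          · exact ⟨fun h => by linarith, fun h => by linarith⟩
          · exact ⟨fun h => by linarith, fun h => by linarith⟩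
          · exact ⟨fun h => by linarith, fun h => by linarith⟩

/-! ### From drawings of rooted trees to drawings of graphs -/

/-- The root of a tree, if there is one. -/
def TTree.root : TTree V → Option V
  | nil => none
  | node v _ _ _ => some v

/-- The nodes of a tree. -/
def TTree.verts : TTree V → Set V
  | nil => ∅
  | node v a b c => {w | w = v ∨ w ∈ a.verts ∨ w ∈ b.verts ∨ w ∈ c.verts}

/-- The edge (if there is one) that joins `v` to the root of its subtree `T`. -/
def TTree.stem (v : V) (T : TTree V) : Set (Sym2 V) := {e | ∃ w, T.root = some w ∧ e = s(v, w)}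

/-- The edges of a tree. -/
def TTree.edges : TTree V → Set (Sym2 V)
  | nil => ∅
  | node v a b c => {e | (e ∈ a.stem v ∨ e ∈ a.edges) ∨ (e ∈ b.stem v ∨ e ∈ b.edges) ∨
      e ∈ c.stem v ∨ e ∈ c.edges}

/-- No label occurs twice in the tree. -/
def TTree.Nodup : TTree V → Prop
  | nil => True
  | node v a b c => (a.Nodup ∧ b.Nodup ∧ c.Nodup) ∧ (v ∉ a.verts ∧ v ∉ b.verts ∧ v ∉ c.verts) ∧
      (∀ w ∈ a.verts, w ∉ b.verts) ∧ (∀ w ∈ a.verts, w ∉ c.verts) ∧ ∀ w ∈ b.verts, w ∉ c.verts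

theorem TTree.root_mem {T : TTree V} {w : V} (h : T.root = some w) : w ∈ T.verts := by
  cases T with
  | nil => cases h
  | node v a b c =>
    cases h
    exact Or.inl rfl

theorem TTree.mem_verts_of_mem_edges {T : TTree V} {e : Sym2 V} (he : e ∈ T.edges) {w : V}
    (hw : w ∈ e) : w ∈ T.verts := by
  induction T with
  | nil => exact he.elim
  | node v a b c iha ihb ihc =>
    have key : ∀ {x : TTree V}, (e ∈ x.edges → w ∈ x.verts) → (e ∈ x.stem v ∨ e ∈ x.edges) →
        w = v ∨ w ∈ x.verts := by
      rintro x ih (⟨u, hu, rfl⟩ | h)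
      · rcases Sym2.mem_iff.1 hw with rfl | rfl
        · exact Or.inl rfl
        · exact Or.inr (root_mem hu)
      · exact Or.inr (ih h)
    rcases he with he | he | he
    · exact (key iha he).imp id Or.inl
    · exact (key ihb he).imp id fun h => Or.inr (Or.inl h)
    · exact (key ihc he).imp id fun h => Or.inr (Or.inr h)

/-- A planar L-shaped drawing with vertex set `X` and edge set `E` that lies in the region `K` and
whose vertices are points of `S`. -/
structure IsDrawing (S : Set (ℝ × ℝ)) (X : Set V) (E : Set (Sym2 V)) (K : Set (ℝ × ℝ))
    (pos : V → ℝ × ℝ) (bend : Sym2 V → ℝ × ℝ) : Prop where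
  pos_mem : ∀ v ∈ X, pos v ∈ S
  pos_mem_region : ∀ v ∈ X, pos v ∈ K
  inj : ∀ u ∈ X, ∀ v ∈ X, pos u = pos v → u = v
  ends : ∀ e ∈ E, ∀ v ∈ e, v ∈ X
  bend_eq : ∀ u v, s(u, v) ∈ E →
    bend s(u, v) = ((pos u).1, (pos v).2) ∨ bend s(u, v) = ((pos v).1, (pos u).2)
  curve : ∀ e ∈ E, edgeCurve pos (bend e) e ⊆ K
  vertex_mem : ∀ e ∈ E, ∀ w ∈ X, pos w ∈ edgeCurve pos (bend e) e → w ∈ e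
  edges_meet : ∀ e ∈ E, ∀ e' ∈ E, e ≠ e' → ∀ x ∈ edgeCurve pos (bend e) e,
    x ∈ edgeCurve pos (bend e') e' → ∃ v, v ∈ e ∧ v ∈ e' ∧ x = pos v

theorem edgeCurve_congr {pos pos' : V → ℝ × ℝ} {b : ℝ × ℝ} {e : Sym2 V}
    (h : ∀ v ∈ e, pos v = pos' v) : edgeCurve pos b e = edgeCurve pos' b e := by
  ext x
  constructor
  · rintro ⟨v, hv, hx⟩
    exact ⟨v, hv, by rwa [← h v hv]⟩
  · rintro ⟨v, hv, hx⟩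
    exact ⟨v, hv, by rwa [h v hv]⟩

theorem mem_segment_row {a b y : ℝ} {p : ℝ × ℝ} (h : p ∈ segment ℝ (a, y) (b, y)) :
    p.2 = y ∧ (a ≤ p.1 ∧ p.1 ≤ b ∨ b ≤ p.1 ∧ p.1 ≤ a) := by
  rw [← Prod.image_mk_segment_left] at h
  obtain ⟨x, hx, rfl⟩ := h
  rw [segment_eq_uIcc] at hx
  exact ⟨rfl, Set.mem_uIcc.1 hx⟩

theorem mem_segment_column {a b x : ℝ} {p : ℝ × ℝ} (h : p ∈ segment ℝ (x, a) (x, b)) :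
    p.1 = x ∧ (a ≤ p.2 ∧ p.2 ≤ b ∨ b ≤ p.2 ∧ p.2 ≤ a) := by
  rw [← Prod.image_mk_segment_right] at h
  obtain ⟨x, hx, rfl⟩ := h
  rw [segment_eq_uIcc] at hx
  exact ⟨rfl, Set.mem_uIcc.1 hx⟩

theorem edgeCurve_subset_hPath (pos : V → ℝ × ℝ) (u v : V) :
    edgeCurve pos ((pos v).1, (pos u).2) s(u, v) ⊆ hPath (pos u) (pos v) := by
  rintro p ⟨w, hw, hp⟩
  rcases Sym2.mem_iff.1 hw with rfl | rfl
  · exact Or.inl (mem_segment_row hp)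
  · exact Or.inr ((mem_segment_column hp).imp id Or.symm)

/-- Two drawings in disjoint regions, joined by an L-shaped edge that meets each of the regions in
one end point only, form a drawing. -/
theorem IsDrawing.glue {S : Set (ℝ × ℝ)} {X₁ X₂ : Set V} {E₁ E₂ : Set (Sym2 V)}
    {K₁ K₂ : Set (ℝ × ℝ)} {pos₁ pos₂ : V → ℝ × ℝ} {bend₁ bend₂ : Sym2 V → ℝ × ℝ}
    (h₁ : IsDrawing S X₁ E₁ K₁ pos₁ bend₁) (h₂ : IsDrawing S X₂ E₂ K₂ pos₂ bend₂)
    (hX : ∀ w ∈ X₁, w ∉ X₂) (hK : ∀ p ∈ K₁, p ∉ K₂) {u v : V} (hu : u ∈ X₁) (hv : v ∈ X₂)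
    {c : Set (ℝ × ℝ)} (hc : c = hPath (pos₁ u) (pos₂ v) ∨ c = hPath (pos₂ v) (pos₁ u))
    (hc₁ : ∀ p ∈ c, p ∈ K₁ → p = pos₁ u) (hc₂ : ∀ p ∈ c, p ∈ K₂ → p = pos₂ v) :
    ∃ pos bend, pos u = pos₁ u ∧ IsDrawing S {w | w ∈ X₁ ∨ w ∈ X₂}
      {e | e ∈ E₁ ∨ e = s(u, v) ∨ e ∈ E₂} {p | p ∈ K₁ ∨ p ∈ c ∨ p ∈ K₂} pos bend := by
  classical
  obtain ⟨b, hb, hbc⟩ : ∃ b : ℝ × ℝ, (b = ((pos₁ u).1, (pos₂ v).2) ∨ b = ((pos₂ v).1, (pos₁ u).2)) ∧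
      ∀ pos : V → ℝ × ℝ, pos u = pos₁ u → pos v = pos₂ v → edgeCurve pos b s(u, v) ⊆ c := by
    rcases hc with rfl | rfl
    · refine ⟨_, Or.inr rfl, fun pos h1 h2 => ?_⟩
      rw [← h1, ← h2]
      exact edgeCurve_subset_hPath pos u v
    · refine ⟨_, Or.inl rfl, fun pos h1 h2 => ?_⟩
      rw [← h1, ← h2, Sym2.eq_swap]
      exact edgeCurve_subset_hPath pos v u
  set pos : V → ℝ × ℝ := fun w => if w ∈ X₁ then pos₁ w else pos₂ w with hpos
  set bend : Sym2 V → ℝ × ℝ := fun e =>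
    if e ∈ E₁ then bend₁ e else if e ∈ E₂ then bend₂ e else b with hbend
  have p1 : ∀ w ∈ X₁, pos w = pos₁ w := fun w hw => if_pos hw
  have p2 : ∀ w ∈ X₂, pos w = pos₂ w := fun w hw => if_neg fun h => hX w h hw
  have e1 : ∀ e ∈ E₁, edgeCurve pos (bend e) e = edgeCurve pos₁ (bend₁ e) e := fun e he => by
    rw [show bend e = bend₁ e from if_pos he]
    exact edgeCurve_congr fun w hw => p1 w (h₁.ends e he w hw)
  have hE : ∀ e ∈ E₂, e ∉ E₁ := by
    intro e he he'
    obtain ⟨w, hw⟩ : ∃ w, w ∈ e := by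
      induction e with | _ x y => exact ⟨x, Sym2.mem_mk_left x y⟩
    exact hX w (h₁.ends e he' w hw) (h₂.ends e he w hw)
  have b2 : ∀ e ∈ E₂, bend e = bend₂ e := fun e he => by
    rw [hbend]
    simp only [if_neg (hE e he), if_pos he]
  have e2 : ∀ e ∈ E₂, edgeCurve pos (bend e) e = edgeCurve pos₂ (bend₂ e) e := fun e he => by
    rw [b2 e he]
    exact edgeCurve_congr fun w hw => p2 w (h₂.ends e he w hw)
  have n1 : s(u, v) ∉ E₁ := fun h => hX v (h₁.ends _ h v (Sym2.mem_mk_right u v)) hv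
  have n2 : s(u, v) ∉ E₂ := fun h => hX u hu (h₂.ends _ h u (Sym2.mem_mk_left u v))
  have b0 : bend s(u, v) = b := by
    rw [hbend]
    simp only [if_neg n1, if_neg n2]
  have e0 : edgeCurve pos (bend s(u, v)) s(u, v) ⊆ c := by
    rw [b0]
    exact hbc pos (p1 u hu) (p2 v hv)
  have m1 : ∀ e ∈ E₁, ∀ x ∈ edgeCurve pos (bend e) e, x ∈ K₁ := fun e he x hx =>
    h₁.curve e he (e1 e he ▸ hx)
  have m2 : ∀ e ∈ E₂, ∀ x ∈ edgeCurve pos (bend e) e, x ∈ K₂ := fun e he x hx =>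
    h₂.curve e he (e2 e he ▸ hx)
  -- a point of the new edge on an edge of one of the two parts is an end of both edges
  have x1 : ∀ e ∈ E₁, ∀ x ∈ edgeCurve pos (bend e) e, x ∈ edgeCurve pos (bend s(u, v)) s(u, v) →
      ∃ w, w ∈ e ∧ w ∈ s(u, v) ∧ x = pos w := by
    intro e he x hx hx'
    have hxu := hc₁ x (e0 hx') (m1 e he x hx)
    refine ⟨u, h₁.vertex_mem e he u hu ?_, Sym2.mem_mk_left u v, hxu.trans (p1 u hu).symm⟩
    rw [← hxu, ← e1 e he]
    exact hx
  have x2 : ∀ e ∈ E₂, ∀ x ∈ edgeCurve pos (bend e) e, x ∈ edgeCurve pos (bend s(u, v)) s(u, v) →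
      ∃ w, w ∈ e ∧ w ∈ s(u, v) ∧ x = pos w := by
    intro e he x hx hx'
    have hxu := hc₂ x (e0 hx') (m2 e he x hx)
    refine ⟨v, h₂.vertex_mem e he v hv ?_, Sym2.mem_mk_right u v, hxu.trans (p2 v hv).symm⟩
    rw [← hxu, ← e2 e he]
    exact hx
  refine ⟨pos, bend, p1 u hu, ?_, ?_, ?_, ?_, ?_, ?_, ?_, ?_⟩
  · rintro w (hw | hw)
    · exact p1 w hw ▸ h₁.pos_mem w hw
    · exact p2 w hw ▸ h₂.pos_mem w hw
  · rintro w (hw | hw)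
    · exact Or.inl (p1 w hw ▸ h₁.pos_mem_region w hw)
    · exact Or.inr (Or.inr (p2 w hw ▸ h₂.pos_mem_region w hw))
  · rintro w (hw | hw) w' (hw' | hw') h
    · exact h₁.inj w hw w' hw' (by rw [← p1 w hw, ← p1 w' hw', h])
    · have := h₂.pos_mem_region w' hw'
      rw [← p2 w' hw', ← h, p1 w hw] at this
      exact absurd this (hK _ (h₁.pos_mem_region w hw))
    · have := h₂.pos_mem_region w hw
      rw [← p2 w hw, h, p1 w' hw'] at this
      exact absurd this (hK _ (h₁.pos_mem_region w' hw'))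
    · exact h₂.inj w hw w' hw' (by rw [← p2 w hw, ← p2 w' hw', h])
  · rintro e (he | rfl | he) w hw
    · exact Or.inl (h₁.ends e he w hw)
    · rcases Sym2.mem_iff.1 hw with rfl | rfl
      · exact Or.inl hu
      · exact Or.inr hv
    · exact Or.inr (h₂.ends e he w hw)
  · rintro x y (he | he | he)
    · rw [show bend s(x, y) = bend₁ s(x, y) from if_pos he,
        p1 x (h₁.ends _ he x (Sym2.mem_mk_left x y)), p1 y (h₁.ends _ he y (Sym2.mem_mk_right x y))]
      exact h₁.bend_eq x y he
    · rw [he, b0]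
      rcases Sym2.eq_iff.1 he with ⟨rfl, rfl⟩ | ⟨rfl, rfl⟩
      · rwa [p1 x hu, p2 y hv]
      · rw [p1 y hu, p2 x hv]
        exact hb.symm
    · rw [b2 _ he, p2 x (h₂.ends _ he x (Sym2.mem_mk_left x y)),
        p2 y (h₂.ends _ he y (Sym2.mem_mk_right x y))]
      exact h₂.bend_eq x y he
  · rintro e (he | rfl | he) x hx
    · exact Or.inl (m1 e he x hx)
    · exact Or.inr (Or.inl (e0 hx))
    · exact Or.inr (Or.inr (m2 e he x hx))
  · rintro e (he | rfl | he) w (hw | hw) hx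
    · rw [e1 e he, p1 w hw] at hx
      exact h₁.vertex_mem e he w hw hx
    · have := m1 e he _ hx
      rw [p2 w hw] at this
      exact absurd (h₂.pos_mem_region w hw) (hK _ this)
    · have := e0 hx
      rw [p1 w hw] at this
      rw [h₁.inj w hw u hu (hc₁ _ this (h₁.pos_mem_region w hw))]
      exact Sym2.mem_mk_left u v
    · have := e0 hx
      rw [p2 w hw] at this
      rw [h₂.inj w hw v hv (hc₂ _ this (h₂.pos_mem_region w hw))]
      exact Sym2.mem_mk_right u v
    · have := m2 e he _ hx
      rw [p1 w hw] at this
      exact absurd this (hK _ (h₁.pos_mem_region w hw))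
    · rw [e2 e he, p2 w hw] at hx
      exact h₂.vertex_mem e he w hw hx
  · rintro e (he | rfl | he) e' (he' | rfl | he') hne x hx hx'
    · rw [e1 e he] at hx
      rw [e1 e' he'] at hx'
      obtain ⟨w, h1, h2, rfl⟩ := h₁.edges_meet e he e' he' hne x hx hx'
      exact ⟨w, h1, h2, (p1 w (h₁.ends e he w h1)).symm⟩
    · exact x1 e he x hx hx'
    · exact absurd (m2 e' he' x hx') (hK x (m1 e he x hx))
    · obtain ⟨w, h1, h2, h3⟩ := x1 e' he' x hx' hx
      exact ⟨w, h2, h1, h3⟩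
    · exact absurd rfl hne
    · obtain ⟨w, h1, h2, h3⟩ := x2 e' he' x hx' hx
      exact ⟨w, h2, h1, h3⟩
    · exact absurd (m2 e he x hx) (hK x (m1 e' he' x hx'))
    · exact x2 e he x hx hx'
    · rw [e2 e he] at hx
      rw [e2 e' he'] at hx'
      obtain ⟨w, h1, h2, rfl⟩ := h₂.edges_meet e he e' he' hne x hx hx'
      exact ⟨w, h1, h2, (p2 w (h₂.ends e he w h1)).symm⟩

theorem IsDrawing.congr {S : Set (ℝ × ℝ)} {X X' : Set V} {E E' : Set (Sym2 V)}
    {K K' : Set (ℝ × ℝ)} {pos : V → ℝ × ℝ} {bend : Sym2 V → ℝ × ℝ}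
    (h : IsDrawing S X E K pos bend) (hX : X = X') (hE : E = E') (hK : K = K') :
    IsDrawing S X' E' K' pos bend := by
  subst hX hE hK
  exact h

theorem Body.exists_isDrawing {S : Set (ℝ × ℝ)} {T : TTree V} :
    ∀ {t : ℝ × ℝ} {K : Set (ℝ × ℝ)}, T.Nodup → Body S T t K →
      ∃ pos bend, (∀ w, T.root = some w → pos w = t) ∧
        IsDrawing S T.verts T.edges K pos bend := by
  induction T with
  | nil => intro t K _ h; exact h.elim
  | node v a b c iha ihb ihc =>
    -- hanging one more subtree on `v`
    have key : ∀ {x : TTree V} {X : Set V} {E : Set (Sym2 V)} {K U : Set (ℝ × ℝ)}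
        {pos : V → ℝ × ℝ} {bend : Sym2 V → ℝ × ℝ},
        (∀ {t : ℝ × ℝ} {K : Set (ℝ × ℝ)}, x.Nodup → Body S x t K →
          ∃ pos bend, (∀ w, x.root = some w → pos w = t) ∧
            IsDrawing S x.verts x.edges K pos bend) →
        x.Nodup → IsDrawing S X E K pos bend → v ∈ X → (∀ w ∈ X, w ∉ x.verts) →
        (x = .nil ∧ U = ∅ ∨ Link (Body S x) (pos v) U) → (∀ p ∈ U, p ∉ K) →
        ∃ pos' bend', pos' v = pos v ∧ IsDrawing S {w | w ∈ X ∨ w ∈ x.verts}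
          {e | e ∈ E ∨ e ∈ x.stem v ∨ e ∈ x.edges} {p | p ∈ K ∨ p ∈ U} pos' bend' := by
      rintro x X E K U pos bend ih hx hD hv hX hU hUK
      rcases hU with ⟨rfl, rfl⟩ | ⟨t, L, e, hB, hne, he, heL, rfl⟩
      · refine ⟨pos, bend, rfl, hD.congr ?_ ?_ ?_⟩
        · simp [TTree.verts]
        · simp [TTree.edges, TTree.stem, TTree.root]
        · simp
      · obtain ⟨pos₂, bend₂, hr, hD₂⟩ := ih hx hB
        obtain ⟨w, hw⟩ : ∃ w, x.root = some w := by
          cases x with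
          | nil => exact hB.elim
          | node w _ _ _ => exact ⟨w, rfl⟩
        have hwt := hr w hw
        have hvK : pos v ∈ K := hD.pos_mem_region v hv
        have hve : pos v ∈ e := by
          rcases he with rfl | rfl
          · exact Or.inl ⟨rfl, (le_total _ _).imp (fun h => ⟨le_rfl, h⟩) fun h => ⟨h, le_rfl⟩⟩
          · exact Or.inr ⟨rfl, (le_total _ _).imp (fun h => ⟨h, le_rfl⟩) fun h => ⟨le_rfl, h⟩⟩
        obtain ⟨pos', bend', h1, h2⟩ := hD.glue hD₂ hX (u := v) (v := w) (c := e)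
          (fun p hp hp' => hUK p ⟨Or.inr hp', fun h => hne (heL _ hve (h ▸ hp'))⟩ hp) hv
          (TTree.root_mem hw) (by rwa [hwt])
          (fun p hp hp' => by
            by_contra h
            exact hUK p ⟨Or.inl hp, h⟩ hp')
          (fun p hp hp' => by rw [hwt]; exact heL p hp hp')
        refine ⟨pos', bend', h1, h2.congr rfl ?_ ?_⟩
        · ext d
          simp [TTree.stem, hw]
        · ext p
          simp only [Set.mem_ofPred_eq]
          by_cases hp : p = pos v
          · simp [hp, hvK]
          · simp [hp]
    rintro t K ⟨⟨ha, hb, hc⟩, ⟨hva, hvb, hvc⟩, hab, hac, hbc⟩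
      ⟨ht, Ua, Ub, Uc, hUa, hUb, hUc, dab, dac, dbc, rfl⟩
    have hne : ∀ {x : TTree V} {U : Set (ℝ × ℝ)}, Arm S x t U → ∀ p ∈ U, p ≠ t :=
      fun h p hp => h.ne hp
    have h0 : IsDrawing S {v} ∅ {t} (fun _ => t) (fun _ => t) :=
      { pos_mem := fun _ _ => ht
        pos_mem_region := fun _ _ => rfl
        inj := fun x hx y hy _ => by rw [hx, hy]
        ends := fun e he => he.elim
        bend_eq := fun x y he => he.elim
        curve := fun e he => he.elim
        vertex_mem := fun e he => he.elim
        edges_meet := fun e he => he.elim }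
    obtain ⟨p1, b1, r1, h1⟩ := key iha ha h0 rfl (fun w hw => by rwa [hw]) hUa
      (fun p hp => hne hUa p hp)
    rw [← r1] at hUb hUc
    obtain ⟨p2, b2, r2, h2⟩ := key ihb hb h1 (Or.inl rfl)
      (fun w hw => hw.elim (fun h => by rwa [h]) fun h => hab w h) hUb
      (by
        rintro p hp (h | h)
        · exact Arm.ne hUb hp (h.trans r1.symm)
        · exact dab p h hp)
    rw [← r2] at hUc
    obtain ⟨p3, b3, r3, h3⟩ := key ihc hc h2 (Or.inl (Or.inl rfl))
      (fun w hw => hw.elim (fun h => h.elim (fun h => by rwa [h]) fun h => hac w h)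
        fun h => hbc w h) hUc
      (by
        rintro p hp ((h | h) | h)
        · exact Arm.ne hUc hp (h.trans (r2.trans r1).symm)
        · exact dac p h hp
        · exact dbc p h hp)
    refine ⟨p3, b3, fun w hw => ?_, h3.congr ?_ ?_ ?_⟩
    · cases hw
      exact r3.trans (r2.trans r1)
    · ext w
      simp [TTree.verts, or_assoc]
    · ext e
      simp [TTree.edges, or_assoc]
    · ext p
      simp [or_assoc]

/-! ### Rooted trees from graphs -/

/-- A new leaf `y` can be added below the node `x` if `x` has a free place. The number of occupied
places is tested by sets `N` of neighbours of `x`; for a node other than the root these include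
the parent. -/
theorem TTree.exists_insert {y : V} {x : V} {T : TTree V} (hT : T.Nodup) (hx : x ∈ T.verts)
    (hy : y ∉ T.verts) (h3 : ∀ N : Finset V, (∀ w ∈ N, s(x, w) ∈ T.edges) → N.card ≤ 3)
    (h2 : T.root = some x → ∀ N : Finset V, (∀ w ∈ N, s(x, w) ∈ T.edges) → N.card ≤ 2) :
    ∃ T' : TTree V, T'.Nodup ∧ T'.verts = insert y T.verts ∧ T'.edges = insert s(x, y) T.edges ∧
      T'.size = T.size + 1 ∧ T'.root = T.root := by
  classical
  induction T with
  | nil => exact hx.elim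
  | node v a b c iha ihb ihc =>
    obtain ⟨⟨ha, hb, hc⟩, ⟨hva, hvb, hvc⟩, hab, hac, hbc⟩ := hT
    have hyv : y ≠ v := fun h => hy (Or.inl h)
    have hya : y ∉ a.verts := fun h => hy (Or.inr (Or.inl h))
    have hyb : y ∉ b.verts := fun h => hy (Or.inr (Or.inr (Or.inl h)))
    have hyc : y ∉ c.verts := fun h => hy (Or.inr (Or.inr (Or.inr h)))
    by_cases hxv : x = v
    · subst hxv
      have key : a = .nil ∨ b = .nil ∨ c = .nil := by
        cases a with
        | nil => exact Or.inl rfl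
        | node wa _ _ _ =>
          cases b with
          | nil => exact Or.inr (Or.inl rfl)
          | node wb _ _ _ =>
            cases c with
            | nil => exact Or.inr (Or.inr rfl)
            | node wc _ _ _ =>
              have hwab : wa ≠ wb := fun h => hab wa (Or.inl rfl) (Or.inl h)
              have hwac : wa ≠ wc := fun h => hac wa (Or.inl rfl) (Or.inl h)
              have hwbc : wb ≠ wc := fun h => hbc wb (Or.inl rfl) (Or.inl h)
              have := h2 rfl {wa, wb, wc} (by
                intro w hw
                simp only [Finset.mem_insert, Finset.mem_singleton] at hw
                rcases hw with rfl | rfl | rfl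
                · exact Or.inl (Or.inl ⟨w, rfl, rfl⟩)
                · exact Or.inr (Or.inl (Or.inl ⟨w, rfl, rfl⟩))
                · exact Or.inr (Or.inr (Or.inl ⟨w, rfl, rfl⟩)))
              rw [Finset.card_insert_of_notMem (by simp [hwab, hwac]),
                Finset.card_insert_of_notMem (by simp [hwbc]), Finset.card_singleton] at this
              omega
      have hleaf : ∀ w, w ∈ (TTree.node y .nil .nil .nil : TTree V).verts ↔ w = y := by
        simp [TTree.verts]
      have hstem : ∀ e, e ∈ (TTree.node y .nil .nil .nil : TTree V).stem x ↔ e = s(x, y) := by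
        simp [TTree.stem, TTree.root]
      have hnil : ∀ u e, e ∈ (TTree.nil : TTree V).stem u ↔ False := by
        simp [TTree.stem, TTree.root]
      have hlN : (TTree.node y .nil .nil .nil : TTree V).Nodup := by
        simp [TTree.Nodup, TTree.verts]
      rcases key with rfl | rfl | rfl
      · refine ⟨.node x (.node y .nil .nil .nil) b c, ⟨⟨hlN, hb, hc⟩, ⟨?_, hvb, hvc⟩, ?_, ?_, hbc⟩,
          ?_, ?_, ?_, rfl⟩
        · rw [hleaf]; exact hyv.symm
        · intro w hw; rw [hleaf] at hw; rwa [hw]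
        · intro w hw; rw [hleaf] at hw; rwa [hw]
        · ext w
          simp only [TTree.verts, Set.mem_ofPred_eq, Set.mem_insert_iff, Set.mem_empty_iff_false,
            or_false, false_or]
          ac_nf
        · ext e
          simp only [TTree.edges, hstem, hnil, Set.mem_ofPred_eq, Set.mem_insert_iff,
            Set.mem_empty_iff_false, or_false, false_or]
        · simp [TTree.size]; omega
      · refine ⟨.node x a (.node y .nil .nil .nil) c, ⟨⟨ha, hlN, hc⟩, ⟨hva, ?_, hvc⟩, ?_, hac, ?_⟩,
          ?_, ?_, ?_, rfl⟩
        · rw [hleaf]; exact hyv.symm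
        · intro w hw hw'; rw [hleaf] at hw'; exact hya (hw' ▸ hw)
        · intro w hw; rw [hleaf] at hw; rwa [hw]
        · ext w
          simp only [TTree.verts, Set.mem_ofPred_eq, Set.mem_insert_iff, Set.mem_empty_iff_false,
            or_false, false_or]
          ac_nf
        · ext e
          simp only [TTree.edges, hstem, hnil, Set.mem_ofPred_eq, Set.mem_insert_iff,
            Set.mem_empty_iff_false, or_false, false_or]
          ac_nf
        · simp [TTree.size]; omega
      · refine ⟨.node x a b (.node y .nil .nil .nil), ⟨⟨ha, hb, hlN⟩, ⟨hva, hvb, ?_⟩, hab, ?_, ?_⟩,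
          ?_, ?_, ?_, rfl⟩
        · rw [hleaf]; exact hyv.symm
        · intro w hw hw'; rw [hleaf] at hw'; exact hya (hw' ▸ hw)
        · intro w hw hw'; rw [hleaf] at hw'; exact hyb (hw' ▸ hw)
        · ext w
          simp only [TTree.verts, Set.mem_ofPred_eq, Set.mem_insert_iff, Set.mem_empty_iff_false,
            or_false]
          ac_nf
        · ext e
          simp only [TTree.edges, hstem, hnil, Set.mem_ofPred_eq, Set.mem_insert_iff,
            Set.mem_empty_iff_false, or_false]
          ac_nf
        · simp [TTree.size]
    · -- if `x` is the root of a child, its parent `v` occupies one of its places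
      have key : ∀ {d : TTree V}, v ∉ d.verts → (∀ e, e ∈ d.stem v ∨ e ∈ d.edges →
          e ∈ (TTree.node v a b c).edges) →
          (∀ N : Finset V, (∀ w ∈ N, s(x, w) ∈ d.edges) → N.card ≤ 3) ∧
          (d.root = some x → ∀ N : Finset V, (∀ w ∈ N, s(x, w) ∈ d.edges) → N.card ≤ 2) := by
        intro d hvd hd
        refine ⟨fun N hN => h3 N fun w hw => hd _ (Or.inr (hN w hw)), fun hr N hN => ?_⟩
        have hvN : v ∉ N := fun h =>
          hvd (TTree.mem_verts_of_mem_edges (hN v h) (Sym2.mem_mk_right x v))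
        have := h3 (insert v N) (fun w hw => by
          rcases Finset.mem_insert.1 hw with rfl | hw
          · exact hd _ (Or.inl ⟨x, hr, Sym2.eq_swap⟩)
          · exact hd _ (Or.inr (hN w hw)))
        rw [Finset.card_insert_of_notMem hvN] at this
        omega
      rcases hx with hx | hx | hx | hx
      · exact absurd hx hxv
      · obtain ⟨k3, k2⟩ := key hva fun e he => Or.inl he
        obtain ⟨a', h1, h2, h3, h4, h5⟩ := iha ha hx hya k3 k2
        refine ⟨.node v a' b c, ⟨⟨h1, hb, hc⟩, ⟨?_, hvb, hvc⟩, ?_, ?_, hbc⟩, ?_, ?_, ?_, rfl⟩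
        · rw [h2]; simp [hyv.symm, hva]
        · rw [h2]; rintro w (rfl | hw); exacts [hyb, hab w hw]
        · rw [h2]; rintro w (rfl | hw); exacts [hyc, hac w hw]
        · ext w
          simp only [TTree.verts, h2, Set.mem_ofPred_eq, Set.mem_insert_iff]
          ac_nf
        · ext e
          simp only [TTree.edges, TTree.stem, h5, h3, Set.mem_ofPred_eq, Set.mem_insert_iff]
          ac_nf
        · simp [TTree.size, h4]; omega
      · obtain ⟨k3, k2⟩ := key hvb fun e he => Or.inr (Or.inl he)
        obtain ⟨b', h1, h2, h3, h4, h5⟩ := ihb hb hx hyb k3 k2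
        refine ⟨.node v a b' c, ⟨⟨ha, h1, hc⟩, ⟨hva, ?_, hvc⟩, ?_, hac, ?_⟩, ?_, ?_, ?_, rfl⟩
        · rw [h2]; simp [hyv.symm, hvb]
        · rw [h2]; rintro w hw (rfl | hw'); exacts [hya hw, hab w hw hw']
        · rw [h2]; rintro w (rfl | hw); exacts [hyc, hbc w hw]
        · ext w
          simp only [TTree.verts, h2, Set.mem_ofPred_eq, Set.mem_insert_iff]
          ac_nf
        · ext e
          simp only [TTree.edges, TTree.stem, h5, h3, Set.mem_ofPred_eq, Set.mem_insert_iff]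
          ac_nf
        · simp [TTree.size, h4]; omega
      · obtain ⟨k3, k2⟩ := key hvc fun e he => Or.inr (Or.inr he)
        obtain ⟨c', h1, h2, h3, h4, h5⟩ := ihc hc hx hyc k3 k2
        refine ⟨.node v a b c', ⟨⟨ha, hb, h1⟩, ⟨hva, hvb, ?_⟩, hab, ?_, ?_⟩, ?_, ?_, ?_, rfl⟩
        · rw [h2]; simp [hyv.symm, hvc]
        · rw [h2]; rintro w hw (rfl | hw'); exacts [hya hw, hac w hw hw']
        · rw [h2]; rintro w hw (rfl | hw'); exacts [hyb hw, hbc w hw hw']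
        · ext w
          simp only [TTree.verts, h2, Set.mem_ofPred_eq, Set.mem_insert_iff]
          ac_nf
        · ext e
          simp only [TTree.edges, TTree.stem, h5, h3, Set.mem_ofPred_eq, Set.mem_insert_iff]
          ac_nf
        · simp [TTree.size, h4]; omega

/-- A tree graph of maximum degree at most `4` can be rooted in a vertex of degree at most `3`, and
then every node has at most three children. -/
theorem exists_ttree [Fintype V] (G : SimpleGraph V) [DecidableRel G.Adj] (hG : G.IsTree)
    (hdeg : ∀ v, G.degree v ≤ 4) :
    ∃ T : TTree V, T.Nodup ∧ T.verts = Set.univ ∧ G.edgeSet ⊆ T.edges ∧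
      T.size = Fintype.card V := by
  classical
  obtain ⟨r, hr⟩ : ∃ r, G.degree r ≤ 3 := by
    have := hG.1.nonempty
    rcases subsingleton_or_nontrivial V with h | h
    · refine ⟨Classical.arbitrary V, ?_⟩
      have := G.degree_lt_card_verts (Classical.arbitrary V)
      have := Fintype.card_le_one_iff_subsingleton.2 h
      omega
    · obtain ⟨r, hr⟩ := hG.exists_vert_degree_one_of_nontrivial
      exact ⟨r, by omega⟩
  -- subtrees of `G` with root `r` grow until they contain all vertices; the number of edges is
  -- recorded because it shows that in the end all edges of `G` are present
  have grow : ∀ k, k + 1 ≤ Fintype.card V → ∃ T : TTree V, T.Nodup ∧ T.root = some r ∧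
      T.size = k + 1 ∧ T.verts.ncard = k + 1 ∧ T.edges ⊆ G.edgeSet ∧ T.edges.ncard = k := by
    intro k
    induction k with
    | zero =>
      intro _
      refine ⟨.node r .nil .nil .nil, ?_, rfl, rfl, ?_, ?_, ?_⟩
      · simp [TTree.Nodup, TTree.verts]
      · simp [TTree.verts]
      · simp [TTree.edges, TTree.stem, TTree.root]
      · simp [TTree.edges, TTree.stem, TTree.root]
    | succ k ih =>
      intro hk
      obtain ⟨T, hT, hTr, hTs, hTv, hTE, hTe⟩ := ih (by omega)
      obtain ⟨z, hz⟩ : ∃ z, z ∉ T.verts := by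
        by_contra! h
        rw [Set.eq_univ_of_forall h, Set.ncard_univ, Nat.card_eq_fintype_card] at hTv
        omega
      obtain ⟨x, hx, y, hy, hxy⟩ : ∃ x ∈ T.verts, ∃ y ∉ T.verts, G.Adj x y := by
        obtain ⟨p⟩ := hG.1.preconnected r z
        obtain ⟨d, -, h1, h2⟩ := p.exists_boundary_dart T.verts (TTree.root_mem hTr) hz
        exact ⟨d.fst, h1, d.snd, h2, d.adj⟩
      have hN : ∀ N : Finset V, (∀ w ∈ N, s(x, w) ∈ T.edges) → N.card + 1 ≤ G.degree x := by
        intro N hN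
        have hyN : y ∉ N := fun h =>
          hy (TTree.mem_verts_of_mem_edges (hN y h) (Sym2.mem_mk_right x y))
        rw [← Finset.card_insert_of_notMem hyN, ← G.card_neighborFinset_eq_degree]
        refine Finset.card_le_card fun w hw => ?_
        rw [SimpleGraph.mem_neighborFinset]
        rcases Finset.mem_insert.1 hw with rfl | hw
        · exact hxy
        · exact hTE (hN w hw)
      obtain ⟨T', h1, h2, h3, h4, h5⟩ := TTree.exists_insert hT hx hy
        (fun N h => by have := hN N h; have := hdeg x; omega)
        (fun hxr N h => by
          rw [hTr] at hxr
          cases hxr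
          have := hN N h
          omega)
      refine ⟨T', h1, h5.trans hTr, by omega, ?_, ?_, ?_⟩
      · rw [h2, Set.ncard_insert_of_notMem hy, hTv]
      · rw [h3]
        exact Set.insert_subset hxy hTE
      · rw [h3, Set.ncard_insert_of_notMem
          (fun h => hy (TTree.mem_verts_of_mem_edges h (Sym2.mem_mk_right x y))), hTe]
  have hpos : 0 < Fintype.card V := Fintype.card_pos_iff.2 hG.1.nonempty
  obtain ⟨T, hT, hTr, hTs, hTv, hTE, hTe⟩ := grow (Fintype.card V - 1) (by omega)
  refine ⟨T, hT, ?_, ?_, by omega⟩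
  · refine Set.eq_of_subset_of_ncard_le (Set.subset_univ _) ?_
    rw [hTv, Set.ncard_univ, Nat.card_eq_fintype_card]
    omega
  · refine (Set.eq_of_subset_of_ncard_le hTE ?_).ge
    have := hG.card_edgeFinset
    rw [hTe, ← SimpleGraph.coe_edgeFinset, Set.ncard_coe_finset]
    omega

/-- A drawing of a rooted tree that contains all vertices and edges of `G` is a drawing of `G`. -/
theorem Body.planarLDrawing {G : SimpleGraph V} {P : Set (ℝ × ℝ)} {T : TTree V} (hT : T.Nodup)
    (hv : T.verts = Set.univ) (hE : G.edgeSet ⊆ T.edges) {t : ℝ × ℝ} {K : Set (ℝ × ℝ)}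
    (h : Body P T t K) : Nonempty (PlanarLDrawing G P) := by
  obtain ⟨pos, bend, -, hD⟩ := h.exists_isDrawing hT
  have hu : ∀ v, v ∈ T.verts := fun v => hv ▸ Set.mem_univ v
  exact ⟨{
    pos := pos
    pos_mem := fun v => hD.pos_mem v (hu v)
    pos_injective := fun u v h => hD.inj u (hu u) v (hu v) h
    bend := bend
    bend_eq := fun u v huv => hD.bend_eq u v (hE huv)
    vertex_mem := fun e he w hw => hD.vertex_mem e (hE he) w (hu w) hw
    edges_meet := fun e he e' he' => hD.edges_meet e (hE he) e' (hE he') }⟩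

/-! ### Ordering the children by size -/

/-- At every node the sizes of the three subtrees increase weakly. -/
def TTree.Sorted : TTree V → Prop
  | nil => True
  | node _ a b c => (a.Sorted ∧ b.Sorted ∧ c.Sorted) ∧ a.size ≤ b.size ∧ b.size ≤ c.size

theorem TTree.size_eq_zero {T : TTree V} (h : T.size = 0) : T = .nil := by
  cases T with
  | nil => rfl
  | node v a b c => simp [TTree.size] at h

theorem Body.swap_left {S : Set (ℝ × ℝ)} {v : V} {a b c : TTree V} {t : ℝ × ℝ} {K : Set (ℝ × ℝ)}
    (h : Body S (.node v a b c) t K) : Body S (.node v b a c) t K := by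
  obtain ⟨ht, Ua, Ub, Uc, ha, hb, hc, hab, hac, hbc, rfl⟩ := h
  refine ⟨ht, Ub, Ua, Uc, hb, ha, hc, fun p h h' => hab p h' h, hbc, hac, ?_⟩
  ext p
  simp only [Set.mem_ofPred_eq]
  tauto

theorem Body.swap_right {S : Set (ℝ × ℝ)} {v : V} {a b c : TTree V} {t : ℝ × ℝ} {K : Set (ℝ × ℝ)}
    (h : Body S (.node v a b c) t K) : Body S (.node v a c b) t K := by
  obtain ⟨ht, Ua, Ub, Uc, ha, hb, hc, hab, hac, hbc, rfl⟩ := h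
  refine ⟨ht, Ua, Uc, Ub, ha, hc, hb, hac, hab, fun p h h' => hbc p h' h, ?_⟩
  ext p
  simp only [Set.mem_ofPred_eq]
  tauto

/-- Reordering the children changes neither the size nor the drawings of a tree. -/
theorem TTree.exists_sorted (T : TTree V) : ∃ T' : TTree V, T'.Sorted ∧ T'.size = T.size ∧
    ∀ S t K, Body S T' t K → Body S T t K := by
  induction T with
  | nil => exact ⟨.nil, trivial, rfl, fun _ _ _ h => h⟩
  | node v a b c iha ihb ihc =>
    obtain ⟨a', sa, na, ha⟩ := iha
    obtain ⟨b', sb, nb, hb⟩ := ihb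
    obtain ⟨c', sc, nc, hc⟩ := ihc
    have key : ∀ S t K, Body S (.node v a' b' c') t K → Body S (.node v a b c) t K := by
      rintro S t K ⟨ht, Ua, Ub, Uc, h1, h2, h3, h⟩
      have aux : ∀ {x x' : TTree V} {U : Set (ℝ × ℝ)}, x'.size = x.size →
          (∀ S t K, Body S x' t K → Body S x t K) → (x' = .nil ∧ U = ∅ ∨ Link (Body S x') t U) →
          (x = .nil ∧ U = ∅ ∨ Link (Body S x) t U) := by
        intro x x' U hs hx hU
        refine hU.imp (fun h => ⟨TTree.size_eq_zero ?_, h.2⟩) (Link.mono (hx S))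
        rw [← hs, h.1]
        rfl
      exact ⟨ht, Ua, Ub, Uc, aux na ha h1, aux nb hb h2, aux nc hc h3, h⟩
    rcases le_total a'.size b'.size with h1 | h1
    · rcases le_total b'.size c'.size with h2 | h2
      · exact ⟨.node v a' b' c', ⟨⟨sa, sb, sc⟩, h1, h2⟩, by simp [TTree.size]; omega, key⟩
      · rcases le_total a'.size c'.size with h3 | h3
        · exact ⟨.node v a' c' b', ⟨⟨sa, sc, sb⟩, h3, h2⟩, by simp [TTree.size]; omega,
            fun S t K h => key S t K h.swap_right⟩
        · exact ⟨.node v c' a' b', ⟨⟨sc, sa, sb⟩, h3, h1⟩, by simp [TTree.size]; omega,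
            fun S t K h => key S t K h.swap_left.swap_right⟩
    · rcases le_total a'.size c'.size with h2 | h2
      · exact ⟨.node v b' a' c', ⟨⟨sb, sa, sc⟩, h1, h2⟩, by simp [TTree.size]; omega,
            fun S t K h => key S t K h.swap_left⟩
      · rcases le_total b'.size c'.size with h3 | h3
        · exact ⟨.node v b' c' a', ⟨⟨sb, sc, sa⟩, h3, h2⟩, by simp [TTree.size]; omega,
            fun S t K h => key S t K h.swap_right.swap_left⟩
        · exact ⟨.node v c' b' a', ⟨⟨sc, sb, sa⟩, h3, h1⟩, by simp [TTree.size]; omega,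
            fun S t K h => key S t K h.swap_left.swap_right.swap_left⟩

/-! ### Estimates for the power `31 / 20` -/

/-- The function `x ^ (31 / 20)`. -/
noncomputable def pw (x : ℝ) : ℝ := x ^ (31 / 20 : ℝ)

theorem pw_zero : pw 0 = 0 := Real.zero_rpow (by norm_num)

theorem pw_one : pw 1 = 1 := Real.one_rpow _

theorem pw_nonneg {x : ℝ} (hx : 0 ≤ x) : 0 ≤ pw x := Real.rpow_nonneg hx _

theorem pw_mono {x y : ℝ} (hx : 0 ≤ x) (h : x ≤ y) : pw x ≤ pw y :=
  Real.rpow_le_rpow hx h (by norm_num)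

theorem pw_mul {x y : ℝ} (hx : 0 ≤ x) (hy : 0 ≤ y) : pw (x * y) = pw x * pw y :=
  Real.mul_rpow hx hy

theorem pw_div_mul {x y : ℝ} (hx : 0 ≤ x) (hy : 0 < y) : pw x = pw y * pw (x / y) := by
  rw [← pw_mul hy.le (by positivity), mul_div_cancel₀ _ hy.ne']

/-- Numerical bounds for `pw` reduce to an inequality between integral powers. -/
theorem pw_le_of_pow_le {p b : ℝ} (hp : 0 ≤ p) (hb : 0 ≤ b) (h : p ^ 31 ≤ b ^ 20) : pw p ≤ b := by
  have h1 : pw p ^ 20 = p ^ 31 := by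
    rw [pw, ← Real.rpow_natCast, ← Real.rpow_mul hp, ← Real.rpow_natCast]
    norm_num
  rw [← h1] at h
  exact le_of_pow_le_pow_left₀ (by norm_num) hb h

theorem pw_add_le {x y : ℝ} (hx : 0 ≤ x) (hy : 0 ≤ y) : pw x + pw y ≤ pw (x + y) := by
  exact Real.add_rpow_le_rpow_add hx hy (by norm_num)

/-- By convexity `pw` lies below its chords. -/
theorem pw_le_chord {p q P Q x : ℝ} (hp : 0 ≤ p) (hpq : p < q) (hP : pw p ≤ P) (hQ : pw q ≤ Q)
    (h1 : p ≤ x) (h2 : x ≤ q) : pw x * (q - p) ≤ (q - x) * P + (x - p) * Q := by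
  have hd : 0 < q - p := by linarith
  have hc : pw (((q - x) / (q - p)) • p + ((x - p) / (q - p)) • q) ≤
      ((q - x) / (q - p)) • pw p + ((x - p) / (q - p)) • pw q :=
    (convexOn_rpow (by norm_num)).2 (Set.mem_Ici.2 hp) (Set.mem_Ici.2 (by linarith))
      (div_nonneg (by linarith) hd.le) (div_nonneg (by linarith) hd.le) (by field_simp; ring)
  have hx : ((q - x) / (q - p)) • p + ((x - p) / (q - p)) • q = x := by
    simp only [smul_eq_mul]
    field_simp
    ring
  rw [hx] at hc
  simp only [smul_eq_mul] at hc
  calc pw x * (q - p) ≤ ((q - x) / (q - p) * pw p + (x - p) / (q - p) * pw q) * (q - p) :=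
        mul_le_mul_of_nonneg_right hc hd.le
    _ = (q - x) * pw p + (x - p) * pw q := by field_simp
    _ ≤ (q - x) * P + (x - p) * Q :=
        add_le_add (mul_le_mul_of_nonneg_left hP (by linarith))
          (mul_le_mul_of_nonneg_left hQ (by linarith))

-- values at the end points of the chords that are used below
section Values

theorem pw_fifth : pw (1 / 5) ≤ 0.0826 := pw_le_of_pow_le (by norm_num) (by norm_num) (by norm_num)
theorem pw_four_fifths : pw (4 / 5) ≤ 0.7077 :=
  pw_le_of_pow_le (by norm_num) (by norm_num) (by norm_num)
theorem pw_third : pw (1 / 3) ≤ 0.1823 := pw_le_of_pow_le (by norm_num) (by norm_num) (by norm_num)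
theorem pw_two_thirds : pw (2 / 3) ≤ 0.5335 :=
  pw_le_of_pow_le (by norm_num) (by norm_num) (by norm_num)
theorem pw_93 : pw (93 / 100) ≤ 0.89362 := pw_le_of_pow_le (by norm_num) (by norm_num) (by norm_num)
theorem pw_7 : pw (7 / 100) ≤ 0.01622 := pw_le_of_pow_le (by norm_num) (by norm_num) (by norm_num)
theorem pw_5 : pw (1 / 20) ≤ 0.00965 := pw_le_of_pow_le (by norm_num) (by norm_num) (by norm_num)
theorem pw_45 : pw (9 / 20) ≤ 0.2901 := pw_le_of_pow_le (by norm_num) (by norm_num) (by norm_num)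
theorem pw_55 : pw (11 / 20) ≤ 0.396 := pw_le_of_pow_le (by norm_num) (by norm_num) (by norm_num)
theorem pw_half : pw (1 / 2) ≤ 0.3416 := pw_le_of_pow_le (by norm_num) (by norm_num) (by norm_num)
theorem pw_22 : pw (9 / 40) ≤ 0.0991 := pw_le_of_pow_le (by norm_num) (by norm_num) (by norm_num)
theorem pw_tenth : pw (1 / 10) ≤ 0.0282 := pw_le_of_pow_le (by norm_num) (by norm_num) (by norm_num)
theorem pw_47 : pw (19 / 40) ≤ 0.3155 := pw_le_of_pow_le (by norm_num) (by norm_num) (by norm_num)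
theorem pw_46 : pw (15 / 32) ≤ 0.3092 := pw_le_of_pow_le (by norm_num) (by norm_num) (by norm_num)
theorem pw_48 : pw (39 / 80) ≤ 0.3286 := pw_le_of_pow_le (by norm_num) (by norm_num) (by norm_num)

end Values

section WeightedSums

variable {x y z : ℝ}

/-! ### Weighted sums of powers

Here `x ≤ y ≤ z` are the sizes of the three subtrees of a node, relative to the size of the whole
tree. The summands are replaced by chords, which leaves linear inequalities. -/

theorem pw_sum_le (hx : 0 ≤ x) (hxy : x ≤ y) (hyz : y ≤ z) (hs : x + y + z ≤ 1) (hz : z ≤ 4 / 5) :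
    pw x + pw y + pw z ≤ 0.8 := by
  have h1 := pw_add_le hx (hx.trans hxy)
  rcases le_total (x + y) (1 / 5) with h | h
  · have h2 := (pw_mono (by linarith) h).trans pw_fifth
    have h3 := (pw_mono (by linarith) hz).trans pw_four_fifths
    linarith
  · have h2 := pw_le_chord (x := x + y) (by norm_num) (by norm_num) pw_fifth pw_two_thirds h
      (by linarith)
    have h3 := pw_le_chord (x := 1 - (x + y)) (by norm_num) (by norm_num) pw_third pw_four_fifths
      (by linarith) (by linarith)
    have h4 := pw_mono (x := z) (y := 1 - (x + y)) (by linarith) (by linarith)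
    linarith

theorem pw_sum_le_of_large (hx : 0 ≤ x) (hy : 0 ≤ y) (hs : x + y + z ≤ 1) (hz : 4 / 5 ≤ z) :
    pw z + 2.5 * (pw x + pw y) ≤ 1 := by
  have h1 := pw_add_le hx hy
  have h2 := pw_le_chord (x := x + y) le_rfl (by norm_num) pw_zero.le pw_fifth
    (by linarith) (by linarith)
  have h3 := pw_le_chord (x := 1 - (x + y)) (by norm_num) (by norm_num) pw_four_fifths pw_one.le
    (by linarith) (by linarith)
  have h4 := pw_mono (x := z) (y := 1 - (x + y)) (by linarith) (by linarith)
  linarith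

theorem pw_weighted_le_of_middle (hx : 0 ≤ x) (hxy : x ≤ y) (hyz : y ≤ z) (hs : x + y + z ≤ 1)
    (hy : y ≤ 9 / 20) : 2 * pw x + 2 * pw y + pw z ≤ 1 := by
  have h4 := pw_mono (x := z) (y := 1 - (x + y)) (by linarith) (by linarith)
  rcases le_total (x + y) (9 / 20) with h | h
  · have h1 := pw_add_le hx (hx.trans hxy)
    have h2 := pw_le_chord (x := x + y) le_rfl (by norm_num) pw_zero.le pw_45 (by linarith) h
    have h3 := pw_le_chord (x := 1 - (x + y)) (by norm_num) (by norm_num) pw_55 pw_one.le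
      (by linarith) (by linarith)
    linarith
  · have h1 := pw_le_chord (x := x) le_rfl (by norm_num) pw_zero.le pw_third hx (by linarith)
    have h2 := pw_le_chord (x := y) (by norm_num) (by norm_num) pw_22 pw_45 (by linarith) hy
    have h3 := pw_le_chord (x := 1 - (x + y)) (by norm_num) (by norm_num) pw_third pw_55
      (by linarith) (by linarith)
    linarith

theorem pw_weighted_le_of_small (hx : 1 / 20 ≤ x) (hyz : y ≤ z) (hs : x + y + z ≤ 1)
    (hy : 9 / 20 ≤ y) : 2 * pw x + 2 * pw y + pw z ≤ 1 := by
  have h1 := pw_le_chord (x := x) (by norm_num) (by norm_num) pw_5 pw_tenth hx (by linarith)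
  have h2 := pw_le_chord (x := y) (by norm_num) (by norm_num) pw_45 pw_47 hy (by linarith)
  have h3 := pw_le_chord (x := z) (by norm_num) (by norm_num) pw_45 pw_half (by linarith)
    (by linarith)
  linarith

/-- The coefficient `1.831` comes from `pw_weighted_le_of_spread`, applied to the subtrees of the
node of relative size `y`. The slack `0.02` absorbs the additive constants of the constructions. -/
theorem pw_weighted_le_of_balanced (hx : 0 ≤ x) (hx' : x ≤ 1 / 20) (hy : 9 / 20 ≤ y) (hyz : y ≤ z)
    (hs : x + y + z ≤ 1) : 6 * pw x + 1.831 * pw y + pw z ≤ 0.98 := by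
  have h1 := pw_le_chord (x := x) le_rfl (by norm_num) pw_zero.le pw_5 hx hx'
  have h2 := pw_le_chord (x := y) (by norm_num) (by norm_num) pw_45 pw_half hy (by linarith)
  have h3 := pw_le_chord (x := z) (by norm_num) (by norm_num) pw_45 pw_55 (by linarith)
    (by linarith)
  linarith

/-- The coefficient `1.6` comes from `pw_weighted_le_of_concentrated`, applied to the subtrees of
the node of relative size `y`. -/
theorem pw_weighted_le_of_balanced' (hx : 0 ≤ x) (hx' : x ≤ 1 / 20) (hy : 9 / 20 ≤ y) (hyz : y ≤ z)
    (hs : x + y + z ≤ 1) : 8 * pw x + 1.6 * pw y + pw z ≤ 0.97 := by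
  have h1 := pw_le_chord (x := x) le_rfl (by norm_num) pw_zero.le pw_5 hx hx'
  have h2 := pw_le_chord (x := y) (by norm_num) (by norm_num) pw_45 pw_half hy (by linarith)
  have h3 := pw_le_chord (x := z) (by norm_num) (by norm_num) pw_45 pw_55 (by linarith)
    (by linarith)
  linarith

theorem pw_weighted_le_of_spread (hx : 0 ≤ x) (hxy : x ≤ y) (hyz : y ≤ z) (hs : x + y + z ≤ 1)
    (hz : z ≤ 93 / 100) : 4 * pw x + 2 * pw y + 2 * pw z ≤ 1.831 := by
  have h0 : 0 ≤ x + y := by linarith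
  have h1 := pw_add_le hx (hx.trans hxy)
  have h2 : pw x ≤ 0.3416 * pw (x + y) := by
    refine (pw_mono hx (show x ≤ 1 / 2 * (x + y) by linarith)).trans ?_
    rw [pw_mul (by norm_num) h0]
    exact mul_le_mul_of_nonneg_right pw_half (pw_nonneg h0)
  rcases le_total (x + y) (7 / 100) with h | h
  · have h3 := (pw_mono h0 h).trans pw_7
    have h4 := (pw_mono (by linarith) hz).trans pw_93
    linarith
  · have h3 := pw_le_chord (x := x + y) (by norm_num) (by norm_num) pw_7 pw_two_thirds h
      (by linarith)
    have h4 := pw_le_chord (x := 1 - (x + y)) (by norm_num) (by norm_num) pw_third pw_93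
      (by linarith) (by linarith)
    have h5 := pw_mono (x := z) (y := 1 - (x + y)) (by linarith) (by linarith)
    linarith

theorem pw_weighted_le_of_concentrated (hx : 0 ≤ x) (hy : 0 ≤ y) (hs : x + y + z ≤ 1)
    (hz : 93 / 100 ≤ z) : 8 * pw x + 6 * pw y + 1.6 * pw z ≤ 1.6 := by
  have h1 := pw_add_le hx hy
  have h0 := pw_nonneg hy
  have h2 := pw_le_chord (x := x + y) le_rfl (by norm_num) pw_zero.le pw_7 (by linarith)
    (by linarith)
  have h3 := pw_le_chord (x := 1 - (x + y)) (by norm_num) (by norm_num) pw_93 pw_one.le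
    (by linarith) (by linarith)
  have h4 := pw_mono (x := z) (y := 1 - (x + y)) (by linarith) (by linarith)
  linarith

end WeightedSums

theorem pw_seventeen : 80 ≤ pw 17 := by
  have h : pw (1 / 17) ≤ 1 / 80 := pw_le_of_pow_le (by norm_num) (by norm_num) (by norm_num)
  have h1 : pw 17 * pw (1 / 17) = 1 := by
    rw [← pw_mul (by norm_num) (by norm_num)]
    norm_num [pw_one]
  have h2 := pw_nonneg (x := 17) (by norm_num)
  nlinarith [mul_le_mul_of_nonneg_left h h2]

/-! ### Capacities of sorted trees -/

/-- The tree `T` with `n` nodes can be hung on a point from any set of at least `2 n ^ 1.55 - 1`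
points, in the sense of `Hcap`. -/
def HBound (T : TTree V) : Prop :=
  ∃ m : ℕ, Hcap T m ∧ (m : ℝ) ≤ 2 * pw T.size ∧ (T.size ≠ 0 → (m : ℝ) ≤ 2 * pw T.size - 1)

/-- The tree `T` with `n` nodes can be drawn, with the ray from its root upwards left free, on any
set of at least `1.6 n ^ 1.55 - 0.6` points, in the sense of `Fcap`. -/
def FBound (T : TTree V) : Prop :=
  T.size ≠ 0 → ∃ m : ℕ, Fcap T m ∧ (m : ℝ) ≤ 1.6 * pw T.size - 0.6

theorem HBound.nil : HBound (.nil : TTree V) :=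
  ⟨0, Hcap.nil, by simp [TTree.size, pw_zero], fun h => absurd rfl h⟩

theorem HBound.of_hcap {T : TTree V} {m : ℕ} (h : Hcap T m) (hm : (m : ℝ) ≤ 2 * pw T.size - 1) :
    HBound T :=
  ⟨m, h, by linarith, fun _ => hm⟩

theorem pw_add_one_le {n : ℕ} : pw n + 1 ≤ pw ((n : ℝ) + 1) := by
  have := pw_add_le (x := n) (y := 1) (Nat.cast_nonneg n) zero_le_one
  rwa [pw_one] at this

theorem div_sum_le_one {x y z n : ℝ} (hn : 0 < n) (h : x + y + z ≤ n) :
    x / n + y / n + z / n ≤ 1 := by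
  rw [← add_div, ← add_div, div_le_one hn]
  exact h

/-- If the subtree `C` has more than four fifths of all nodes, or is the only one, it is drawn below
the root by `Fcap.node_of_lower`; otherwise the strips of `Fcap.node_of_strips` suffice. -/
theorem FBound.node (v : V) {A B C : TTree V} (hA : HBound A) (hB : HBound B) (hC : HBound C)
    (hCf : FBound C) (hAB : A.size ≤ B.size) (hBC : B.size ≤ C.size) :
    FBound (.node v A B C) := by
  intro _
  obtain ⟨a, hA, ha, -⟩ := hA
  obtain ⟨b, hB, hb, hb'⟩ := hB
  obtain ⟨c, hC, hc, hc'⟩ := hC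
  have hsize : ((TTree.node v A B C).size : ℝ) = 1 + A.size + B.size + C.size := by
    simp [TTree.size]
  rw [hsize]
  have hab : (A.size : ℝ) ≤ B.size := Nat.cast_le.2 hAB
  have hbc : (B.size : ℝ) ≤ C.size := Nat.cast_le.2 hBC
  have ha0 : (0 : ℝ) ≤ A.size := Nat.cast_nonneg _
  set N : ℝ := 1 + A.size + B.size + C.size with hN
  have hNpos : 0 < N := by linarith
  rcases Nat.eq_zero_or_pos B.size with h2 | h2
  · have h1 : A.size = 0 := by omega
    rw [h1] at ha
    rw [h2] at hb
    simp only [Nat.cast_zero, pw_zero, mul_zero] at ha hb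
    rcases Nat.eq_zero_or_pos C.size with h3 | h3
    · rw [h3] at hc
      simp only [Nat.cast_zero, pw_zero, mul_zero] at hc
      refine ⟨_, Fcap.node_of_strips v hA hB hC, ?_⟩
      have : N = 1 := by simp [hN, h1, h2, h3]
      rw [this, pw_one]
      push_cast
      linarith
    · obtain ⟨f, hf, hfb⟩ := hCf (by omega)
      refine ⟨_, Fcap.node_of_lower v hA hB hf, ?_⟩
      have : N = C.size + 1 := by simp [hN, h1, h2, add_comm]
      have := pw_add_one_le (n := C.size)
      rw [‹N = _›]
      push_cast
      linarith
  · have hb'' := hb' (by omega)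
    have hc'' := hc' (by omega)
    have e1 := pw_div_mul ha0 hNpos
    have e2 := pw_div_mul (ha0.trans hab) hNpos
    have e3 := pw_div_mul (ha0.trans (hab.trans hbc)) hNpos
    have hw := pw_nonneg hNpos.le
    have hs := div_sum_le_one (x := A.size) (y := B.size) (z := C.size) hNpos (by linarith)
    rcases le_total ((C.size : ℝ) / N) (4 / 5) with h | h
    · refine ⟨_, Fcap.node_of_strips v hA hB hC, ?_⟩
      have := mul_le_mul_of_nonneg_left (pw_sum_le (div_nonneg ha0 hNpos.le)
        (div_le_div_of_nonneg_right hab hNpos.le) (div_le_div_of_nonneg_right hbc hNpos.le) hs h) hw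
      push_cast
      linarith
    · obtain ⟨f, hf, hfb⟩ := hCf (by omega)
      refine ⟨_, Fcap.node_of_lower v hA hB hf, ?_⟩
      have := mul_le_mul_of_nonneg_left (pw_sum_le_of_large (div_nonneg ha0 hNpos.le)
        (div_nonneg (ha0.trans hab) hNpos.le) hs h) hw
      push_cast
      linarith

theorem Hcap.node_of_strips (v : V) {A B C : TTree V} {a b c : ℕ} (hA : Hcap A a) (hB : Hcap B b)
    (hC : Hcap C c) : Hcap (.node v A B C) (c + 2 * a + 2 * b + 1) :=
  (Hcap.node_of_corner v (CornerCap.of_strip hA hB) hC).mono (by omega)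

/-- `Hcap.node_of_strips` suffices unless the subtree `A` is small and `B` and `C` have about half
the size of the tree each. In this case `B` is taken apart: `CornerCap.node_of_left` is used if
its largest subtree `C'` makes up almost all of `B`, and `CornerCap.node_of_strips` otherwise. -/
theorem HBound.node (v : V) {A B C : TTree V} (hA : HBound A) (hB : HBound B) (hC : HBound C)
    (hAB : A.size ≤ B.size) (hBC : B.size ≤ C.size)
    (hB' : ∀ u A' B' C', B = .node u A' B' C' → HBound A' ∧ HBound B' ∧ HBound C' ∧ FBound C' ∧
      A'.size ≤ B'.size ∧ B'.size ≤ C'.size) :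
    HBound (.node v A B C) := by
  obtain ⟨a, hA, ha, -⟩ := hA
  obtain ⟨b, hB, hb, hb'⟩ := hB
  obtain ⟨c, hC, hc, hc'⟩ := hC
  have hsize : ((TTree.node v A B C).size : ℝ) = 1 + A.size + B.size + C.size := by
    simp [TTree.size]
  have hab : (A.size : ℝ) ≤ B.size := Nat.cast_le.2 hAB
  have hbc : (B.size : ℝ) ≤ C.size := Nat.cast_le.2 hBC
  have ha0 : (0 : ℝ) ≤ A.size := Nat.cast_nonneg _
  set N : ℝ := 1 + A.size + B.size + C.size with hN
  have hNpos : 0 < N := by linarith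
  rcases Nat.eq_zero_or_pos B.size with h2 | h2
  · refine .of_hcap (Hcap.node_of_strips v hA hB hC) ?_
    rw [hsize]
    have h1 : A.size = 0 := by omega
    rw [h1] at ha
    rw [h2] at hb
    simp only [Nat.cast_zero, pw_zero, mul_zero] at ha hb
    have : N = C.size + 1 := by simp [hN, h1, h2, add_comm]
    rw [this]
    have := pw_add_one_le (n := C.size)
    push_cast
    rcases Nat.eq_zero_or_pos C.size with h3 | h3
    · rw [h3] at hc this ⊢
      simp only [Nat.cast_zero, pw_zero, mul_zero, zero_add, pw_one] at hc this ⊢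
      linarith
    · linarith [hc' (by omega)]
  have hb'' := hb' (by omega)
  have hc'' := hc' (by omega)
  have e1 := pw_div_mul ha0 hNpos
  have e2 := pw_div_mul (ha0.trans hab) hNpos
  have e3 := pw_div_mul (ha0.trans (hab.trans hbc)) hNpos
  have hw := pw_nonneg hNpos.le
  have hs := div_sum_le_one (x := A.size) (y := B.size) (z := C.size) hNpos (by linarith)
  have d0 := div_nonneg ha0 hNpos.le
  have d1 := div_le_div_of_nonneg_right hab hNpos.le
  have d2 := div_le_div_of_nonneg_right hbc hNpos.le
  by_cases hstrip : 2 * pw (A.size / N) + 2 * pw (B.size / N) + pw (C.size / N) ≤ 1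
  · refine .of_hcap (Hcap.node_of_strips v hA hB hC) ?_
    rw [hsize]
    have := mul_le_mul_of_nonneg_left hstrip hw
    push_cast
    linarith
  have hy : 9 / 20 < (B.size : ℝ) / N := by
    by_contra! h
    exact hstrip (pw_weighted_le_of_middle d0 d1 d2 hs h)
  have hx : (A.size : ℝ) / N < 1 / 20 := by
    by_contra! h
    exact hstrip (pw_weighted_le_of_small h d2 hs hy.le)
  have hy' := (lt_div_iff₀ hNpos).1 hy
  have hx' := (div_lt_iff₀ hNpos).1 hx
  -- in a small tree `A` would be empty and the sizes of `B` and `C` would be well below half of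
  -- `N`, so that the strips suffice
  have h17 : 17 ≤ N := by
    by_contra! hlt
    have hlt' : 1 + A.size + B.size + C.size < 17 := by
      have : ((1 + A.size + B.size + C.size : ℕ) : ℝ) < (17 : ℕ) := by push_cast; exact hlt
      exact_mod_cast this
    have hA0 : A.size = 0 := by
      by_contra h
      have : (1 : ℝ) ≤ A.size := Nat.one_le_cast.2 (by omega)
      linarith
    have hle : N ≤ 16 := by
      have : ((1 + A.size + B.size + C.size : ℕ) : ℝ) ≤ (16 : ℕ) := Nat.cast_le.2 (by omega)
      push_cast at this
      exact this
    rw [hA0, Nat.cast_zero] at hN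
    have q1 : (B.size : ℝ) / N ≤ 15 / 32 := by
      rw [div_le_iff₀ hNpos]
      linarith
    have q2 : (C.size : ℝ) / N ≤ 39 / 80 := by
      rw [div_le_iff₀ hNpos]
      linarith
    refine hstrip ?_
    rw [hA0, Nat.cast_zero, zero_div, pw_zero]
    have := (pw_mono (by linarith) q1).trans pw_46
    have := (pw_mono (by linarith) q2).trans pw_48
    linarith
  have hw80 : 80 ≤ pw N := pw_seventeen.trans (pw_mono (by norm_num) h17)
  cases B with
  | nil => exact absurd h2 (lt_irrefl 0)
  | node u A' B' C' =>
    obtain ⟨hA', hB', hC', hCf', hAB', hBC'⟩ := hB' u A' B' C' rfl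
    obtain ⟨a', hA', ha', -⟩ := hA'
    obtain ⟨b', hB', hb', -⟩ := hB'
    obtain ⟨c', hC', -, hc'⟩ := hC'
    have hBsize : ((TTree.node u A' B' C').size : ℝ) = 1 + A'.size + B'.size + C'.size := by
      simp [TTree.size]
    have hab' : (A'.size : ℝ) ≤ B'.size := Nat.cast_le.2 hAB'
    have hbc' : (B'.size : ℝ) ≤ C'.size := Nat.cast_le.2 hBC'
    have ha0' : (0 : ℝ) ≤ A'.size := Nat.cast_nonneg _
    set M : ℝ := ((TTree.node u A' B' C').size : ℝ) with hM
    have hMpos : 0 < M := by linarith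
    have hC0 : C'.size ≠ 0 := by
      intro h
      rw [h, Nat.cast_zero] at hbc'
      rw [h, Nat.cast_zero] at hBsize
      linarith
    have hc'' := hc' hC0
    have e1' := pw_div_mul ha0' hMpos
    have e2' := pw_div_mul (ha0'.trans hab') hMpos
    have e3' := pw_div_mul (ha0'.trans (hab'.trans hbc')) hMpos
    have hwM := pw_nonneg hMpos.le
    have hs' := div_sum_le_one (x := A'.size) (y := B'.size) (z := C'.size) hMpos (by linarith)
    have d0' := div_nonneg ha0' hMpos.le
    have d1' := div_le_div_of_nonneg_right hab' hMpos.le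
    have d2' := div_le_div_of_nonneg_right hbc' hMpos.le
    rcases le_total ((C'.size : ℝ) / M) (93 / 100) with h | h
    · refine .of_hcap (Hcap.node_of_corner v (CornerCap.node_of_strips u hA hA' hB' hC') hC
        |>.mono (show _ ≤ c + 2 * c' + 2 * b' + 6 * a + 4 * a' + 5 by omega)) ?_
      rw [hsize]
      have k1 := mul_le_mul_of_nonneg_left (pw_weighted_le_of_spread d0' d1' d2' hs' h) hwM
      have k2 := mul_le_mul_of_nonneg_left
        (pw_weighted_le_of_balanced d0 hx.le hy.le d2 hs) hw
      push_cast
      linarith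
    · obtain ⟨f, hf, hfb⟩ := hCf' hC0
      refine .of_hcap (Hcap.node_of_corner v (CornerCap.node_of_left u hA hA' hB' hf) hC
        |>.mono (show _ ≤ c + 2 * f + 8 * a + 8 * a' + 6 * b' + 5 by omega)) ?_
      rw [hsize]
      have k1 := mul_le_mul_of_nonneg_left
        (pw_weighted_le_of_concentrated d0' (d0'.trans d1') hs' h) hwM
      have k2 := mul_le_mul_of_nonneg_left
        (pw_weighted_le_of_balanced' d0 hx.le hy.le d2 hs) hw
      push_cast
      linarith

/-- The bounds for the subtrees of the root are carried along because the bound for a node uses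
those for its grandchildren. -/
theorem TTree.Sorted.bounds {T : TTree V} (hT : T.Sorted) : HBound T ∧ FBound T ∧
    ∀ u A B C, T = .node u A B C → HBound A ∧ HBound B ∧ HBound C ∧ FBound C ∧
      A.size ≤ B.size ∧ B.size ≤ C.size := by
  induction T with
  | nil => exact ⟨.nil, fun h => absurd rfl h, fun _ _ _ _ h => by cases h⟩
  | node v a b c iha ihb ihc =>
    obtain ⟨⟨sa, sb, sc⟩, hab, hbc⟩ := hT
    obtain ⟨ha, -, -⟩ := iha sa
    obtain ⟨hb, -, hb'⟩ := ihb sb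
    obtain ⟨hc, hcf, -⟩ := ihc sc
    refine ⟨.node v ha hb hc hab hbc hb', .node v ha hb hc hcf hab hbc, fun u A B C h => ?_⟩
    cases h
    exact ⟨ha, hb, hc, hcf, hab, hbc⟩

end

theorem mainTheorem1 {V : Type*} [Fintype V] (T : SimpleGraph V) [DecidableRel T.Adj]
    (hT : T.IsTree) (hdeg : ∀ v, T.degree v ≤ 4)
    (P : Finset (ℝ × ℝ)) (hP : GeneralOrthogonalPosition (P : Set (ℝ × ℝ)))
    (hcard : 2 * (Fintype.card V : ℝ) ^ (1.55 : ℝ) ≤ (P.card : ℝ)) :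
    Nonempty (PlanarLDrawing T (P : Set (ℝ × ℝ))) := by
  obtain ⟨R, hR, hverts, hedges, hsize⟩ := exists_ttree T hT hdeg
  obtain ⟨R', hsorted, hsize', hbody⟩ := R.exists_sorted
  have hpos : 0 < Fintype.card V := Fintype.card_pos_iff.2 hT.1.nonempty
  obtain ⟨-, hF, -⟩ := hsorted.bounds
  obtain ⟨m, hm, hmle⟩ := hF (by omega)
  have h : (2 : ℝ) * pw R'.size ≤ P.card := by
    rw [hsize', hsize, pw]
    norm_num at hcard ⊢
    exact hcard
  have hmP : m ≤ P.card := by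
    have : (m : ℝ) ≤ P.card := by linarith [pw_nonneg (Nat.cast_nonneg R'.size)]
    exact_mod_cast this
  obtain ⟨t, K, hB, -⟩ := hm P hP hmP
  exact (hbody _ _ _ hB).planarLDrawing hR hverts hedges
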